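/- **Setting.** Let $\rho$ be a measure on $\mathbb R$ that is not concentrated on a single point (in particular $\rho\neq 0$), let $b(\theta)=\log\int e^{\theta x}\,d\rho(x)$, and let $\Theta^o$ be the interior of $\{\theta:\int e^{\theta x}d\rho(x)<\infty\}$. For $\theta\in\Theta^o$ let $d\nu_\theta(x)=e^{\theta x-b(\theta)}d\rho(x)$, whose mean is $b'(\theta)$, and let $\mathcal S=b'(\Theta^o)$. Members of this family are identified with their means; for $m,m'\in\mathcal S$, $d(m,m')$ denotes the Kullback–Leibler divergence between the members with means $m$ and $m'$. Let $K\ge 2$, $\mu=(\mu_1,\dots,\mu_K)\in\mathcal S^K$ with $\mu_1>\max_{a\ge 2}\mu_a$ (the best arm is called arm $1$ without loss of generality), and $\alpha\in(0,1)$. For $\nu\in\mathcal S^K$, weights $w\in\mathbb R_{\ge0}^K$ and arms $i\ne a$ put $x_{i,a}(\nu,w)=\frac{w_i\nu_i+w_a\nu_a}{w_i+w_a}$ and $$W_{i,a}(\nu,w)=w_i\,d(\nu_i,x_{i,a}(\nu,w))+w_a\,d(\nu_a,x_{i,a}(\nu,w)),$$ and, if $\nu$ has a unique largest coordinate $\nu_j$,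 define the anchor function $$g(\nu,w)=\sum_{a\neq j}\frac{d(\nu_j,x_{j,a}(\nu,w))}{d(\nu_a,x_{j,a}(\nu,w))}-1 .$$ **Algorithms (run without stopping).** At each iteration $N\ge1$ an arm $A_N$ is chosen on the basis of the past and a reward $X_N$ is drawn, which given the past and $A_N$ has the law of the member of the family with mean $\mu_{A_N}$. Let $\widetilde N_a(N)$ be the number of pulls of arm $a$ in iterations $1,\dots,N$, $\widetilde\mu_a(N)$ its sample mean, $\widetilde\omega_a(N)=\widetilde N_a(N)/N$, and $\hat\imath_N$ an arm with the largest $\widetilde\mu_a(N)$. In both the AT2 and the IAT2 algorithm $A_N$ is chosen as follows, with arbitrary tie breaking. * If some arm has $\widetilde N_a(N-1)<N^\alpha$, then $A_N\in\arg\min_{a}\widetilde N_a(N-1)$. * Otherwise, if $g(\widetilde\mu(N-1),\widetilde N(N-1))>0$, then $A_N=\hat\imath_{N-1}$. * Otherwise $A_N$ minimises over $a\ne\hat\imath_{N-1}$ the empirical index $W_{\hat\imath_{N-1},a}(\widetilde\mu(N-1),\widetilde N(N-1))$ (AT2), respectively that index plus $\log\widetilde N_a(N-1)$ (IAT2). In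 the last two cases, if some sample mean is not in $\mathcal S$ or the largest sample mean is not unique, so that the rule is undefined, the choice of $A_N$ is arbitrary. **Proposition 5.1.** There is a constant $C_2>0$, depending only on the family, $\mu$, $\alpha$ and $K$, such that for each of the two algorithms there is a random time $T_{stable}$ with $\mathbb E_\mu[T_{stable}]<\infty$ such that, almost surely, for all $N\ge T_{stable}$, $$|g(\mu,\widetilde\omega(N))|=\Big|\sum_{a\ne1}\frac{d(\mu_1,x_{1,a}(N))}{d(\mu_a,x_{1,a}(N))}-1\Big|\le C_2N^{-3\alpha/8},\qquad x_{1,a}(N)=x_{1,a}(\mu,\widetilde N(N)),$$ and $$\max_{a,b\in\{2,\dots,K\}}|I_a(N)-I_b(N)|\le C_2N^{1-3\alpha/8},$$ where $I_a(N)$ denotes the index of arm $a$ at the true means, and the bound holds both for $I_a(N)=W_{1,a}(\mu,\widetilde N(N))$ and for $I_a(N)=W_{\hat\imath_N,a}(\mu,\widetilde N(N))$ with any empirically best arm $\hat\imath_N$ (for $a=\hat\imath_N$ the same formulas are used, with $x_{a,a}=\mu_a$). -/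

import Mathlib

open MeasureTheory ProbabilityTheory Filter

noncomputable section

namespace AnchoredTop2

/-! ### Single parameter exponential families -/

/-- The open parameter set `Θ°`: the interior of `{θ | ∫ exp (θ x) dρ < ∞}`. -/
def paramSet (ρ : Measure ℝ) : Set ℝ := interior (integrableExpSet id ρ)

/-- The set `S` of means of the family: the image of `Θ°` under `b'`, where
`b θ = log ∫ exp (θ x) dρ` is the log-moment generating function of `ρ`. -/
def meanSet (ρ : Measure ℝ) : Set ℝ := deriv (cgf id ρ) '' paramSet ρ

/-- The natural parameter `θ_m ∈ Θ°` with `b' θ_m = m`, for `m ∈ S`. -/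
def natParam (ρ : Measure ℝ) (m : ℝ) : ℝ :=
  Function.invFunOn (deriv (cgf id ρ)) (paramSet ρ) m

/-- The member of the family with mean `m ∈ S`: the probability measure
`exp (θ_m x - b θ_m) dρ(x)`. -/
def armLaw (ρ : Measure ℝ) (m : ℝ) : Measure ℝ := ρ.tilted (fun x => natParam ρ m * x)

/-- `d(m, m')`: the Kullback-Leibler divergence between the members of the family with means
`m` and `m'`. -/
def kl (ρ : Measure ℝ) (m m' : ℝ) : ℝ :=
  (InformationTheory.klDiv (armLaw ρ m) (armLaw ρ m')).toReal

/-! ### Anchor function and indexes -/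

variable {K : ℕ}

/-- The weighted mean `(w_i ν_i + w_a ν_a) / (w_i + w_a)`. -/
def mix (ν w : Fin K → ℝ) (i a : Fin K) : ℝ := (w i * ν i + w a * ν a) / (w i + w a)

/-- The anchor function `g(ν, w)`, where `i` is the arm with the largest `ν`. -/
def anchor (ρ : Measure ℝ) (i : Fin K) (ν w : Fin K → ℝ) : ℝ :=
  ∑ a ∈ Finset.univ.erase i, kl ρ (ν i) (mix ν w i a) / kl ρ (ν a) (mix ν w i a) - 1

/-- The index `w_i d(ν_i, x) + w_a d(ν_a, x)` of arm `a` against arm `i`, with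
`x = (w_i ν_i + w_a ν_a) / (w_i + w_a)`. -/
def index (ρ : Measure ℝ) (ν w : Fin K → ℝ) (i a : Fin K) : ℝ :=
  w i * kl ρ (ν i) (mix ν w i a) + w a * kl ρ (ν a) (mix ν w i a)

/-! ### The two algorithms -/

/-- The two sampling rules. -/
inductive Rule where
  | at2
  | iat2

/-- The quantity that the challenger arm minimises: the empirical index for AT2, and the empirical
index plus the logarithm of the number of pulls for IAT2. -/
def score (ρ : Measure ℝ) (r : Rule) (ν w : Fin K → ℝ) (i a : Fin K) : ℝ :=
  match r with
  | Rule.at2 => index ρ ν w i a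
  | Rule.iat2 => index ρ ν w i a + Real.log (w a)

/-- Arm `c` is an admissible choice at iteration `N`, when `n` and `m` are the numbers of pulls and
the sample means after iteration `N - 1`. Ties in every `argmin` are broken arbitrarily.
When no arm is under-explored but the rule is not defined (a sample mean is not in `S`, so that `d`
is not defined there, or the largest sample mean is not unique, so that the anchor function is not
defined), any choice is admissible. -/
def IsChoice (ρ : Measure ℝ) (r : Rule) (α : ℝ) (N : ℕ) (n : Fin K → ℕ) (m : Fin K → ℝ)
    (c : Fin K) : Prop :=
  ((∃ a, (n a : ℝ) < (N : ℝ) ^ α) → ∀ b, n c ≤ n b) ∧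
  ((∀ a, (N : ℝ) ^ α ≤ (n a : ℝ)) → (∀ a, m a ∈ meanSet ρ) →
    ∀ i, (∀ b, b ≠ i → m b < m i) →
      (0 < anchor ρ i m (fun a => (n a : ℝ)) → c = i) ∧
      (anchor ρ i m (fun a => (n a : ℝ)) ≤ 0 →
        c ≠ i ∧ ∀ b, b ≠ i →
          score ρ r m (fun a => (n a : ℝ)) i c ≤ score ρ r m (fun a => (n a : ℝ)) i b))

/-- The number of pulls of arm `a` in iterations `1, …, N` along the action sequence `s`. -/
def pulls (s : ℕ → Fin K) (N : ℕ) (a : Fin K) : ℕ :=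
  ((Finset.Icc 1 N).filter (fun t => s t = a)).card

/-- The sample mean of arm `a` after iteration `N`, for actions `s` and rewards `x`. -/
def sampleMean (s : ℕ → Fin K) (x : ℕ → ℝ) (N : ℕ) (a : Fin K) : ℝ :=
  (∑ t ∈ (Finset.Icc 1 N).filter (fun t => s t = a), x t) / (pulls s N a : ℝ)

/-- The proportion of the first `N` samples that is allocated to arm `a`. -/
def proportion (s : ℕ → Fin K) (N : ℕ) (a : Fin K) : ℝ := (pulls s N a : ℝ) / (N : ℝ)

/-- `(A, X)` is a run (never stopped) of the rule `r` with exploration parameter `α` on the instance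
with mean vector `μ`: `A N` and `X N` are the arm pulled and the reward obtained at iteration
`N ≥ 1`, and `𝓕 N` is the information available after iteration `N`. The arm `A (N + 1)` is chosen
from `𝓕 N`, the reward `X (N + 1)` given `𝓕 N` is distributed as the arm `A (N + 1)`, and all
choices obey the rule. -/
structure IsRun {Ω : Type*} [mΩ : MeasurableSpace Ω] (ρ : Measure ℝ) (r : Rule) (α : ℝ)
    (μ : Fin K → ℝ) (P : Measure Ω) (𝓕 : Filtration ℕ mΩ)
    (A : ℕ → Ω → Fin K) (X : ℕ → Ω → ℝ) : Prop where
  measurable_action : ∀ N, Measurable[𝓕 N] (A (N + 1))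
  measurable_reward : ∀ N, Measurable[𝓕 (N + 1)] (X (N + 1))
  reward_law : ∀ N, ∀ B : Set ℝ, MeasurableSet B →
    P⟦X (N + 1) ⁻¹' B | 𝓕 N⟧ =ᵐ[P] fun ω => (armLaw ρ (μ (A (N + 1) ω))).real B
  choice : ∀ᵐ ω ∂P, ∀ N, IsChoice ρ r α (N + 1) (pulls (fun t => A t ω) N)
    (sampleMean (fun t => A t ω) (fun t => X t ω) N) (A (N + 1) ω)

end AnchoredTop2

end

/-!
# Stability of anchored top-two algorithms

*Structure of the family.* On a compact interval of means the Kullback-Leibler divergence is a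
Bregman divergence with curvature bounded above and below (`exists_isBregman_kl`). All that is used
about the family follows from this: with `s = n_a / n_i` the ratio of the pulls of a challenger `a` to
those of the best arm `i`, the anchor term `d(μ_i, x) / d(μ_a, x)` and the normalised index
`W_a / n_i` are functions of `s` and the two means. The former is comparable to `s ^ 2`, the latter
lies between multiples of `s / (1 + s)` and of `s`, and on compact ranges of `s` both are increasing
and bi-Lipschitz in `s` and Lipschitz in the means (`RateBounds`).

*Dynamics along one path.* Suppose that from iteration `T₀` on the sample means are within
`N ^ (-3 α / 8)` of the means. The best arm is pulled only if the anchor function is nonnegative, the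
others only if it is nonpositive, so that the best arm and some challenger have linearly many pulls;
comparing indexes at the last pull of that challenger shows that all arms do
(`exists_forall_mul_le_pulls`), and forced exploration stops. From then on, the anchor function is
controlled at the last pull of the best arm, after which it only increases, and at the last pull of a
challenger, after which it only decreases (`Settled.abs_anchorSum_sub_one_le`).

For the indexes, consider the last pull of a challenger `a` before `N`. Its index was minimal then,
up to the error in the means, and it has grown since only through pulls of the best arm. If there
had been many of those, the anchor term of `a` would have dropped, and, the anchor function being
close to zero, the term of some other challenger `b` would have risen. So `b` would have been pulled, at
a time when its index was at most that of `a`, although it had been at least that of `a` at the start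
and had increased substantially in between. Therefore few pulls of the best arm separate `N` from the
last pull of any challenger (`Settled.one_sub_div_le`), and all indexes are close
(`Settled.exists_cost_le`). The time this takes is polynomial in `T₀` (`exists_forall_stable`).

*Probability.* Forced exploration gives at least `(N / 2) ^ α` pulls of every arm
(`exists_forall_rpow_le_pulls`). An exponential supermartingale then bounds the probability of a
deviation by `N ^ (-3 α / 8)` by a multiple of `exp (-c N ^ (α / 4))`
(`IsRun.measure_deviationSet_le`), so the last time of a deviation has finite moments of all orders
(`exists_random_time`).
-/

namespace AnchoredTop2

/-! ### The log-moment generating function and the mean parametrisation -/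

section ExponentialFamily

variable {ρ : Measure ℝ}

lemma ne_zero_of_not_ae_eq_const (hρ : ∀ c : ℝ, ¬ ∀ᵐ x ∂ρ, x = c) : NeZero ρ :=
  ⟨fun h => hρ 0 (by simp [h])⟩

lemma integrable_exp_mul_of_mem_paramSet {t : ℝ} (ht : t ∈ paramSet ρ) :
    Integrable (fun x : ℝ => Real.exp (t * x)) ρ :=
  interior_subset (s := integrableExpSet id ρ) ht

lemma isOpen_paramSet : IsOpen (paramSet ρ) := isOpen_interior

lemma convex_paramSet : Convex ℝ (paramSet ρ) := convex_integrableExpSet.interior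

lemma analyticAt_deriv_cgf {t : ℝ} (ht : t ∈ paramSet ρ) :
    AnalyticAt ℝ (deriv (cgf id ρ)) t :=
  (analyticAt_cgf (X := id) ht).deriv

/-- `b''` is the variance of a tilt of `ρ`, and it vanishes only if `ρ` sits on one point. -/
lemma deriv_deriv_cgf_pos (hρ : ∀ c : ℝ, ¬ ∀ᵐ x ∂ρ, x = c) {t : ℝ} (ht : t ∈ paramSet ρ) :
    0 < deriv (deriv (cgf id ρ)) t := by
  have := ne_zero_of_not_ae_eq_const hρ
  have hint := integrable_exp_mul_of_mem_paramSet ht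
  have h2 : Var[(id : ℝ → ℝ); ρ.tilted (fun x => t * id x)] = deriv (deriv (cgf id ρ)) t := by
    rw [variance_tilted_mul (X := id) ht, iteratedDeriv_succ, iteratedDeriv_one]
  have : IsProbabilityMeasure (ρ.tilted (fun x => t * id x)) := isProbabilityMeasure_tilted hint
  rw [← h2]
  refine lt_of_le_of_ne (variance_nonneg _ _) fun h0 => ?_
  have h3 := ae_eq_integral_of_variance_eq_zero (memLp_tilted_mul (X := id) ht 2) h0.symm
  exact hρ _ ((absolutelyContinuous_tilted hint).ae_le h3)

lemma strictMonoOn_deriv_cgf (hρ : ∀ c : ℝ, ¬ ∀ᵐ x ∂ρ, x = c) :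
    StrictMonoOn (deriv (cgf id ρ)) (paramSet ρ) := by
  refine strictMonoOn_of_deriv_pos convex_paramSet
    (fun t ht => (analyticAt_deriv_cgf ht).continuousAt.continuousWithinAt) fun t ht => ?_
  exact deriv_deriv_cgf_pos hρ (interior_subset ht)

lemma natParam_mem {m : ℝ} (hm : m ∈ meanSet ρ) : natParam ρ m ∈ paramSet ρ :=
  Function.invFunOn_mem hm

lemma deriv_cgf_natParam {m : ℝ} (hm : m ∈ meanSet ρ) : deriv (cgf id ρ) (natParam ρ m) = m :=
  Function.invFunOn_eq hm

lemma natParam_le_natParam (hρ : ∀ c : ℝ, ¬ ∀ᵐ x ∂ρ, x = c) {x y : ℝ} (hx : x ∈ meanSet ρ)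
    (hy : y ∈ meanSet ρ) (hxy : x ≤ y) : natParam ρ x ≤ natParam ρ y := by
  rw [← (strictMonoOn_deriv_cgf hρ).le_iff_le (natParam_mem hx) (natParam_mem hy),
    deriv_cgf_natParam hx, deriv_cgf_natParam hy]
  exact hxy

lemma Icc_subset_paramSet {s t : ℝ} (hs : s ∈ paramSet ρ) (ht : t ∈ paramSet ρ) :
    Set.Icc s t ⊆ paramSet ρ :=
  convex_paramSet.ordConnected.out hs ht

lemma isProbabilityMeasure_armLaw (hρ : ∀ c : ℝ, ¬ ∀ᵐ x ∂ρ, x = c) {m : ℝ}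
    (hm : m ∈ meanSet ρ) : IsProbabilityMeasure (armLaw ρ m) := by
  have := ne_zero_of_not_ae_eq_const hρ
  exact isProbabilityMeasure_tilted (integrable_exp_mul_of_mem_paramSet (natParam_mem hm))

/-- The Kullback-Leibler divergence of the family as the Bregman divergence of `b`. -/
lemma kl_eq (hρ : ∀ c : ℝ, ¬ ∀ᵐ x ∂ρ, x = c) {m m' : ℝ} (hm : m ∈ meanSet ρ)
    (hm' : m' ∈ meanSet ρ) :
    kl ρ m m' = (natParam ρ m - natParam ρ m') * m - cgf id ρ (natParam ρ m)
      + cgf id ρ (natParam ρ m') := by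
  have hne := ne_zero_of_not_ae_eq_const hρ
  set s := natParam ρ m with hs
  set t := natParam ρ m' with ht
  have his := integrable_exp_mul_of_mem_paramSet (natParam_mem hm)
  have hit := integrable_exp_mul_of_mem_paramSet (natParam_mem hm')
  have hp := isProbabilityMeasure_armLaw hρ hm
  have hp' := isProbabilityMeasure_armLaw hρ hm'
  have htilt : armLaw ρ m = (armLaw ρ m').tilted (fun x => (s - t) * x) := by
    rw [armLaw, armLaw, tilted_tilted hit]
    congr 1
    ext x
    simp only [Pi.add_apply]
    ring
  have hint : Integrable (fun x => Real.exp ((s - t) * x)) (armLaw ρ m') := by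
    rw [armLaw, integrable_tilted_iff hit]
    refine his.congr (Eventually.of_forall fun x => ?_)
    simp only [smul_eq_mul]
    rw [← Real.exp_add]
    congr 1
    ring
  have hac : armLaw ρ m ≪ armLaw ρ m' := by
    rw [htilt]
    exact tilted_absolutelyContinuous _ _
  have hlog : Real.log (∫ x, Real.exp ((s - t) * x) ∂(armLaw ρ m'))
      = cgf id ρ s - cgf id ρ t := by
    rw [armLaw, integral_exp_tilted (fun x => t * x) (fun x => (s - t) * x),
      Real.log_div (integral_exp_pos ?_).ne' (integral_exp_pos hit).ne']
    · simp only [cgf, mgf, id]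
      congr 3
      ext x
      simp only [Pi.add_apply]
      ring_nf
    · refine his.congr (Eventually.of_forall fun x => ?_)
      simp only [Pi.add_apply]
      congr 1
      rw [← hs]
      ring
  have hllr : llr (armLaw ρ m) (armLaw ρ m') =ᵐ[armLaw ρ m]
      fun x => (s - t) * x - (cgf id ρ s - cgf id ρ t) := by
    refine hac.ae_le ?_
    have h := log_rnDeriv_tilted_left_self hint
    rw [← htilt, hlog] at h
    exact h
  have hmean : ∫ x, x ∂(armLaw ρ m) = m := by
    have h := integral_tilted_mul_self (X := id) (natParam_mem hm)
    rw [deriv_cgf_natParam hm] at h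
    exact h
  have hid : Integrable (fun x : ℝ => x) (armLaw ρ m) :=
    (memLp_tilted_mul (X := id) (natParam_mem hm) 1).integrable le_rfl
  rw [kl, InformationTheory.toReal_klDiv_of_measure_eq hac (by simp), integral_congr_ae hllr,
    integral_sub (hid.const_mul _) (integrable_const _), integral_const_mul, hmean]
  simp
  ring

/-- A uniform bound of the log-moment generating function of a centred arm near zero, in the form
in which the exponential supermartingale uses it. -/
lemma lintegral_exp_armLaw_le (hρ : ∀ c : ℝ, ¬ ∀ᵐ x ∂ρ, x = c) {m : ℝ} (hm : m ∈ meanSet ρ) :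
    ∃ δ C : ℝ, 0 < δ ∧ 0 < C ∧ ∀ l : ℝ, |l| ≤ δ →
      ∫⁻ x, ENNReal.ofReal (Real.exp (l * (x - m) - C * l ^ 2)) ∂(armLaw ρ m) ≤ 1 := by
  have hne := ne_zero_of_not_ae_eq_const hρ
  set θ := natParam ρ m with hθ
  have hθm := natParam_mem hm
  obtain ⟨δ, hδ, hball⟩ := Metric.isOpen_iff.1 isOpen_paramSet θ hθm
  have hsub : Set.Icc (θ - δ / 2) (θ + δ / 2) ⊆ paramSet ρ := fun x hx => hball (by
    rw [Metric.mem_ball, Real.dist_eq, abs_lt]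
    constructor <;> linarith [hx.1, hx.2])
  obtain ⟨V, hV⟩ := (isCompact_Icc (a := θ - δ / 2) (b := θ + δ / 2)).exists_bound_of_continuousOn
    (f := deriv (deriv (cgf id ρ)))
    (fun x hx => (analyticAt_deriv_cgf (hsub hx)).deriv.continuousAt.continuousWithinAt)
  have hmemθ : θ ∈ Set.Icc (θ - δ / 2) (θ + δ / 2) := ⟨by linarith, by linarith⟩
  have hV0 : 0 ≤ V := (norm_nonneg _).trans (hV θ hmemθ)
  have hup : ∀ x ∈ Set.Icc (θ - δ / 2) (θ + δ / 2), ∀ y ∈ Set.Icc (θ - δ / 2) (θ + δ / 2), x ≤ y →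
      deriv (cgf id ρ) y - deriv (cgf id ρ) x ≤ V * (y - x) := by
    refine (convex_Icc _ _).image_sub_le_mul_sub_of_deriv_le
      (fun x hx => (analyticAt_deriv_cgf (hsub hx)).continuousAt.continuousWithinAt)
      (fun x hx => (analyticAt_deriv_cgf
        (hsub (interior_subset hx))).differentiableAt.differentiableWithinAt)
      fun x hx => (le_abs_self _).trans (hV x (interior_subset hx))
  have hmono := (strictMonoOn_deriv_cgf hρ).monotoneOn
  have hkey : ∀ l : ℝ, |l| ≤ δ / 2 →
      cgf id ρ (θ + l) - cgf id ρ θ ≤ l * m + (V + 1) * l ^ 2 := by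
    intro l hl
    have hl' := abs_le.1 hl
    have hmem : θ + l ∈ Set.Icc (θ - δ / 2) (θ + δ / 2) := ⟨by linarith, by linarith⟩
    rcases le_total 0 l with h0 | h0
    · have hs : Set.Icc θ (θ + l) ⊆ paramSet ρ := Icc_subset_paramSet hθm (hsub hmem)
      have h1 := (convex_Icc θ (θ + l)).image_sub_le_mul_sub_of_deriv_le (f := cgf id ρ)
        (C := deriv (cgf id ρ) (θ + l))
        (fun x hx => (analyticAt_cgf (X := id) (hs hx)).continuousAt.continuousWithinAt)
        (fun x hx => (analyticAt_cgf (X := id)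
          (hs (interior_subset hx))).differentiableAt.differentiableWithinAt)
        (fun x hx => hmono (hs (interior_subset hx)) (hsub hmem) (interior_subset hx).2)
        θ ⟨le_rfl, by linarith⟩ (θ + l) ⟨by linarith, le_rfl⟩ (by linarith)
      have h2 := hup θ hmemθ (θ + l) hmem (by linarith)
      rw [deriv_cgf_natParam hm] at h2
      nlinarith
    · have hs : Set.Icc (θ + l) θ ⊆ paramSet ρ := Icc_subset_paramSet (hsub hmem) hθm
      have h1 := (convex_Icc (θ + l) θ).mul_sub_le_image_sub_of_le_deriv (f := cgf id ρ)
        (C := deriv (cgf id ρ) (θ + l))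
        (fun x hx => (analyticAt_cgf (X := id) (hs hx)).continuousAt.continuousWithinAt)
        (fun x hx => (analyticAt_cgf (X := id)
          (hs (interior_subset hx))).differentiableAt.differentiableWithinAt)
        (fun x hx => hmono (hsub hmem) (hs (interior_subset hx)) (interior_subset hx).1)
        (θ + l) ⟨le_rfl, by linarith⟩ θ ⟨by linarith, le_rfl⟩ (by linarith)
      have h2 := hup (θ + l) hmem θ hmemθ (by linarith)
      rw [deriv_cgf_natParam hm] at h2
      nlinarith
  refine ⟨δ / 2, V + 1, by linarith, by linarith, fun l hl => ?_⟩
  have hl' := abs_le.1 hl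
  have hiθ := integrable_exp_mul_of_mem_paramSet hθm
  have hmem : θ + l ∈ Set.Icc (θ - δ / 2) (θ + δ / 2) := ⟨by linarith, by linarith⟩
  have hil := integrable_exp_mul_of_mem_paramSet (hsub hmem)
  have hfun : ∀ x : ℝ, Real.exp (θ * x) * Real.exp (l * (x - m) - (V + 1) * l ^ 2)
      = Real.exp (-(l * m + (V + 1) * l ^ 2)) * Real.exp ((θ + l) * x) := fun x => by
    rw [← Real.exp_add, ← Real.exp_add]
    congr 1
    ring
  have hint : Integrable (fun x => Real.exp (l * (x - m) - (V + 1) * l ^ 2)) (armLaw ρ m) := by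
    rw [armLaw, integrable_tilted_iff hiθ]
    simp only [smul_eq_mul]
    simp_rw [← hθ, hfun]
    exact hil.const_mul _
  rw [← ofReal_integral_eq_lintegral_ofReal hint (Eventually.of_forall fun x => (Real.exp_pos _).le),
    ← ENNReal.ofReal_one]
  refine ENNReal.ofReal_le_ofReal ?_
  have hval : ∫ x, Real.exp (l * (x - m) - (V + 1) * l ^ 2) ∂(armLaw ρ m)
      = Real.exp (-(l * m + (V + 1) * l ^ 2)) * Real.exp (cgf id ρ (θ + l))
        / Real.exp (cgf id ρ θ) := by
    rw [exp_cgf (X := id) hil, exp_cgf (X := id) hiθ, armLaw, integral_tilted]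
    simp only [smul_eq_mul]
    simp_rw [div_mul_eq_mul_div]
    rw [integral_div]
    simp_rw [← hθ, hfun]
    rw [integral_const_mul]
    rfl
  rw [hval, ← Real.exp_add, ← Real.exp_sub, Real.exp_le_one_iff]
  linarith [hkey l hl]

end ExponentialFamily

/-! ### Bregman divergences with bounded curvature -/

/-- On the interval `[lo, hi]`, `D` is the Bregman divergence of a convex function, written in mean
coordinates: `θ m` is the natural parameter of mean `m` and `B m` the value of the convex function
there. The map `θ` is bi-Lipschitz with constants `k₁` and `k₂`, and `slope` says that the mean is
the slope of the convex function. -/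
structure IsBregman (D : ℝ → ℝ → ℝ) (θ B : ℝ → ℝ) (lo hi k₁ k₂ : ℝ) : Prop where
  k₁_pos : 0 < k₁
  apply_eq : ∀ m ∈ Set.Icc lo hi, ∀ x ∈ Set.Icc lo hi, D m x = (θ m - θ x) * m - B m + B x
  lower : ∀ x ∈ Set.Icc lo hi, ∀ y ∈ Set.Icc lo hi, x ≤ y → k₁ * (y - x) ≤ θ y - θ x
  upper : ∀ x ∈ Set.Icc lo hi, ∀ y ∈ Set.Icc lo hi, x ≤ y → θ y - θ x ≤ k₂ * (y - x)
  slope : ∀ x ∈ Set.Icc lo hi, ∀ y ∈ Set.Icc lo hi, x ≤ y →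
    x * (θ y - θ x) ≤ B y - B x ∧ B y - B x ≤ y * (θ y - θ x)

/-- Finitely many means of the family lie inside a compact interval of means, on which the
Kullback-Leibler divergence is a Bregman divergence with curvature bounded above and below. -/
lemma exists_isBregman_kl {ρ : Measure ℝ} (hρ : ∀ c : ℝ, ¬ ∀ᵐ x ∂ρ, x = c) {K : ℕ} [NeZero K]
    {μ : Fin K → ℝ} (hμ : ∀ a, μ a ∈ meanSet ρ) :
    ∃ lo hi k₁ k₂ : ℝ, Set.Icc lo hi ⊆ meanSet ρ ∧ (∀ a, lo < μ a ∧ μ a < hi) ∧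
      IsBregman (kl ρ) (natParam ρ) (fun m => cgf id ρ (natParam ρ m)) lo hi k₁ k₂ := by
  have hmono := strictMonoOn_deriv_cgf hρ
  obtain ⟨a₁, ha₁⟩ := Finite.exists_min fun a => natParam ρ (μ a)
  obtain ⟨a₂, ha₂⟩ := Finite.exists_max fun a => natParam ρ (μ a)
  obtain ⟨δ₁, hδ₁, hb₁⟩ := Metric.isOpen_iff.1 isOpen_paramSet _ (natParam_mem (hμ a₁))
  obtain ⟨δ₂, hδ₂, hb₂⟩ := Metric.isOpen_iff.1 isOpen_paramSet _ (natParam_mem (hμ a₂))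
  set s := natParam ρ (μ a₁) - δ₁ / 2 with hs_def
  set t := natParam ρ (μ a₂) + δ₂ / 2 with ht_def
  have hs : s ∈ paramSet ρ := hb₁ (by
    rw [Metric.mem_ball, Real.dist_eq, abs_lt]; constructor <;> linarith)
  have ht : t ∈ paramSet ρ := hb₂ (by
    rw [Metric.mem_ball, Real.dist_eq, abs_lt]; constructor <;> linarith)
  have hst : s ≤ t := by linarith [ha₁ a₂]
  have hsub : Set.Icc s t ⊆ paramSet ρ := Icc_subset_paramSet hs ht
  have hcont : ContinuousOn (deriv (cgf id ρ)) (Set.Icc s t) :=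
    fun x hx => (analyticAt_deriv_cgf (hsub hx)).continuousAt.continuousWithinAt
  have hcont2 : ContinuousOn (deriv (deriv (cgf id ρ))) (Set.Icc s t) :=
    fun x hx => (analyticAt_deriv_cgf (hsub hx)).deriv.continuousAt.continuousWithinAt
  have hdiff : DifferentiableOn ℝ (deriv (cgf id ρ)) (interior (Set.Icc s t)) := fun x hx =>
    (analyticAt_deriv_cgf (hsub (interior_subset hx))).differentiableAt.differentiableWithinAt
  have hne : (Set.Icc s t).Nonempty := ⟨s, le_rfl, hst⟩
  obtain ⟨u, hu, hmin⟩ := isCompact_Icc.exists_isMinOn hne hcont2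
  obtain ⟨v, hv, hmax⟩ := isCompact_Icc.exists_isMaxOn hne hcont2
  set v₁ := deriv (deriv (cgf id ρ)) u with hv₁
  set v₂ := deriv (deriv (cgf id ρ)) v with hv₂
  have hv₁pos : 0 < v₁ := deriv_deriv_cgf_pos hρ (hsub hu)
  have hv₂pos : 0 < v₂ := deriv_deriv_cgf_pos hρ (hsub hv)
  have hlow : ∀ x ∈ Set.Icc s t, ∀ y ∈ Set.Icc s t, x ≤ y →
      v₁ * (y - x) ≤ deriv (cgf id ρ) y - deriv (cgf id ρ) x :=
    (convex_Icc s t).mul_sub_le_image_sub_of_le_deriv hcont hdiff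
      fun x hx => hmin (interior_subset hx)
  have hupp : ∀ x ∈ Set.Icc s t, ∀ y ∈ Set.Icc s t, x ≤ y →
      deriv (cgf id ρ) y - deriv (cgf id ρ) x ≤ v₂ * (y - x) :=
    (convex_Icc s t).image_sub_le_mul_sub_of_deriv_le hcont hdiff
      fun x hx => hmax (interior_subset hx)
  have hJ : ∀ x ∈ Set.Icc (deriv (cgf id ρ) s) (deriv (cgf id ρ) t),
      x ∈ meanSet ρ ∧ natParam ρ x ∈ Set.Icc s t := by
    intro x hx
    obtain ⟨r, hr, hrx⟩ := intermediate_value_Icc hst hcont hx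
    have hxm : x ∈ meanSet ρ := ⟨r, hsub hr, hrx⟩
    have : natParam ρ x = r := hmono.injOn (natParam_mem hxm) (hsub hr)
      ((deriv_cgf_natParam hxm).trans hrx.symm)
    exact ⟨hxm, this ▸ hr⟩
  refine ⟨deriv (cgf id ρ) s, deriv (cgf id ρ) t, 1 / v₂, 1 / v₁, fun x hx => (hJ x hx).1,
    fun a => ?_, ?_⟩
  · rw [← deriv_cgf_natParam (hμ a)]
    exact ⟨hmono hs (natParam_mem (hμ a)) (by linarith [ha₁ a]),
      hmono (natParam_mem (hμ a)) ht (by linarith [ha₂ a])⟩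
  · refine ⟨by positivity, fun m hm x hx => kl_eq hρ (hJ m hm).1 (hJ x hx).1,
      fun x hx y hy hxy => ?_, fun x hx y hy hxy => ?_, fun x hx y hy hxy => ?_⟩
    · have h := hupp _ (hJ x hx).2 _ (hJ y hy).2
        (natParam_le_natParam hρ (hJ x hx).1 (hJ y hy).1 hxy)
      rw [deriv_cgf_natParam (hJ x hx).1, deriv_cgf_natParam (hJ y hy).1] at h
      rw [div_mul_eq_mul_div, one_mul, div_le_iff₀ hv₂pos]
      linarith
    · have h := hlow _ (hJ x hx).2 _ (hJ y hy).2
        (natParam_le_natParam hρ (hJ x hx).1 (hJ y hy).1 hxy)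
      rw [deriv_cgf_natParam (hJ x hx).1, deriv_cgf_natParam (hJ y hy).1] at h
      rw [div_mul_eq_mul_div, one_mul, le_div_iff₀ hv₁pos]
      linarith
    · have hle := natParam_le_natParam hρ (hJ x hx).1 (hJ y hy).1 hxy
      have hs' : Set.Icc (natParam ρ x) (natParam ρ y) ⊆ paramSet ρ :=
        Icc_subset_paramSet (natParam_mem (hJ x hx).1) (natParam_mem (hJ y hy).1)
      have hc : ContinuousOn (cgf id ρ) (Set.Icc (natParam ρ x) (natParam ρ y)) :=
        fun z hz => (analyticAt_cgf (X := id) (hs' hz)).continuousAt.continuousWithinAt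
      have hd : DifferentiableOn ℝ (cgf id ρ)
          (interior (Set.Icc (natParam ρ x) (natParam ρ y))) := fun z hz =>
        (analyticAt_cgf (X := id)
          (hs' (interior_subset hz))).differentiableAt.differentiableWithinAt
      constructor
      · refine (convex_Icc _ _).mul_sub_le_image_sub_of_le_deriv hc hd (fun z hz => ?_)
          _ ⟨le_rfl, hle⟩ _ ⟨hle, le_rfl⟩ hle
        have h := hmono.monotoneOn (natParam_mem (hJ x hx).1) (hs' (interior_subset hz))
          (interior_subset hz).1
        rwa [deriv_cgf_natParam (hJ x hx).1] at h
      · refine (convex_Icc _ _).image_sub_le_mul_sub_of_deriv_le hc hd (fun z hz => ?_)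
          _ ⟨le_rfl, hle⟩ _ ⟨hle, le_rfl⟩ hle
        have h := hmono.monotoneOn (hs' (interior_subset hz)) (natParam_mem (hJ y hy).1)
          (interior_subset hz).2
        rwa [deriv_cgf_natParam (hJ y hy).1] at h

namespace IsBregman

variable {D : ℝ → ℝ → ℝ} {θ B : ℝ → ℝ} {lo hi k₁ k₂ : ℝ}

lemma sub_eq (h : IsBregman D θ B lo hi k₁ k₂) {m x y : ℝ} (hm : m ∈ Set.Icc lo hi)
    (hx : x ∈ Set.Icc lo hi) (hy : y ∈ Set.Icc lo hi) :
    D m y - D m x = (B y - B x) - m * (θ y - θ x) := by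
  rw [h.apply_eq m hm x hx, h.apply_eq m hm y hy]
  ring

lemma self_eq_zero (h : IsBregman D θ B lo hi k₁ k₂) {m : ℝ} (hm : m ∈ Set.Icc lo hi) :
    D m m = 0 := by
  rw [h.apply_eq m hm m hm]
  ring

lemma k₁_le_k₂ (h : IsBregman D θ B lo hi k₁ k₂) (hlt : lo < hi) : k₁ ≤ k₂ := by
  have h1 := h.lower lo ⟨le_rfl, hlt.le⟩ hi ⟨hlt.le, le_rfl⟩ hlt.le
  have h2 := h.upper lo ⟨le_rfl, hlt.le⟩ hi ⟨hlt.le, le_rfl⟩ hlt.le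
  exact le_of_mul_le_mul_right (h1.trans h2) (sub_pos.2 hlt)

/-- To the right of `m` the divergence from `m` increases. -/
lemma mul_le_sub_right (h : IsBregman D θ B lo hi k₁ k₂) {m x y : ℝ} (hm : m ∈ Set.Icc lo hi)
    (hx : x ∈ Set.Icc lo hi) (hy : y ∈ Set.Icc lo hi) (hmx : m ≤ x) (hxy : x ≤ y) :
    (x - m) * (k₁ * (y - x)) ≤ D m y - D m x := by
  rw [h.sub_eq hm hx hy]
  have h1 := mul_le_mul_of_nonneg_left (h.lower x hx y hy hxy) (sub_nonneg.2 hmx)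
  have h2 := (h.slope x hx y hy hxy).1
  linarith

/-- To the left of `m` the divergence from `m` decreases. -/
lemma mul_le_sub_left (h : IsBregman D θ B lo hi k₁ k₂) {m x y : ℝ} (hm : m ∈ Set.Icc lo hi)
    (hx : x ∈ Set.Icc lo hi) (hy : y ∈ Set.Icc lo hi) (hym : y ≤ m) (hxy : x ≤ y) :
    (m - y) * (k₁ * (y - x)) ≤ D m x - D m y := by
  rw [h.sub_eq hm hy hx]
  have h1 := mul_le_mul_of_nonneg_left (h.lower x hx y hy hxy) (sub_nonneg.2 hym)
  have h2 := (h.slope x hx y hy hxy).2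
  linarith

lemma abs_sub_le_of_le (h : IsBregman D θ B lo hi k₁ k₂) {m x y : ℝ} (hm : m ∈ Set.Icc lo hi)
    (hx : x ∈ Set.Icc lo hi) (hy : y ∈ Set.Icc lo hi) (hxy : x ≤ y) {r : ℝ} (hr : |x - m| ≤ r)
    (hr' : |y - m| ≤ r) : |D m y - D m x| ≤ k₂ * r * (y - x) := by
  have hr0 : 0 ≤ r := (abs_nonneg _).trans hr
  have h0 : 0 ≤ θ y - θ x :=
    (mul_nonneg h.k₁_pos.le (sub_nonneg.2 hxy)).trans (h.lower x hx y hy hxy)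
  have h1 := mul_le_mul_of_nonneg_left (h.upper x hx y hy hxy) hr0
  have h2 := h.slope x hx y hy hxy
  rw [h.sub_eq hm hx hy, abs_le]
  have h3 := mul_le_mul_of_nonneg_right (abs_le.1 hr).1 h0
  have h4 := mul_le_mul_of_nonneg_right (abs_le.1 hr').2 h0
  constructor <;> nlinarith

lemma abs_sub_le (h : IsBregman D θ B lo hi k₁ k₂) {m x y : ℝ} (hm : m ∈ Set.Icc lo hi)
    (hx : x ∈ Set.Icc lo hi) (hy : y ∈ Set.Icc lo hi) :
    |D m y - D m x| ≤ k₂ * (hi - lo) * |y - x| := by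
  have key : ∀ z ∈ Set.Icc lo hi, |z - m| ≤ hi - lo := fun z hz => by
    rw [abs_le]
    constructor <;> linarith [hz.1, hz.2, hm.1, hm.2]
  rcases le_total x y with hxy | hxy
  · rw [abs_of_nonneg (sub_nonneg.2 hxy)]
    exact h.abs_sub_le_of_le hm hx hy hxy (key x hx) (key y hy)
  · rw [abs_sub_comm, abs_sub_comm y x, abs_of_nonneg (sub_nonneg.2 hxy)]
    exact h.abs_sub_le_of_le hm hy hx hxy (key y hy) (key x hx)

lemma abs_sub_le_left (h : IsBregman D θ B lo hi k₁ k₂) {m m' x : ℝ} (hm : m ∈ Set.Icc lo hi)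
    (hm' : m' ∈ Set.Icc lo hi) (hx : x ∈ Set.Icc lo hi) :
    |D m x - D m' x| ≤ 2 * (k₂ * (hi - lo)) * |m - m'| := by
  have h1 : D m x - D m' x = (D m m' - D m m) + (θ m' - θ x) * (m - m') := by
    rw [h.apply_eq m hm x hx, h.apply_eq m' hm' x hx, h.apply_eq m hm m' hm', h.self_eq_zero hm]
    ring
  have h2 := h.abs_sub_le hm hm hm'
  rw [abs_sub_comm m' m] at h2
  have h3 : |θ m' - θ x| ≤ k₂ * (hi - lo) := by
    rcases le_total x m' with hxm | hxm
    · have h4 := h.upper x hx m' hm' hxm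
      have h5 := h.lower x hx m' hm' hxm
      have h6 : 0 ≤ k₁ * (m' - x) := mul_nonneg h.k₁_pos.le (sub_nonneg.2 hxm)
      rw [abs_of_nonneg (by linarith)]
      rcases eq_or_lt_of_le (hx.1.trans hx.2) with he | hlt
      · have : m' = x := le_antisymm (by linarith [hm'.2, hx.1]) hxm
        subst this
        simp [he]
      · nlinarith [h.k₁_le_k₂ hlt, h.k₁_pos, hx.1, hm'.2]
    · have h4 := h.upper m' hm' x hx hxm
      have h5 := h.lower m' hm' x hx hxm
      have h6 : 0 ≤ k₁ * (x - m') := mul_nonneg h.k₁_pos.le (sub_nonneg.2 hxm)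
      rw [abs_sub_comm, abs_of_nonneg (by linarith)]
      rcases eq_or_lt_of_le (hx.1.trans hx.2) with he | hlt
      · have : m' = x := le_antisymm hxm (by linarith [hm'.1, hx.2])
        subst this
        simp [he]
      · nlinarith [h.k₁_le_k₂ hlt, h.k₁_pos, hm'.1, hx.2]
  calc |D m x - D m' x| ≤ |D m m' - D m m| + |(θ m' - θ x) * (m - m')| := by
        rw [h1]; exact abs_add_le _ _
    _ ≤ k₂ * (hi - lo) * |m - m'| + k₂ * (hi - lo) * |m - m'| := by
        rw [abs_mul]
        gcongr
    _ = _ := by ring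

lemma le_sq (h : IsBregman D θ B lo hi k₁ k₂) {m x : ℝ} (hm : m ∈ Set.Icc lo hi)
    (hx : x ∈ Set.Icc lo hi) : D m x ≤ k₂ * (x - m) ^ 2 := by
  have h0 := h.self_eq_zero hm
  rcases le_total m x with hmx | hmx
  · have h1 := h.abs_sub_le_of_le (r := x - m) hm hm hx hmx (by simpa using hmx)
      (abs_of_nonneg (sub_nonneg.2 hmx)).le
    have h2 := (le_abs_self _).trans h1
    nlinarith
  · have h1 := h.abs_sub_le_of_le (r := m - x) hm hx hm hmx
      (by rw [abs_sub_comm, abs_of_nonneg (sub_nonneg.2 hmx)]) (by simpa using hmx)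
    rw [abs_sub_comm] at h1
    have h2 := (le_abs_self _).trans h1
    nlinarith

/-- The lower bound comes from the half of the way from `m` to `x` that is farther from `m`. -/
lemma sq_le (h : IsBregman D θ B lo hi k₁ k₂) {m x : ℝ} (hm : m ∈ Set.Icc lo hi)
    (hx : x ∈ Set.Icc lo hi) : k₁ / 4 * (x - m) ^ 2 ≤ D m x := by
  have hk := h.k₁_pos
  have h0 := h.self_eq_zero hm
  have hz : (m + x) / 2 ∈ Set.Icc lo hi :=
    ⟨by linarith [hm.1, hx.1], by linarith [hm.2, hx.2]⟩
  rcases le_total m x with hmx | hmx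
  · have h1 := h.mul_le_sub_right hm hm hz le_rfl (by linarith)
    have h2 := h.mul_le_sub_right hm hz hx (by linarith) (by linarith)
    nlinarith
  · have h1 := h.mul_le_sub_left hm hz hm le_rfl (by linarith)
    have h2 := h.mul_le_sub_left hm hx hz (by linarith) (by linarith)
    nlinarith

lemma nonneg (h : IsBregman D θ B lo hi k₁ k₂) {m x : ℝ} (hm : m ∈ Set.Icc lo hi)
    (hx : x ∈ Set.Icc lo hi) : 0 ≤ D m x := by
  have := h.k₁_pos
  exact le_trans (by positivity) (h.sq_le hm hx)

end IsBregman

/-! ### Anchor terms and indexes as functions of the ratio of the weights -/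

/-- The weighted mean of `p` and `q` with weights `1` and `s`. -/
noncomputable def pooled (p q s : ℝ) : ℝ := (p + s * q) / (1 + s)

/-- The term `d(p, x) / d(q, x)` of the anchor function, with `x` the mean of `p` and `q` for
weights in the ratio `1 : s`. -/
noncomputable def ratio (D : ℝ → ℝ → ℝ) (p q s : ℝ) : ℝ :=
  D p (pooled p q s) / D q (pooled p q s)

/-- The index `d(p, x) + s d(q, x)` per unit of weight of the arm with mean `p`, with `x` the mean
of `p` and `q` for weights in the ratio `1 : s`. -/
noncomputable def cost (D : ℝ → ℝ → ℝ) (p q s : ℝ) : ℝ :=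
  D p (pooled p q s) + s * D q (pooled p q s)

lemma sub_pooled {p q s : ℝ} (hs : 0 ≤ s) : p - pooled p q s = (p - q) * (s / (1 + s)) := by
  rw [pooled]
  field_simp
  ring

lemma pooled_sub {p q s : ℝ} (hs : 0 ≤ s) : pooled p q s - q = (p - q) * (1 / (1 + s)) := by
  rw [pooled]
  field_simp
  ring

lemma pooled_sub_pooled {p q s t : ℝ} (hs : 0 ≤ s) (ht : 0 ≤ t) :
    pooled p q s - pooled p q t = (p - q) * (t - s) / ((1 + s) * (1 + t)) := by
  rw [pooled, pooled]
  field_simp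
  ring

lemma pooled_mem {p q s lo hi : ℝ} (hs : 0 ≤ s) (hp : p ∈ Set.Icc lo hi)
    (hq : q ∈ Set.Icc lo hi) : pooled p q s ∈ Set.Icc lo hi := by
  rw [pooled]
  constructor
  · rw [le_div_iff₀ (by linarith)]
    nlinarith [hp.1, hq.1]
  · rw [div_le_iff₀ (by linarith)]
    nlinarith [hp.2, hq.2]

lemma abs_pooled_sub_pooled_le {p q p' q' s : ℝ} (hs : 0 ≤ s) :
    |pooled p q s - pooled p' q' s| ≤ |p - p'| + |q - q'| := by
  have h1 : pooled p q s - pooled p' q' s = (p - p') * (1 / (1 + s)) + (q - q') * (s / (1 + s)) := by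
    rw [pooled, pooled]
    field_simp
    ring
  have h2 : 1 / (1 + s) ≤ 1 := by rw [div_le_one (by linarith)]; linarith
  have h3 : s / (1 + s) ≤ 1 := by rw [div_le_one (by linarith)]; linarith
  rw [h1]
  refine (abs_add_le _ _).trans ?_
  rw [abs_mul, abs_mul, abs_of_nonneg (by positivity : 0 ≤ 1 / (1 + s)),
    abs_of_nonneg (by positivity : 0 ≤ s / (1 + s))]
  exact add_le_add (mul_le_of_le_one_right (abs_nonneg _) h2)
    (mul_le_of_le_one_right (abs_nonneg _) h3)

lemma abs_div_sub_div_le {a a' b b' M c : ℝ} (hc : 0 < c) (ha' : |a'| ≤ M)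
    (hb : c ≤ b) (hb' : c ≤ b') :
    |a / b - a' / b'| ≤ |a - a'| / c + M * |b - b'| / c ^ 2 := by
  have hb0 : 0 < b := hc.trans_le hb
  have hb0' : 0 < b' := hc.trans_le hb'
  have hM : 0 ≤ M := (abs_nonneg _).trans ha'
  have h1 : a / b - a' / b' = (a - a') / b + a' * (b' - b) / (b * b') := by
    field_simp
    ring
  rw [h1]
  refine (abs_add_le _ _).trans (add_le_add ?_ ?_)
  · rw [abs_div, abs_of_pos hb0]
    exact div_le_div_of_nonneg_left (abs_nonneg _) hc hb
  · rw [abs_div, abs_of_pos (mul_pos hb0 hb0'), abs_mul, abs_sub_comm b' b]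
    refine div_le_div₀ (by positivity) (by gcongr) (by positivity) ?_
    rw [sq]
    exact mul_le_mul hb hb' hc.le hb0.le

namespace IsBregman

variable {D : ℝ → ℝ → ℝ} {θ B : ℝ → ℝ} {lo hi k₁ k₂ : ℝ}

/-- The pooled mean minimises the weighted divergence, and the excess is again a divergence. -/
lemma add_mul_eq (h : IsBregman D θ B lo hi k₁ k₂) {p q s y : ℝ} (hs : 0 ≤ s)
    (hp : p ∈ Set.Icc lo hi) (hq : q ∈ Set.Icc lo hi) (hy : y ∈ Set.Icc lo hi) :
    D p y + s * D q y = cost D p q s + (1 + s) * D (pooled p q s) y := by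
  have hx := pooled_mem hs hp hq
  have h1 : (1 + s) * pooled p q s = p + s * q := by
    rw [pooled]
    field_simp
  rw [cost, h.apply_eq p hp y hy, h.apply_eq q hq y hy, h.apply_eq p hp _ hx,
    h.apply_eq q hq _ hx, h.apply_eq _ hx y hy]
  linear_combination (-(θ (pooled p q s) - θ y)) * h1

lemma cost_le (h : IsBregman D θ B lo hi k₁ k₂) {p q s y : ℝ} (hs : 0 ≤ s)
    (hp : p ∈ Set.Icc lo hi) (hq : q ∈ Set.Icc lo hi) (hy : y ∈ Set.Icc lo hi) :
    cost D p q s ≤ D p y + s * D q y := by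
  rw [h.add_mul_eq hs hp hq hy]
  have := h.nonneg (pooled_mem hs hp hq) hy
  nlinarith

lemma ratio_le_sq (h : IsBregman D θ B lo hi k₁ k₂) {p q s : ℝ} (hs : 0 ≤ s)
    (hp : p ∈ Set.Icc lo hi) (hq : q ∈ Set.Icc lo hi) (hqp : q < p) :
    ratio D p q s ≤ 4 * k₂ / k₁ * s ^ 2 := by
  have hx := pooled_mem hs hp hq
  have hk := h.k₁_pos
  have h1 := h.le_sq hp hx
  have h2 := h.sq_le hq hx
  rw [pooled_sub hs] at h2
  rw [← neg_sub, neg_sq, sub_pooled hs] at h1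
  have hpq : 0 < p - q := sub_pos.2 hqp
  have hpos : 0 < k₁ / 4 * ((p - q) * (1 / (1 + s))) ^ 2 := by positivity
  rw [ratio, div_le_iff₀ (hpos.trans_le h2)]
  refine h1.trans ?_
  have hk2 : 0 ≤ 4 * k₂ / k₁ * s ^ 2 := by
    have := hk.trans_le (h.k₁_le_k₂ (hq.1.trans_lt (hqp.trans_le hp.2)))
    positivity
  refine le_trans (le_of_eq ?_) (mul_le_mul_of_nonneg_left h2 hk2)
  field_simp

lemma sq_le_ratio (h : IsBregman D θ B lo hi k₁ k₂) {p q s : ℝ} (hs : 0 ≤ s)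
    (hp : p ∈ Set.Icc lo hi) (hq : q ∈ Set.Icc lo hi) (hqp : q < p) :
    s ^ 2 ≤ 4 * k₂ / k₁ * ratio D p q s := by
  have hx := pooled_mem hs hp hq
  have hk := h.k₁_pos
  have hk2 := hk.trans_le (h.k₁_le_k₂ (hq.1.trans_lt (hqp.trans_le hp.2)))
  have h1 := h.sq_le hp hx
  have h2 := h.le_sq hq hx
  have h3 := h.sq_le hq hx
  rw [pooled_sub hs] at h2 h3
  rw [← neg_sub, neg_sq, sub_pooled hs] at h1
  have hpq : 0 < p - q := sub_pos.2 hqp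
  have hpos : 0 < k₁ / 4 * ((p - q) * (1 / (1 + s))) ^ 2 := by positivity
  have hD := hpos.trans_le h3
  have h4 : s ^ 2 * D q (pooled p q s) ≤ 4 * k₂ / k₁ * D p (pooled p q s) := by
    calc s ^ 2 * D q (pooled p q s) ≤ s ^ 2 * (k₂ * ((p - q) * (1 / (1 + s))) ^ 2) := by gcongr
      _ = 4 * k₂ / k₁ * (k₁ / 4 * ((p - q) * (s / (1 + s))) ^ 2) := by field_simp
      _ ≤ _ := by gcongr
  rw [ratio, ← mul_div_assoc, le_div_iff₀ hD]
  exact h4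

lemma cost_le_mul (h : IsBregman D θ B lo hi k₁ k₂) {p q s : ℝ} (hs : 0 ≤ s)
    (hp : p ∈ Set.Icc lo hi) (hq : q ∈ Set.Icc lo hi) (hqp : q < p) :
    cost D p q s ≤ k₂ * (hi - lo) ^ 2 * s := by
  have hk2 := h.k₁_pos.trans_le (h.k₁_le_k₂ (hq.1.trans_lt (hqp.trans_le hp.2)))
  -- test the minimisation property of the pooled mean at the point `p`
  have h1 := h.cost_le hs hp hq hp
  rw [h.self_eq_zero hp, zero_add] at h1
  have h2 := h.le_sq hq hp
  have h3 : (p - q) ^ 2 ≤ (hi - lo) ^ 2 :=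
    pow_le_pow_left₀ (sub_nonneg.2 hqp.le) (by linarith [hp.2, hq.1]) 2
  calc cost D p q s ≤ s * D q p := h1
    _ ≤ s * (k₂ * (hi - lo) ^ 2) := by
        gcongr
        exact h2.trans (by gcongr)
    _ = _ := by ring

lemma mul_le_cost (h : IsBregman D θ B lo hi k₁ k₂) {p q s : ℝ} (hs : 0 ≤ s)
    (hp : p ∈ Set.Icc lo hi) (hq : q ∈ Set.Icc lo hi) :
    k₁ / 4 * (p - q) ^ 2 * (s / (1 + s)) ≤ cost D p q s := by
  have hx := pooled_mem hs hp hq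
  have h1 := h.sq_le hp hx
  have h2 := h.sq_le hq hx
  rw [pooled_sub hs] at h2
  rw [← neg_sub, neg_sq, sub_pooled hs] at h1
  have h3 := mul_le_mul_of_nonneg_left h2 hs
  refine le_trans (le_of_eq ?_) (add_le_add h1 h3)
  field_simp
  ring

end IsBregman

/-- Quantitative regularity of the anchor terms and of the normalised indexes, for pairs of means in
`[lo, hi]` at distance at least `γ` and weight ratios `s` in `[c, 1 / c]`: both are increasing and
bi-Lipschitz in `s`, and Lipschitz in the means. -/
structure RateBounds (D : ℝ → ℝ → ℝ) (lo hi γ c L : ℝ) : Prop where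
  one_le : 1 ≤ L
  le_ratio_sub : ∀ p ∈ Set.Icc lo hi, ∀ q ∈ Set.Icc lo hi, γ ≤ p - q →
    ∀ s ∈ Set.Icc c (1 / c), ∀ t ∈ Set.Icc c (1 / c), s ≤ t →
      (t - s) / L ≤ ratio D p q t - ratio D p q s
  ratio_sub_le : ∀ p ∈ Set.Icc lo hi, ∀ q ∈ Set.Icc lo hi, γ ≤ p - q →
    ∀ s ∈ Set.Icc c (1 / c), ∀ t ∈ Set.Icc c (1 / c), s ≤ t →
      ratio D p q t - ratio D p q s ≤ L * (t - s)
  le_cost_sub : ∀ p ∈ Set.Icc lo hi, ∀ q ∈ Set.Icc lo hi, γ ≤ p - q →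
    ∀ s ∈ Set.Icc c (1 / c), ∀ t ∈ Set.Icc c (1 / c), s ≤ t →
      (t - s) / L ≤ cost D p q t - cost D p q s
  cost_sub_le : ∀ p ∈ Set.Icc lo hi, ∀ q ∈ Set.Icc lo hi, γ ≤ p - q →
    ∀ s ∈ Set.Icc c (1 / c), ∀ t ∈ Set.Icc c (1 / c), s ≤ t →
      cost D p q t - cost D p q s ≤ L * (t - s)
  abs_ratio_sub_le : ∀ p ∈ Set.Icc lo hi, ∀ q ∈ Set.Icc lo hi, γ ≤ p - q →
    ∀ p' ∈ Set.Icc lo hi, ∀ q' ∈ Set.Icc lo hi, γ ≤ p' - q' → ∀ s ∈ Set.Icc c (1 / c),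
      |ratio D p q s - ratio D p' q' s| ≤ L * (|p - p'| + |q - q'|)
  abs_cost_sub_le : ∀ p ∈ Set.Icc lo hi, ∀ q ∈ Set.Icc lo hi, γ ≤ p - q →
    ∀ p' ∈ Set.Icc lo hi, ∀ q' ∈ Set.Icc lo hi, γ ≤ p' - q' → ∀ s ∈ Set.Icc c (1 / c),
      |cost D p q s - cost D p' q' s| ≤ L * (|p - p'| + |q - q'|)

namespace IsBregman

variable {D : ℝ → ℝ → ℝ} {θ B : ℝ → ℝ} {lo hi k₁ k₂ : ℝ}

set_option maxHeartbeats 1000000 in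
lemma exists_rateBounds (h : IsBregman D θ B lo hi k₁ k₂) (hlt : lo < hi) {γ c : ℝ} (hγ : 0 < γ)
    (hc : 0 < c) : ∃ L, RateBounds D lo hi γ c L := by
  have hk := h.k₁_pos
  have hk2 := hk.trans_le (h.k₁_le_k₂ hlt)
  have hw : 0 < hi - lo := sub_pos.2 hlt
  set w := hi - lo with hw_def
  set M := k₂ * w ^ 2 with hM
  set Λ := 2 * (k₂ * w) with hΛ
  set r := 1 + 1 / c with hr
  set m₀ := k₁ / 4 * (γ * (1 / r)) ^ 2 with hm₀
  have hM0 : 0 < M := by positivity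
  have hΛ0 : 0 < Λ := by positivity
  have hr0 : 0 < r := by positivity
  have hm0 : 0 < m₀ := by positivity
  have hDM : ∀ m ∈ Set.Icc lo hi, ∀ x ∈ Set.Icc lo hi, D m x ≤ M := fun m hm x hx => by
    refine (h.le_sq hm hx).trans ?_
    have : (x - m) ^ 2 ≤ w ^ 2 :=
      sq_le_sq' (by linarith [hm.2, hx.1]) (by linarith [hm.1, hx.2])
    rw [hM]
    gcongr
  have hDm : ∀ p ∈ Set.Icc lo hi, ∀ q ∈ Set.Icc lo hi, γ ≤ p - q → ∀ s ∈ Set.Icc c (1 / c),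
      m₀ ≤ D q (pooled p q s) := fun p hp q hq hpq s hs => by
    have hs0 : 0 ≤ s := hc.le.trans hs.1
    refine le_trans ?_ (h.sq_le hq (pooled_mem hs0 hp hq))
    rw [pooled_sub hs0]
    have : 1 / r ≤ 1 / (1 + s) := one_div_le_one_div_of_le (by linarith) (by linarith [hs.2])
    have hpq0 : 0 ≤ p - q := hγ.le.trans hpq
    rw [hm₀]
    gcongr
  have hlip : ∀ p ∈ Set.Icc lo hi, ∀ q ∈ Set.Icc lo hi, γ ≤ p - q → ∀ s ∈ Set.Icc c (1 / c),
      ∀ t ∈ Set.Icc c (1 / c), s ≤ t →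
      |pooled p q t - pooled p q s| ≤ w * (t - s) := fun p hp q hq hpq s hs t ht hst => by
    have hs0 : 0 ≤ s := hc.le.trans hs.1
    have ht0 : 0 ≤ t := hc.le.trans ht.1
    rw [abs_sub_comm, pooled_sub_pooled hs0 ht0,
      abs_of_nonneg (div_nonneg (mul_nonneg (by linarith) (by linarith)) (by positivity))]
    refine (div_le_self (mul_nonneg (by linarith) (by linarith)) ?_).trans ?_
    · nlinarith
    · exact mul_le_mul_of_nonneg_right (by linarith [hp.2, hq.1]) (by linarith)
  set L₁ := Λ * w / m₀ + M * (Λ * w) / m₀ ^ 2 with hL₁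
  set ℓ := γ * (c / r) * (k₁ * (γ / (r * r))) / M with hℓ
  set L₂ := 2 * Λ / m₀ + M * (2 * Λ) / m₀ ^ 2 with hL₂
  set L₃ := 2 * Λ + 1 / c * (2 * Λ) with hL₃
  have hℓ0 : 0 < ℓ := by positivity
  have hL10 : 0 < L₁ := by positivity
  have hL20 : 0 < L₂ := by positivity
  have hL30 : 0 < L₃ := by positivity
  have hi1 : 0 < 1 / ℓ := by positivity
  have hi2 : 0 < 1 / m₀ := by positivity
  set L := 1 + L₁ + 1 / ℓ + L₂ + L₃ + M + 1 / m₀ with hL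
  have hL0 : 0 < L := by positivity
  have hLinv : ∀ e : ℝ, 0 < e → 1 / e ≤ L → ∀ z : ℝ, 0 ≤ z → z / L ≤ e * z := fun e he hle z hz => by
    rw [div_le_iff₀ hL0]
    have : 1 ≤ e * L := by
      rw [div_le_iff₀ he] at hle
      linarith
    nlinarith
  have hΛw : ∀ m ∈ Set.Icc lo hi, ∀ x ∈ Set.Icc lo hi, ∀ y ∈ Set.Icc lo hi,
      |D m y - D m x| ≤ Λ * |y - x| := fun m hm x hx y hy => by
    refine (h.abs_sub_le hm hx hy).trans ?_
    gcongr
    rw [hΛ]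
    nlinarith
  -- joint Lipschitz bound of the divergences of two pairs at their pooled means
  have hnoise : ∀ p ∈ Set.Icc lo hi, ∀ q ∈ Set.Icc lo hi, ∀ p' ∈ Set.Icc lo hi,
      ∀ q' ∈ Set.Icc lo hi, ∀ s : ℝ, 0 ≤ s →
      |D p (pooled p q s) - D p' (pooled p' q' s)| ≤ 2 * Λ * (|p - p'| + |q - q'|) ∧
      |D q (pooled p q s) - D q' (pooled p' q' s)| ≤ 2 * Λ * (|p - p'| + |q - q'|) := by
    intro p hp q hq p' hp' q' hq' s hs
    have hx := pooled_mem hs hp hq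
    have hx' := pooled_mem hs hp' hq'
    have h1 := abs_pooled_sub_pooled_le (p := p) (q := q) (p' := p') (q' := q') hs
    have key : ∀ m ∈ Set.Icc lo hi, ∀ m' ∈ Set.Icc lo hi, |m - m'| ≤ |p - p'| + |q - q'| →
        |D m (pooled p q s) - D m' (pooled p' q' s)| ≤ 2 * Λ * (|p - p'| + |q - q'|) := by
      intro m hm m' hm' hmm
      have h2 := hΛw m hm _ hx' _ hx
      have h3 := h.abs_sub_le_left hm hm' hx'
      calc |D m (pooled p q s) - D m' (pooled p' q' s)|
          ≤ |D m (pooled p q s) - D m (pooled p' q' s)|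
            + |D m (pooled p' q' s) - D m' (pooled p' q' s)| := _root_.abs_sub_le _ _ _
        _ ≤ Λ * (|p - p'| + |q - q'|) + Λ * (|p - p'| + |q - q'|) := by
            refine add_le_add (h2.trans ?_) (h3.trans ?_) <;> gcongr
        _ = _ := by ring
    exact ⟨key p hp p' hp' (by linarith [abs_nonneg (q - q')]),
      key q hq q' hq' (by linarith [abs_nonneg (p - p')])⟩
  refine ⟨L, by linarith, ?_, ?_, ?_, ?_, ?_, ?_⟩
  · intro p hp q hq hpq s hs t ht hst
    have hs0 : 0 ≤ s := hc.le.trans hs.1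
    have ht0 : 0 ≤ t := hc.le.trans ht.1
    refine (hLinv ℓ hℓ0 (by linarith) _ (sub_nonneg.2 hst)).trans ?_
    have hx := pooled_mem hs0 hp hq
    have hy := pooled_mem ht0 hp hq
    have hxy : pooled p q t ≤ pooled p q s := by
      rw [← sub_nonneg, pooled_sub_pooled hs0 ht0]
      exact div_nonneg (mul_nonneg (by linarith) (by linarith)) (by positivity)
    have hxp : pooled p q s ≤ p := by
      rw [← sub_nonneg, sub_pooled hs0]
      exact mul_nonneg (by linarith) (by positivity)
    have hqy : q ≤ pooled p q t := by
      rw [← sub_nonneg, pooled_sub ht0]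
      exact mul_nonneg (by linarith) (by positivity)
    have h1 := h.mul_le_sub_left hp hy hx hxp hxy
    have h2 := h.mul_le_sub_right hq hy hx hqy hxy
    have h2' : D q (pooled p q t) ≤ D q (pooled p q s) := by
      have : 0 ≤ (pooled p q t - q) * (k₁ * (pooled p q s - pooled p q t)) :=
        mul_nonneg (sub_nonneg.2 hqy) (mul_nonneg hk.le (sub_nonneg.2 hxy))
      linarith
    have h3 := hDm p hp q hq hpq s hs
    have h4 := hDm p hp q hq hpq t ht
    have h5 : γ * (c / r) ≤ p - pooled p q s := by
      rw [sub_pooled hs0]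
      refine mul_le_mul hpq ?_ (by positivity) (by linarith)
      exact div_le_div₀ hs0 hs.1 (by linarith) (by linarith [hs.2])
    have h6 : γ / (r * r) * (t - s) ≤ pooled p q s - pooled p q t := by
      rw [pooled_sub_pooled hs0 ht0, div_mul_eq_mul_div]
      refine div_le_div₀ (mul_nonneg (by linarith) (by linarith))
        (mul_le_mul_of_nonneg_right hpq (by linarith)) (by positivity) ?_
      exact mul_le_mul (by linarith [hs.2]) (by linarith [ht.2]) (by linarith) hr0.le
    have h7 : γ * (c / r) * (k₁ * (γ / (r * r) * (t - s))) ≤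
        D p (pooled p q t) - D p (pooled p q s) := by
      refine le_trans ?_ h1
      refine mul_le_mul h5 (mul_le_mul_of_nonneg_left h6 hk.le) ?_ ?_
      · have : 0 ≤ t - s := by linarith
        positivity
      · linarith
    have h8 : 0 < D q (pooled p q s) := hm0.trans_le h3
    have h9 : D p (pooled p q t) / D q (pooled p q s) ≤ ratio D p q t :=
      div_le_div_of_nonneg_left (h.nonneg hp hy) (hm0.trans_le h4) h2'
    have h10 : ℓ * (t - s) ≤
        (D p (pooled p q t) - D p (pooled p q s)) / D q (pooled p q s) := by
      have e : ℓ * (t - s) = γ * (c / r) * (k₁ * (γ / (r * r) * (t - s))) / M := by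
        rw [hℓ]
        ring
      rw [e]
      have : 0 ≤ t - s := by linarith
      exact div_le_div₀ (le_trans (by positivity) h7) h7 h8 (hDM q hq _ hx)
    rw [sub_div] at h10
    have : ratio D p q s = D p (pooled p q s) / D q (pooled p q s) := rfl
    linarith
  · intro p hp q hq hpq s hs t ht hst
    have hs0 : 0 ≤ s := hc.le.trans hs.1
    have ht0 : 0 ≤ t := hc.le.trans ht.1
    have hx := pooled_mem hs0 hp hq
    have hy := pooled_mem ht0 hp hq
    have hts : 0 ≤ t - s := by linarith
    have h1 := abs_div_sub_div_le (a := D p (pooled p q t)) (a' := D p (pooled p q s)) hm0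
      (abs_le.2 ⟨by linarith [h.nonneg hp hx], hDM p hp _ hx⟩) (hDm p hp q hq hpq t ht)
      (hDm p hp q hq hpq s hs)
    have h2 := hlip p hp q hq hpq s hs t ht hst
    have h3 := (hΛw p hp _ hx _ hy).trans (mul_le_mul_of_nonneg_left h2 hΛ0.le)
    have h4 := (hΛw q hq _ hx _ hy).trans (mul_le_mul_of_nonneg_left h2 hΛ0.le)
    calc ratio D p q t - ratio D p q s
        ≤ Λ * (w * (t - s)) / m₀ + M * (Λ * (w * (t - s))) / m₀ ^ 2 := by
          refine (le_abs_self _).trans (h1.trans ?_)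
          gcongr
      _ = L₁ * (t - s) := by rw [hL₁]; ring
      _ ≤ L * (t - s) := by
          gcongr
          linarith
  · intro p hp q hq hpq s hs t ht hst
    have hs0 : 0 ≤ s := hc.le.trans hs.1
    have ht0 : 0 ≤ t := hc.le.trans ht.1
    refine (hLinv m₀ hm0 (by linarith) _ (sub_nonneg.2 hst)).trans ?_
    have h1 := h.cost_le hs0 hp hq (pooled_mem ht0 hp hq)
    have h2 := hDm p hp q hq hpq t ht
    have h3 : cost D p q t = D p (pooled p q t) + t * D q (pooled p q t) := rfl
    nlinarith
  · intro p hp q hq hpq s hs t ht hst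
    have hs0 : 0 ≤ s := hc.le.trans hs.1
    have ht0 : 0 ≤ t := hc.le.trans ht.1
    have h1 := h.cost_le ht0 hp hq (pooled_mem hs0 hp hq)
    have h2 := hDM q hq _ (pooled_mem hs0 hp hq)
    have h3 : cost D p q s = D p (pooled p q s) + s * D q (pooled p q s) := rfl
    have h4 : M * (t - s) ≤ L * (t - s) :=
      mul_le_mul_of_nonneg_right (by linarith) (sub_nonneg.2 hst)
    nlinarith
  · intro p hp q hq hpq p' hp' q' hq' hpq' s hs
    have hs0 : 0 ≤ s := hc.le.trans hs.1
    obtain ⟨h1, h2⟩ := hnoise p hp q hq p' hp' q' hq' s hs0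
    have hx' := pooled_mem hs0 hp' hq'
    have h3 := abs_div_sub_div_le (a := D p (pooled p q s)) (a' := D p' (pooled p' q' s)) hm0
      (abs_le.2 ⟨by linarith [h.nonneg hp' hx'], hDM p' hp' _ hx'⟩) (hDm p hp q hq hpq s hs)
      (hDm p' hp' q' hq' hpq' s hs)
    have hn : 0 ≤ |p - p'| + |q - q'| := by positivity
    calc |ratio D p q s - ratio D p' q' s|
        ≤ 2 * Λ * (|p - p'| + |q - q'|) / m₀
          + M * (2 * Λ * (|p - p'| + |q - q'|)) / m₀ ^ 2 := by
          refine h3.trans ?_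
          gcongr
      _ = L₂ * (|p - p'| + |q - q'|) := by rw [hL₂]; ring
      _ ≤ L * (|p - p'| + |q - q'|) := by
          gcongr
          linarith
  · intro p hp q hq hpq p' hp' q' hq' hpq' s hs
    have hs0 : 0 ≤ s := hc.le.trans hs.1
    obtain ⟨h1, h2⟩ := hnoise p hp q hq p' hp' q' hq' s hs0
    have hn : 0 ≤ |p - p'| + |q - q'| := by positivity
    have e : cost D p q s - cost D p' q' s = (D p (pooled p q s) - D p' (pooled p' q' s))
        + s * (D q (pooled p q s) - D q' (pooled p' q' s)) := by
      rw [cost, cost]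
      ring
    calc |cost D p q s - cost D p' q' s|
        ≤ 2 * Λ * (|p - p'| + |q - q'|) + 1 / c * (2 * Λ * (|p - p'| + |q - q'|)) := by
          rw [e]
          refine (abs_add_le _ _).trans (add_le_add h1 ?_)
          rw [abs_mul, abs_of_nonneg hs0]
          exact mul_le_mul hs.2 h2 (abs_nonneg _) (by positivity)
      _ = L₃ * (|p - p'| + |q - q'|) := by rw [hL₃]; ring
      _ ≤ L * (|p - p'| + |q - q'|) := by
          gcongr
          linarith

end IsBregman

variable {K : ℕ}

/-! ### Counting pulls along an action sequence -/

lemma pulls_zero (s : ℕ → Fin K) (a : Fin K) : pulls s 0 a = 0 := by simp [pulls]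

lemma pulls_succ (s : ℕ → Fin K) (N : ℕ) (a : Fin K) :
    pulls s (N + 1) a = pulls s N a + if s (N + 1) = a then 1 else 0 := by
  rw [pulls, pulls, ← Finset.insert_Icc_right_eq_Icc_add_one (by omega), Finset.filter_insert]
  split_ifs with h
  · rw [Finset.card_insert_of_notMem (by simp)]
  · rfl

lemma pulls_mono (s : ℕ → Fin K) (a : Fin K) : Monotone fun N => pulls s N a :=
  monotone_nat_of_le_succ fun N => by
    rw [pulls_succ]
    exact Nat.le_add_right _ _

lemma pulls_succ_le (s : ℕ → Fin K) (N : ℕ) (a : Fin K) :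
    pulls s (N + 1) a ≤ pulls s N a + 1 := by
  rw [pulls_succ]
  split_ifs <;> omega

lemma sum_pulls (s : ℕ → Fin K) (N : ℕ) : ∑ a, pulls s N a = N := by
  induction N with
  | zero => simp [pulls_zero]
  | succ N ih =>
    simp_rw [pulls_succ, Finset.sum_add_distrib, ih]
    simp

lemma pulls_le (s : ℕ → Fin K) (N : ℕ) (a : Fin K) : pulls s N a ≤ N := by
  conv_rhs => rw [← sum_pulls s N]
  exact Finset.single_le_sum (f := fun a => pulls s N a) (fun _ _ => Nat.zero_le _)
    (Finset.mem_univ a)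

lemma pulls_add_sum_erase (s : ℕ → Fin K) (N : ℕ) (i : Fin K) :
    (pulls s N i : ℝ) + ∑ a ∈ Finset.univ.erase i, (pulls s N a : ℝ) = N := by
  rw [Finset.add_sum_erase _ (fun a => (pulls s N a : ℝ)) (Finset.mem_univ i)]
  exact_mod_cast sum_pulls s N

lemma exists_last_pull {s : ℕ → Fin K} {t N : ℕ} {a : Fin K} (h : pulls s t a < pulls s N a) :
    ∃ u, t ≤ u ∧ u < N ∧ s (u + 1) = a ∧ pulls s N a = pulls s u a + 1 := by
  induction N with
  | zero => simp [pulls_zero] at h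
  | succ N ih =>
    by_cases hs : s (N + 1) = a
    · refine ⟨N, ?_, N.lt_succ_self, hs, by rw [pulls_succ, if_pos hs]⟩
      by_contra hlt
      exact absurd (pulls_mono s a (by omega : N + 1 ≤ t)) (not_le.2 h)
    · have e : pulls s (N + 1) a = pulls s N a := by rw [pulls_succ, if_neg hs, add_zero]
      rw [e] at h ⊢
      obtain ⟨u, h1, h2, h3⟩ := ih h
      exact ⟨u, h1, by omega, h3⟩

lemma exists_last_other_pull {s : ℕ → Fin K} {N : ℕ} {i a : Fin K} (hai : a ≠ i)
    (h : 0 < pulls s N a) :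
    ∃ u, u < N ∧ s (u + 1) ≠ i ∧ ∀ b, b ≠ i → pulls s N b = pulls s (u + 1) b := by
  induction N with
  | zero => simp [pulls_zero] at h
  | succ N ih =>
    by_cases hs : s (N + 1) = i
    · have e : ∀ b, b ≠ i → pulls s (N + 1) b = pulls s N b := fun b hb => by
        rw [pulls_succ, if_neg (fun hc => hb (hc.symm.trans hs)), add_zero]
      rw [e a hai] at h
      obtain ⟨u, h1, h2, h3⟩ := ih h
      exact ⟨u, by omega, h2, fun b hb => (e b hb).trans (h3 b hb)⟩
    · exact ⟨N, N.lt_succ_self, hs, fun b _ => rfl⟩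

lemma exists_forall_rpow_le_mul {α c : ℝ} (hα : α < 1) (hc : 0 < c) :
    ∃ N₀ : ℕ, ∀ x : ℝ, (N₀ : ℝ) ≤ x → x ^ α ≤ c * x := by
  have h := tendsto_rpow_neg_atTop (sub_pos.2 hα)
  obtain ⟨A, hA⟩ := eventually_atTop.1 (h.eventually (eventually_le_nhds hc))
  refine ⟨⌈max A 1⌉₊, fun x hx => ?_⟩
  have hx' := (Nat.le_ceil _).trans hx
  have hx0 : 0 < x := by linarith [le_max_right A 1]
  calc x ^ α = x ^ (-(1 - α)) * x := by
        rw [← Real.rpow_add_one hx0.ne']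
        congr 1
        ring
    _ ≤ c * x := mul_le_mul_of_nonneg_right (hA x ((le_max_left _ _).trans hx')) hx0.le

/-- Forced exploration: if the least pulled arm is pulled whenever some arm has fewer than
`(N + 1) ^ α` pulls, then every arm eventually has at least `(N / 2) ^ α` pulls. An arm violating this
would force all pulls of the window `(N / 2, N]` onto arms with fewer pulls than `(N / 2) ^ α + 1`,
and those cannot absorb so many. -/
lemma exists_forall_rpow_le_pulls (hK : 0 < K) {α : ℝ} (hα0 : 0 < α) (hα1 : α < 1) :
    ∃ N₀ : ℕ, ∀ s : ℕ → Fin K,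
      (∀ N, (∃ a, (pulls s N a : ℝ) < ((N + 1 : ℕ) : ℝ) ^ α) →
        ∀ b, pulls s N (s (N + 1)) ≤ pulls s N b) →
      ∀ N, N₀ ≤ N → ∀ a, ((N : ℝ) / 2) ^ α ≤ pulls s N a := by
  have hK' : (0 : ℝ) < K := by exact_mod_cast hK
  obtain ⟨N₁, hN₁⟩ := exists_forall_rpow_le_mul (c := 1 / (2 * K)) hα1 (by positivity)
  refine ⟨2 * N₁ + 4 * (K + 1) + 1, fun s hs N hN a => ?_⟩
  by_contra hlt
  push Not at hlt
  set h := (N + 1) / 2 with hh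
  set M := pulls s N a with hM
  have hhN : h ≤ N := by omega
  have key : ∀ t, h ≤ t → t ≤ N → ∀ b, pulls s t b ≤ pulls s h b + (M + 1) := by
    intro t ht
    induction t, ht using Nat.le_induction with
    | base => intro _ b; omega
    | succ t ht ih =>
      intro htN b
      have hta : pulls s t a ≤ M := pulls_mono s a (by omega : t ≤ N)
      have hexp : (pulls s t a : ℝ) < ((t + 1 : ℕ) : ℝ) ^ α := by
        calc (pulls s t a : ℝ) ≤ M := by exact_mod_cast hta
          _ < ((N : ℝ) / 2) ^ α := hlt
          _ ≤ ((t + 1 : ℕ) : ℝ) ^ α := by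
            refine Real.rpow_le_rpow (by positivity) ?_ hα0.le
            rw [div_le_iff₀ (by norm_num)]
            have : N ≤ (t + 1) * 2 := by omega
            exact_mod_cast this
      have h1 := hs t ⟨a, hexp⟩ a
      by_cases hb : s (t + 1) = b
      · rw [hb] at h1
        have := pulls_succ_le s t b
        omega
      · rw [pulls_succ, if_neg hb]
        exact ih (by omega) b
  have h2 : N ≤ h + K * (M + 1) := by
    calc N = ∑ b, pulls s N b := (sum_pulls s N).symm
      _ ≤ ∑ b : Fin K, (pulls s h b + (M + 1)) :=
          Finset.sum_le_sum fun b _ => key N hhN le_rfl b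
      _ = _ := by
          rw [Finset.sum_add_distrib, sum_pulls]
          simp
  have h3 : (N : ℝ) ≤ (N + 1) / 2 + K * (M + 1) := by
    have h4 : (h : ℝ) ≤ (N + 1) / 2 := by
      rw [le_div_iff₀ (by norm_num)]
      have : h * 2 ≤ N + 1 := by omega
      exact_mod_cast this
    have h5 : (N : ℝ) ≤ h + K * (M + 1) := by exact_mod_cast h2
    linarith
  have h6 : (2 * N₁ + 4 * (K + 1) + 1 : ℝ) ≤ N := by exact_mod_cast hN
  have h7 := hN₁ ((N : ℝ) / 2) (by linarith)
  have h8 : (K : ℝ) * M ≤ K * (1 / (2 * K) * (N / 2)) :=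
    mul_le_mul_of_nonneg_left (hlt.le.trans h7) hK'.le
  have h9 : (K : ℝ) * (1 / (2 * K) * (N / 2)) = N / 4 := by
    field_simp
    ring
  linarith [(Nat.cast_nonneg N₁ : (0 : ℝ) ≤ N₁)]

/-! ### Linear growth of the numbers of pulls -/

/-- The number of pulls of arm `a` relative to that of arm `i`. -/
noncomputable def share (s : ℕ → Fin K) (N : ℕ) (i a : Fin K) : ℝ :=
  (pulls s N a : ℝ) / (pulls s N i : ℝ)

lemma share_nonneg (s : ℕ → Fin K) (N : ℕ) (i a : Fin K) : 0 ≤ share s N i a := by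
  rw [share]
  positivity

/-- From iteration `T` on the means `m N` used by the rule lie in `[lo, hi]`, the mean of arm `i`
exceeds the others by at least `γ`, and `m N` is within `N ^ (-β)` of `μ`. -/
structure MeansClose (lo hi γ β : ℝ) (i : Fin K) (μ : Fin K → ℝ) (m : ℕ → Fin K → ℝ) (T : ℕ) :
    Prop where
  mem : ∀ N, T ≤ N → ∀ a, m N a ∈ Set.Icc lo hi
  gap : ∀ N, T ≤ N → ∀ a, a ≠ i → γ ≤ m N i - m N a
  close : ∀ N, T ≤ N → ∀ a, |m N a - μ a| ≤ (N : ℝ) ^ (-β)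

/-- The choice made at iteration `N + 1` outside of forced exploration, when arm `i` is the
empirically best one: either the anchor function is nonnegative and arm `i` is pulled, or the anchor
function is nonpositive and the challenger pulled has an index that exceeds no other index by more
than a logarithm. Both sampling rules satisfy this. -/
def AnchoredStep (D : ℝ → ℝ → ℝ) (i : Fin K) (s : ℕ → Fin K) (m : ℕ → Fin K → ℝ) (N : ℕ) : Prop :=
  (s (N + 1) = i ∧ 1 ≤ ∑ a ∈ Finset.univ.erase i, ratio D (m N i) (m N a) (share s N i a)) ∨
  (s (N + 1) ≠ i ∧ ∑ a ∈ Finset.univ.erase i, ratio D (m N i) (m N a) (share s N i a) ≤ 1 ∧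
    ∀ b, b ≠ i →
      pulls s N i * cost D (m N i) (m N (s (N + 1))) (share s N i (s (N + 1))) ≤
        pulls s N i * cost D (m N i) (m N b) (share s N i b) + Real.log (pulls s N b))

/-- The sampling rule along an action sequence: the least pulled arm is pulled under forced
exploration, and from iteration `T` on every other choice is an `AnchoredStep`. -/
structure FollowsRule (D : ℝ → ℝ → ℝ) (α : ℝ) (i : Fin K) (s : ℕ → Fin K) (m : ℕ → Fin K → ℝ)
    (T : ℕ) : Prop where
  explore : ∀ N, (∃ a, (pulls s N a : ℝ) < ((N + 1 : ℕ) : ℝ) ^ α) →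
    ∀ b, pulls s N (s (N + 1)) ≤ pulls s N b
  pos : ∀ N, T ≤ N → ∀ a, 0 < pulls s N a
  step : ∀ N, T ≤ N → (∀ a, ((N + 1 : ℕ) : ℝ) ^ α ≤ pulls s N a) → AnchoredStep D i s m N

section Growth

variable {D : ℝ → ℝ → ℝ} {θ B : ℝ → ℝ} {lo hi k₁ k₂ γ α β : ℝ} {i : Fin K} {μ : Fin K → ℝ}
  {s : ℕ → Fin K} {m : ℕ → Fin K → ℝ} {T : ℕ}

lemma FollowsRule.explore_or_step (hf : FollowsRule D α i s m T) {N : ℕ} (hN : T ≤ N) :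
    ((∃ a, (pulls s N a : ℝ) < ((N + 1 : ℕ) : ℝ) ^ α) ∧
      ∀ b, pulls s N (s (N + 1)) ≤ pulls s N b) ∨ AnchoredStep D i s m N := by
  by_cases h : ∃ a, (pulls s N a : ℝ) < ((N + 1 : ℕ) : ℝ) ^ α
  · exact Or.inl ⟨h, hf.explore N h⟩
  · push Not at h
    exact Or.inr (hf.step N hN h)

lemma four_le_kappa (h : IsBregman D θ B lo hi k₁ k₂) (hlt : lo < hi) : 4 ≤ 4 * k₂ / k₁ := by
  rw [le_div_iff₀ h.k₁_pos]
  linarith [h.k₁_le_k₂ hlt]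

/-- A challenger is pulled only when its anchor term is at most one, so its number of pulls stays
comparable to that of the best arm. -/
lemma pulls_le_mul_pulls_best (h : IsBregman D θ B lo hi k₁ k₂) (hlt : lo < hi) (hγ : 0 < γ)
    (hm : MeansClose lo hi γ β i μ m T) (hf : FollowsRule D α i s m T) {N : ℕ} (hN : T ≤ N)
    {a : Fin K} (ha : a ≠ i) :
    (pulls s N a : ℝ) ≤ 4 * k₂ / k₁ * pulls s N i + (1 + T) := by
  have hκ := four_le_kappa h hlt
  set κ := 4 * k₂ / k₁ with hκ_def
  induction N, hN using Nat.le_induction with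
  | base =>
    have h1 : (pulls s T a : ℝ) ≤ T := by exact_mod_cast pulls_le s T a
    have h2 : (0 : ℝ) ≤ κ * pulls s T i := by positivity
    linarith
  | succ N hN ih =>
    have hmono : (pulls s N i : ℝ) ≤ pulls s (N + 1) i := by
      exact_mod_cast pulls_mono s i (Nat.le_succ N)
    have hmono' : κ * (pulls s N i : ℝ) ≤ κ * pulls s (N + 1) i :=
      mul_le_mul_of_nonneg_left hmono (by linarith)
    by_cases hs : s (N + 1) = a
    · have hT : (0 : ℝ) ≤ T := Nat.cast_nonneg T
      have hsucc : (pulls s (N + 1) a : ℝ) = pulls s N a + 1 := by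
        rw [pulls_succ, if_pos hs]
        push_cast
        ring
      suffices hle : (pulls s N a : ℝ) ≤ κ * pulls s N i by linarith
      rcases hf.explore_or_step hN with ⟨-, hex⟩ | ⟨hsi, -⟩ | ⟨-, hsum, -⟩
      · have h1 : (pulls s N a : ℝ) ≤ pulls s N i := by exact_mod_cast hs ▸ hex i
        nlinarith [(Nat.cast_nonneg _ : (0 : ℝ) ≤ pulls s N i)]
      · exact absurd (hs.symm.trans hsi) ha
      · have hni : (0 : ℝ) < pulls s N i := by exact_mod_cast hf.pos N hN i
        have hlt' : ∀ b, b ≠ i → m N b < m N i := fun b hb => by linarith [hm.gap N hN b hb]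
        have hnn : ∀ b ∈ Finset.univ.erase i,
            0 ≤ ratio D (m N i) (m N b) (share s N i b) := fun b _ => by
          have hx := pooled_mem (share_nonneg s N i b) (hm.mem N hN i) (hm.mem N hN b)
          exact div_nonneg (h.nonneg (hm.mem N hN i) hx) (h.nonneg (hm.mem N hN b) hx)
        have h1 : ratio D (m N i) (m N a) (share s N i a) ≤ 1 :=
          (Finset.single_le_sum hnn (Finset.mem_erase.2 ⟨ha, Finset.mem_univ a⟩)).trans hsum
        have h2 := h.sq_le_ratio (share_nonneg s N i a) (hm.mem N hN i) (hm.mem N hN a)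
          (hlt' a ha)
        have h3 : share s N i a ^ 2 ≤ κ ^ 2 := by nlinarith
        have h4 := (le_abs_self _).trans (abs_le_of_sq_le_sq h3 (by linarith))
        rwa [share, div_le_iff₀ hni] at h4
    · rw [pulls_succ s N a, if_neg hs, add_zero]
      linarith

/-- The best arm is pulled only when some anchor term is not small, so its number of pulls stays
comparable to the total number of pulls of the challengers. -/
lemma pulls_best_le_mul_sum (h : IsBregman D θ B lo hi k₁ k₂) (hlt : lo < hi) (hγ : 0 < γ)
    (hK : 2 ≤ K) (hm : MeansClose lo hi γ β i μ m T) (hf : FollowsRule D α i s m T) {N : ℕ}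
    (hN : T ≤ N) :
    (pulls s N i : ℝ) ≤
      4 * k₂ / k₁ * ∑ a ∈ Finset.univ.erase i, (pulls s N a : ℝ) + (1 + T) := by
  have hκ := four_le_kappa h hlt
  set κ := 4 * k₂ / k₁ with hκ_def
  induction N, hN using Nat.le_induction with
  | base =>
    have h1 : (pulls s T i : ℝ) ≤ T := by exact_mod_cast pulls_le s T i
    have h2 : (0 : ℝ) ≤ κ * ∑ a ∈ Finset.univ.erase i, (pulls s T a : ℝ) := by positivity
    linarith
  | succ N hN ih =>
    have hmono : ∑ a ∈ Finset.univ.erase i, (pulls s N a : ℝ) ≤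
        ∑ a ∈ Finset.univ.erase i, (pulls s (N + 1) a : ℝ) :=
      Finset.sum_le_sum fun a _ => by exact_mod_cast pulls_mono s a (Nat.le_succ N)
    have hmono' := mul_le_mul_of_nonneg_left hmono (by linarith : 0 ≤ κ)
    by_cases hs : s (N + 1) = i
    · have hT : (0 : ℝ) ≤ T := Nat.cast_nonneg T
      have hsucc : (pulls s (N + 1) i : ℝ) = pulls s N i + 1 := by
        rw [pulls_succ, if_pos hs]
        push_cast
        ring
      suffices hle : (pulls s N i : ℝ) ≤ κ * ∑ a ∈ Finset.univ.erase i, (pulls s N a : ℝ) by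
        linarith
      rcases hf.explore_or_step hN with ⟨-, hex⟩ | ⟨-, hsum⟩ | ⟨hsi, -⟩
      · have : Nontrivial (Fin K) := Fin.nontrivial_iff_two_le.2 hK
        obtain ⟨b, hb⟩ := exists_ne i
        have h1 : (pulls s N i : ℝ) ≤ pulls s N b := by exact_mod_cast hs ▸ hex b
        have h2 : (pulls s N b : ℝ) ≤ ∑ a ∈ Finset.univ.erase i, (pulls s N a : ℝ) :=
          Finset.single_le_sum (f := fun a => (pulls s N a : ℝ)) (fun _ _ => Nat.cast_nonneg _)
            (Finset.mem_erase.2 ⟨hb, Finset.mem_univ b⟩)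
        nlinarith [(Nat.cast_nonneg _ : (0 : ℝ) ≤ pulls s N b)]
      · have hni : (0 : ℝ) < pulls s N i := by exact_mod_cast hf.pos N hN i
        set S := ∑ a ∈ Finset.univ.erase i, share s N i a with hS
        have hS0 : 0 ≤ S := Finset.sum_nonneg fun a _ => share_nonneg s N i a
        have h1 : 1 ≤ κ * ∑ a ∈ Finset.univ.erase i, share s N i a ^ 2 := by
          rw [Finset.mul_sum]
          refine hsum.trans (Finset.sum_le_sum fun a ha => ?_)
          exact h.ratio_le_sq (share_nonneg s N i a) (hm.mem N hN i) (hm.mem N hN a)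
            (by linarith [hm.gap N hN a (Finset.ne_of_mem_erase ha)])
        have h2 : ∑ a ∈ Finset.univ.erase i, share s N i a ^ 2 ≤ S ^ 2 :=
          Finset.sum_sq_le_sq_sum_of_nonneg fun a _ => share_nonneg s N i a
        have h3 : 1 ≤ κ * S := by
          by_contra hlt'
          push Not at hlt'
          have h4 : 0 ≤ κ * S := mul_nonneg (by linarith) hS0
          nlinarith
        have h4 : S = (∑ a ∈ Finset.univ.erase i, (pulls s N a : ℝ)) / pulls s N i := by
          rw [hS, Finset.sum_div]
          rfl
        rw [h4, ← mul_div_assoc, le_div_iff₀ hni, one_mul] at h3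
        exact h3
      · exact absurd hs hsi
    · rw [pulls_succ s N i, if_neg hs, add_zero]
      linarith

/-- Once the best arm has enough pulls to forget the first `T` iterations, the best arm and at
least one challenger have a positive fraction of all pulls. -/
lemma exists_linear_pulls (h : IsBregman D θ B lo hi k₁ k₂) (hlt : lo < hi) (hγ : 0 < γ)
    (hK : 2 ≤ K) (hm : MeansClose lo hi γ β i μ m T) (hf : FollowsRule D α i s m T) {N : ℕ}
    (hN : T ≤ N) (hNi : 2 * ((T : ℝ) + 1) ≤ pulls s N i) :
    k₁ / (16 * k₂ * K) * N ≤ pulls s N i ∧ ∃ b, b ≠ i ∧ k₁ / (16 * k₂ * K) * N ≤ pulls s N b := by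
  have hk := h.k₁_pos
  have hk2 := hk.trans_le (h.k₁_le_k₂ hlt)
  have hκ := four_le_kappa h hlt
  have hK' : (2 : ℝ) ≤ K := by exact_mod_cast hK
  have h1 : ∀ a ∈ Finset.univ.erase i, (pulls s N a : ℝ) ≤ 4 * k₂ / k₁ * pulls s N i + (1 + T) :=
    fun a ha => pulls_le_mul_pulls_best h hlt hγ hm hf hN (Finset.ne_of_mem_erase ha)
  have h2 := pulls_best_le_mul_sum h hlt hγ hK hm hf hN
  have h3 := pulls_add_sum_erase s N i
  have e : k₁ / (16 * k₂ * K) = 1 / (4 * (4 * k₂ / k₁) * K) := by field_simp; ring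
  rw [e]
  set κ := 4 * k₂ / k₁ with hκ_def
  set S := ∑ a ∈ Finset.univ.erase i, (pulls s N a : ℝ) with hS
  have hcard : ((Finset.univ.erase i).card : ℝ) = K - 1 := by
    rw [Finset.card_erase_of_mem (Finset.mem_univ i), Finset.card_univ, Fintype.card_fin,
      Nat.cast_sub (by omega)]
    simp
  have h4 : S ≤ (K - 1) * (κ * pulls s N i + (1 + T)) := by
    have := Finset.sum_le_card_nsmul _ _ _ h1
    rwa [nsmul_eq_mul, hcard] at this
  have hni : (0 : ℝ) ≤ pulls s N i := Nat.cast_nonneg _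
  have hpos : 0 < 4 * κ * K := by positivity
  have hκK : 8 ≤ κ * K := by nlinarith
  refine ⟨?_, ?_⟩
  · rw [div_mul_eq_mul_div, one_mul, div_le_iff₀ hpos]
    have h5 : κ * pulls s N i + (1 + T) ≤ 2 * κ * pulls s N i := by nlinarith
    have h6 : S ≤ K * (2 * κ * pulls s N i) := by
      refine h4.trans ?_
      have : 0 ≤ 2 * κ * pulls s N i := by positivity
      nlinarith
    nlinarith
  · by_contra hno
    push Not at hno
    have h5 : S ≤ (K - 1) * (1 / (4 * κ * K) * N) := by
      have := Finset.sum_le_card_nsmul (Finset.univ.erase i) (fun a => (pulls s N a : ℝ)) _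
        fun a ha => (hno a (Finset.ne_of_mem_erase ha)).le
      rwa [nsmul_eq_mul, hcard] at this
    have h6 : (N : ℝ) ≤ (2 * κ + 1) * S := by nlinarith
    have h7 : S ≤ N / (4 * κ) := by
      refine h5.trans ?_
      rw [div_mul_eq_mul_div, one_mul, ← mul_div_assoc, div_le_div_iff₀ hpos (by linarith)]
      have : (0 : ℝ) ≤ N := Nat.cast_nonneg N
      nlinarith [mul_nonneg this (by linarith : 0 ≤ κ)]
    have hN0 : (0 : ℝ) < N := by
      have : (pulls s N i : ℝ) ≤ N := by exact_mod_cast pulls_le s N i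
      linarith [(Nat.cast_nonneg T : (0 : ℝ) ≤ T)]
    rw [le_div_iff₀ (by linarith)] at h7
    have hS0 : 0 ≤ S := Finset.sum_nonneg fun _ _ => Nat.cast_nonneg _
    nlinarith

set_option maxHeartbeats 800000 in
/-- All arms have a positive fraction of the pulls: a challenger `b` with linearly many pulls was
chosen recently, so that its index, which is then of linear order, was at most the index of any
other challenger `a`, and the latter is at most a multiple of the number of pulls of `a`. -/
lemma exists_forall_mul_le_pulls (h : IsBregman D θ B lo hi k₁ k₂) (hlt : lo < hi) (hγ : 0 < γ)
    (hK : 2 ≤ K) (hα0 : 0 < α) (hα1 : α < 1) :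
    ∃ c : ℝ, 0 < c ∧ c ≤ 1 ∧ ∃ C : ℕ, ∀ (i : Fin K) (μ : Fin K → ℝ) (β : ℝ) (s : ℕ → Fin K)
      (m : ℕ → Fin K → ℝ) (T T' : ℕ), MeansClose lo hi γ β i μ m T → FollowsRule D α i s m T →
      T ≤ T' → (∀ N, T' ≤ N → 2 * ((T : ℝ) + 1) ≤ pulls s N i) →
      ∀ N, C * (T' + 1) ≤ N → ∀ a, c * N ≤ pulls s N a := by
  have hk := h.k₁_pos
  have hk2 := hk.trans_le (h.k₁_le_k₂ hlt)
  have hK' : (2 : ℝ) ≤ K := by exact_mod_cast hK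
  set c₁ := k₁ / (16 * k₂ * K) with hc₁
  have hc10 : 0 < c₁ := by positivity
  have hw : 0 < hi - lo := sub_pos.2 hlt
  set E := k₂ * (hi - lo) ^ 2 + 1 with hE
  have hE0 : 0 < E := by positivity
  set c₂ := k₁ / 4 * γ ^ 2 * (c₁ * (c₁ / 2)) / E with hc₂
  have hc20 : 0 < c₂ := by positivity
  obtain ⟨N₁, hN₁⟩ := exists_forall_rpow_le_mul (c := c₁ / 4) hα1 (by positivity)
  refine ⟨min 1 (min c₁ c₂), by positivity, min_le_left _ _, ⌈(N₁ + 2) / c₁⌉₊ + 1,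
    fun i μ β s m T T' hm hf hTT' hT' N hN a => ?_⟩
  have hN' : ((⌈(N₁ + 2) / c₁⌉₊ : ℝ) + 1) * (T' + 1) ≤ N := by exact_mod_cast hN
  have hceil := Nat.le_ceil ((N₁ + 2 : ℝ) / c₁)
  have hT0 : (0 : ℝ) ≤ T' := Nat.cast_nonneg T'
  have hN10 : (0 : ℝ) ≤ N₁ := Nat.cast_nonneg N₁
  have hdiv : 0 ≤ (N₁ + 2 : ℝ) / c₁ := by positivity
  have hTN : T' ≤ N := by
    have : (T' : ℝ) ≤ N := by nlinarith
    exact_mod_cast this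
  have hbig : (N₁ + 2 : ℝ) * (T' + 1) ≤ c₁ * N := by
    have h1 : (N₁ + 2 : ℝ) / c₁ * (T' + 1) ≤ N := by nlinarith
    rw [div_mul_eq_mul_div, div_le_iff₀ hc10] at h1
    linarith
  have hN0 : (0 : ℝ) ≤ N := Nat.cast_nonneg N
  obtain ⟨hi', b, hb, hbN⟩ := exists_linear_pulls h hlt hγ hK hm hf (hTT'.trans hTN) (hT' N hTN)
  rw [← hc₁] at hi' hbN
  by_cases hai : a = i
  · subst hai
    refine le_trans (mul_le_mul_of_nonneg_right ?_ hN0) hi'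
    exact (min_le_right _ _).trans (min_le_left _ _)
  have hbT : pulls s T' b < pulls s N b := by
    have h1 : (pulls s T' b : ℝ) ≤ T' := by exact_mod_cast pulls_le s T' b
    have h2 : (pulls s T' b : ℝ) < pulls s N b := by nlinarith
    exact_mod_cast h2
  obtain ⟨u, hTu, huN, hsu, hu⟩ := exists_last_pull hbT
  have hu' : (pulls s N b : ℝ) = pulls s u b + 1 := by exact_mod_cast hu
  have hnb : c₁ / 2 * N ≤ pulls s u b := by nlinarith
  have huN' : (u : ℝ) + 1 ≤ N := by exact_mod_cast huN
  have hub : (pulls s u b : ℝ) ≤ u := by exact_mod_cast pulls_le s u b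
  have hnoexp : ((u + 1 : ℕ) : ℝ) ^ α < pulls s u b := by
    have h1 := hN₁ ((u + 1 : ℕ) : ℝ) (by push_cast; nlinarith)
    have h2 : c₁ / 4 * ((u + 1 : ℕ) : ℝ) ≤ c₁ / 4 * N :=
      mul_le_mul_of_nonneg_left (by push_cast; exact huN') (by positivity)
    have h3 : 0 < c₁ * N := by nlinarith
    linarith
  have hTu' : T ≤ u := hTT'.trans hTu
  have hni : (0 : ℝ) < pulls s u i := by exact_mod_cast hf.pos u hTu' i
  have hna : (0 : ℝ) < pulls s u a := by exact_mod_cast hf.pos u hTu' a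
  have hnbpos : (0 : ℝ) < pulls s u b := by exact_mod_cast hf.pos u hTu' b
  suffices hc2 : c₂ * N ≤ pulls s u a by
    have h1 : (pulls s u a : ℝ) ≤ pulls s N a := by exact_mod_cast pulls_mono s a huN.le
    refine le_trans (mul_le_mul_of_nonneg_right ?_ hN0) (hc2.trans h1)
    exact (min_le_right _ _).trans (min_le_right _ _)
  rcases hf.explore_or_step hTu' with ⟨⟨a', ha'⟩, hex⟩ | ⟨hsi, -⟩ | ⟨-, -, hidx⟩
  · exfalso
    have h1 : (pulls s u b : ℝ) ≤ pulls s u a' := by exact_mod_cast hsu ▸ hex a'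
    linarith
  · exact absurd (hsu.symm.trans hsi) hb
  · have h1 := hidx a hai
    rw [hsu] at h1
    have hgap := hm.gap u hTu' b hb
    have h2 := h.mul_le_cost (share_nonneg s u i b) (hm.mem u hTu' i) (hm.mem u hTu' b)
    have h3 := h.cost_le_mul (share_nonneg s u i a) (hm.mem u hTu' i) (hm.mem u hTu' a)
      (by linarith [hm.gap u hTu' a hai])
    have h4 : (pulls s u i : ℝ) * cost D (m u i) (m u a) (share s u i a) ≤
        k₂ * (hi - lo) ^ 2 * pulls s u a := by
      refine (mul_le_mul_of_nonneg_left h3 hni.le).trans (le_of_eq ?_)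
      rw [share]
      field_simp
    have h5 : Real.log (pulls s u a) ≤ pulls s u a := Real.log_le_self hna.le
    have hiu := (exists_linear_pulls h hlt hγ hK hm hf hTu' (hT' u hTu)).1
    rw [← hc₁] at hiu
    have hu0 : (0 : ℝ) < u := hnbpos.trans_le hub
    -- the index of `b` is at least a multiple of the harmonic mean of the two numbers of pulls
    have h6 : k₁ / 4 * γ ^ 2 * (c₁ * (c₁ / 2) * N) ≤
        pulls s u i * cost D (m u i) (m u b) (share s u i b) := by
      have h7 : (pulls s u i : ℝ) + pulls s u b ≤ u := by
        have h8 := pulls_add_sum_erase s u i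
        have h9 : (pulls s u b : ℝ) ≤ ∑ a ∈ Finset.univ.erase i, (pulls s u a : ℝ) :=
          Finset.single_le_sum (f := fun a => (pulls s u a : ℝ)) (fun _ _ => Nat.cast_nonneg _)
            (Finset.mem_erase.2 ⟨hb, Finset.mem_univ b⟩)
        linarith
      have h8 : c₁ * (c₁ / 2) * N ≤
          pulls s u i * (share s u i b / (1 + share s u i b)) := by
        have e1 : (pulls s u i : ℝ) * (share s u i b / (1 + share s u i b))
            = pulls s u i * pulls s u b / (pulls s u i + pulls s u b) := by
          rw [share]
          field_simp
        rw [e1, le_div_iff₀ (by positivity)]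
        calc c₁ * (c₁ / 2) * N * (pulls s u i + pulls s u b) ≤ c₁ * (c₁ / 2) * N * u := by gcongr
          _ = (c₁ * u) * (c₁ / 2 * N) := by ring
          _ ≤ pulls s u i * pulls s u b := by gcongr
      have h9 : γ ^ 2 ≤ (m u i - m u b) ^ 2 := pow_le_pow_left₀ hγ.le hgap 2
      calc k₁ / 4 * γ ^ 2 * (c₁ * (c₁ / 2) * N)
          ≤ k₁ / 4 * (m u i - m u b) ^ 2
            * (pulls s u i * (share s u i b / (1 + share s u i b))) := by gcongr
        _ = pulls s u i * (k₁ / 4 * (m u i - m u b) ^ 2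
            * (share s u i b / (1 + share s u i b))) := by ring
        _ ≤ _ := by gcongr
    have h10 : k₁ / 4 * γ ^ 2 * (c₁ * (c₁ / 2) * N) ≤ E * pulls s u a := by
      rw [hE]
      linarith
    rw [hc₂, div_mul_eq_mul_div, div_le_iff₀ hE0]
    linarith

end Growth

/-! ### The anchor function and the indexes in the regime of linear growth -/

namespace RateBounds

variable {D : ℝ → ℝ → ℝ} {lo hi γ c L p q s t δ : ℝ}

lemma ratio_le_add (h : RateBounds D lo hi γ c L) (hp : p ∈ Set.Icc lo hi)
    (hq : q ∈ Set.Icc lo hi) (hpq : γ ≤ p - q) (hs : s ∈ Set.Icc c (1 / c))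
    (ht : t ∈ Set.Icc c (1 / c)) (hδ : 0 ≤ δ) (hst : s ≤ t + δ) :
    ratio D p q s ≤ ratio D p q t + L * δ := by
  have hL : 0 < L := zero_lt_one.trans_le h.one_le
  rcases le_total s t with hle | hle
  · have h1 := h.le_ratio_sub p hp q hq hpq s hs t ht hle
    have h2 : 0 ≤ (t - s) / L := div_nonneg (sub_nonneg.2 hle) hL.le
    nlinarith
  · have h1 := h.ratio_sub_le p hp q hq hpq t ht s hs hle
    nlinarith

lemma cost_le_add (h : RateBounds D lo hi γ c L) (hp : p ∈ Set.Icc lo hi)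
    (hq : q ∈ Set.Icc lo hi) (hpq : γ ≤ p - q) (hs : s ∈ Set.Icc c (1 / c))
    (ht : t ∈ Set.Icc c (1 / c)) (hδ : 0 ≤ δ) (hst : s ≤ t + δ) :
    cost D p q s ≤ cost D p q t + L * δ := by
  have hL : 0 < L := zero_lt_one.trans_le h.one_le
  rcases le_total s t with hle | hle
  · have h1 := h.le_cost_sub p hp q hq hpq s hs t ht hle
    have h2 : 0 ≤ (t - s) / L := div_nonneg (sub_nonneg.2 hle) hL.le
    nlinarith
  · have h1 := h.cost_sub_le p hp q hq hpq t ht s hs hle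
    nlinarith

end RateBounds

lemma rpow_neg_le_of_mul_le {d β x y : ℝ} (hd0 : 0 < d) (hd1 : d ≤ 1) (hβ0 : 0 ≤ β) (hβ1 : β ≤ 1)
    (hx : 0 < x) (hxy : d * x ≤ y) : y ^ (-β) ≤ 1 / d * x ^ (-β) := by
  have h1 : y ^ (-β) ≤ (d * x) ^ (-β) :=
    Real.rpow_le_rpow_of_nonpos (by positivity) hxy (by linarith)
  have h2 : d ^ (-β) ≤ d ^ (-1 : ℝ) := Real.rpow_le_rpow_of_exponent_ge hd0 hd1 (by linarith)
  rw [Real.rpow_neg_one, ← one_div] at h2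
  rw [Real.mul_rpow hd0.le hx.le] at h1
  exact h1.trans (mul_le_mul_of_nonneg_right h2 (Real.rpow_nonneg hx.le _))

lemma one_div_le_rpow_neg {β x : ℝ} (hβ1 : β ≤ 1) (hx : 1 ≤ x) : 1 / x ≤ x ^ (-β) := by
  rw [one_div, ← Real.rpow_neg_one]
  exact Real.rpow_le_rpow_of_exponent_le hx (by linarith)

/-- From iteration `T` on, the means are close to `μ`, every arm has at least the fraction `c` of the
pulls, and there is no forced exploration. -/
structure Settled (D : ℝ → ℝ → ℝ) (lo hi γ c β : ℝ) (i : Fin K) (μ : Fin K → ℝ) (s : ℕ → Fin K)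
    (m : ℕ → Fin K → ℝ) (T : ℕ) : Prop where
  means : MeansClose lo hi γ β i μ m T
  one_le : 1 ≤ T
  linear : ∀ N, T ≤ N → ∀ a, c * N ≤ pulls s N a
  step : ∀ N, T ≤ N → AnchoredStep D i s m N

section Settled

variable {D : ℝ → ℝ → ℝ} {lo hi γ c β L : ℝ} {i : Fin K} {μ : Fin K → ℝ} {s : ℕ → Fin K}
  {m : ℕ → Fin K → ℝ} {T : ℕ}

lemma Settled.mono (h : Settled D lo hi γ c β i μ s m T) {T' : ℕ} (hT : T ≤ T') :
    Settled D lo hi γ c β i μ s m T' :=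
  ⟨⟨fun N hN => h.means.mem N (hT.trans hN), fun N hN => h.means.gap N (hT.trans hN),
    fun N hN => h.means.close N (hT.trans hN)⟩, h.one_le.trans hT,
    fun N hN => h.linear N (hT.trans hN), fun N hN => h.step N (hT.trans hN)⟩

lemma Settled.cast_one_le (h : Settled D lo hi γ c β i μ s m T) {N : ℕ} (hN : T ≤ N) :
    (1 : ℝ) ≤ N := by
  exact_mod_cast h.one_le.trans hN

lemma Settled.share_mem (h : Settled D lo hi γ c β i μ s m T) (hc : 0 < c) {N : ℕ} (hN : T ≤ N)
    (a : Fin K) : share s N i a ∈ Set.Icc c (1 / c) := by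
  have hN1 := h.cast_one_le hN
  have h1 := h.linear N hN a
  have h2 := h.linear N hN i
  have h3 : (pulls s N a : ℝ) ≤ N := by exact_mod_cast pulls_le s N a
  have h4 : (pulls s N i : ℝ) ≤ N := by exact_mod_cast pulls_le s N i
  have h5 : (0 : ℝ) < pulls s N i := lt_of_lt_of_le (by positivity) h2
  rw [share]
  constructor
  · rw [le_div_iff₀ h5]
    nlinarith
  · rw [div_le_div_iff₀ h5 hc]
    nlinarith

lemma share_le_add_of_pulls_le {t N : ℕ} {a : Fin K} (hc : 0 < c) (ht : (0 : ℝ) < t)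
    (hi : c * t ≤ pulls s t i) (htN : t ≤ N) (ha : pulls s N a ≤ pulls s t a + 1) :
    share s N i a ≤ share s t i a + 1 / (c * t) := by
  have h1 : (pulls s t i : ℝ) ≤ pulls s N i := by exact_mod_cast pulls_mono s i htN
  have h2 : (pulls s N a : ℝ) ≤ pulls s t a + 1 := by exact_mod_cast ha
  have h3 : 0 < c * t := by positivity
  have h4 : (0 : ℝ) < pulls s t i := h3.trans_le hi
  calc share s N i a ≤ (pulls s t a + 1) / pulls s t i := by
        rw [share]
        gcongr
    _ = share s t i a + 1 / pulls s t i := by rw [share, add_div]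
    _ ≤ _ := by gcongr

/-- The sum of the anchor terms at the means `μ`; the anchor function is this sum minus one. -/
noncomputable def anchorSum (D : ℝ → ℝ → ℝ) (i : Fin K) (μ : Fin K → ℝ) (s : ℕ → Fin K) (N : ℕ) :
    ℝ :=
  ∑ a ∈ Finset.univ.erase i, ratio D (μ i) (μ a) (share s N i a)

lemma sum_erase_le_card_mul {f : Fin K → ℝ} {x : ℝ} (hx : 0 ≤ x) (h : ∀ a, a ≠ i → f a ≤ x) :
    ∑ a ∈ Finset.univ.erase i, f a ≤ K * x := by
  have h1 := Finset.sum_le_card_nsmul (Finset.univ.erase i) f x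
    fun a ha => h a (Finset.ne_of_mem_erase ha)
  rw [nsmul_eq_mul] at h1
  refine h1.trans (mul_le_mul_of_nonneg_right ?_ hx)
  have := Finset.card_le_univ (Finset.univ.erase i)
  rw [Fintype.card_fin] at this
  exact_mod_cast this

lemma Settled.abs_anchorSum_sub_le (h : Settled D lo hi γ c β i μ s m T)
    (hL : RateBounds D lo hi γ c L) (hc : 0 < c) (hμ : ∀ a, μ a ∈ Set.Icc lo hi)
    (hμγ : ∀ a, a ≠ i → γ ≤ μ i - μ a) {N : ℕ} (hN : T ≤ N) :
    |anchorSum D i (m N) s N - anchorSum D i μ s N| ≤ K * (2 * L * (N : ℝ) ^ (-β)) := by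
  have hL0 := zero_le_one.trans hL.one_le
  rw [anchorSum, anchorSum, ← Finset.sum_sub_distrib]
  refine (Finset.abs_sum_le_sum_abs _ _).trans (sum_erase_le_card_mul (by positivity) fun a ha => ?_)
  refine (hL.abs_ratio_sub_le _ (h.means.mem N hN i) _ (h.means.mem N hN a)
    (h.means.gap N hN a ha) _ (hμ i) _ (hμ a) (hμγ a ha) _ (h.share_mem hc hN a)).trans ?_
  have h1 := h.means.close N hN i
  have h2 := h.means.close N hN a
  calc L * (|m N i - μ i| + |m N a - μ a|) ≤ L * ((N : ℝ) ^ (-β) + (N : ℝ) ^ (-β)) := by gcongr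
    _ = _ := by ring

lemma Settled.anchorSum_le_add (h : Settled D lo hi γ c β i μ s m T)
    (hL : RateBounds D lo hi γ c L) (hc : 0 < c) (hμ : ∀ a, μ a ∈ Set.Icc lo hi)
    (hμγ : ∀ a, a ≠ i → γ ≤ μ i - μ a) {t N : ℕ} (ht : T ≤ t) (hN : T ≤ N) {δ : ℝ} (hδ : 0 ≤ δ)
    (hs : ∀ a, a ≠ i → share s t i a ≤ share s N i a + δ) :
    anchorSum D i μ s t ≤ anchorSum D i μ s N + K * (L * δ) := by
  have hL0 := zero_le_one.trans hL.one_le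
  rw [← sub_le_iff_le_add', anchorSum, anchorSum, ← Finset.sum_sub_distrib]
  refine sum_erase_le_card_mul (by positivity) fun a ha => ?_
  rw [sub_le_iff_le_add']
  exact hL.ratio_le_add (hμ i) (hμ a) (hμγ a ha) (h.share_mem hc ht a) (h.share_mem hc hN a) hδ
    (hs a ha)

/-- The anchor function stays near zero. For the upper bound look at the last pull of a challenger:
the anchor function was nonpositive then, and has decreased since. For the lower bound look at the
last pull of the best arm. -/
lemma Settled.abs_anchorSum_sub_one_le (h : Settled D lo hi γ c β i μ s m T)
    (hL : RateBounds D lo hi γ c L) (hK : 2 ≤ K) (hc : 0 < c) (hc1 : c ≤ 1) (hβ0 : 0 ≤ β)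
    (hβ1 : β ≤ 1) (hμ : ∀ a, μ a ∈ Set.Icc lo hi) (hμγ : ∀ a, a ≠ i → γ ≤ μ i - μ a) {N : ℕ}
    (hN : 2 * ((T : ℝ) + 1) ≤ c * N) :
    |anchorSum D i μ s N - 1| ≤ 2 / c * (K * L * (2 + 1 / c ^ 2)) * (N : ℝ) ^ (-β) := by
  have hL0 := zero_le_one.trans hL.one_le
  have hT0 : (0 : ℝ) ≤ T := Nat.cast_nonneg T
  have hN0 : (0 : ℝ) < N := by
    by_contra hneg
    push Not at hneg
    nlinarith
  have hTN : T ≤ N := by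
    have : (T : ℝ) ≤ N := by nlinarith
    exact_mod_cast this
  -- the bound at the time `t` of a recent pull is transported to `N`
  have main : ∀ t : ℕ, c * N ≤ t + 1 → T ≤ t ∧ (0 : ℝ) < t ∧
      K * (2 * L * (t : ℝ) ^ (-β)) + K * (L * (1 / (c ^ 2 * t))) ≤
        2 / c * (K * L * (2 + 1 / c ^ 2)) * (N : ℝ) ^ (-β) := by
    intro t ht
    have ht1 : T ≤ t := by
      have : (T : ℝ) ≤ t := by linarith
      exact_mod_cast this
    have ht2 := h.cast_one_le ht1
    have ht3 : c / 2 * N ≤ t := by linarith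
    have h1 := rpow_neg_le_of_mul_le (by positivity) (by linarith) hβ0 hβ1 hN0 ht3
    have h2 := one_div_le_rpow_neg hβ1 ht2
    rw [one_div_div] at h1
    refine ⟨ht1, by linarith, ?_⟩
    calc K * (2 * L * (t : ℝ) ^ (-β)) + K * (L * (1 / (c ^ 2 * t)))
        = K * L * (2 * (t : ℝ) ^ (-β) + 1 / c ^ 2 * (1 / t)) := by
          field_simp
      _ ≤ K * L * (2 * (t : ℝ) ^ (-β) + 1 / c ^ 2 * (t : ℝ) ^ (-β)) := by gcongr
      _ = K * L * (2 + 1 / c ^ 2) * (t : ℝ) ^ (-β) := by ring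
      _ ≤ K * L * (2 + 1 / c ^ 2) * (2 / c * (N : ℝ) ^ (-β)) := by gcongr
      _ = _ := by ring
  rw [abs_le]
  constructor
  · have hpos : pulls s 0 i < pulls s N i := by
      have h1 : (0 : ℝ) < pulls s N i := lt_of_lt_of_le (by positivity) (h.linear N hTN i)
      rw [pulls_zero]
      exact_mod_cast h1
    obtain ⟨t, -, htN, hst, hti⟩ := exists_last_pull hpos
    have ht : c * N ≤ t + 1 := by
      have h1 : (pulls s N i : ℝ) ≤ t + 1 := by
        exact_mod_cast hti.trans_le (Nat.succ_le_succ (pulls_le s t i))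
      exact (h.linear N hTN i).trans h1
    obtain ⟨hTt, ht0, hbound⟩ := main t ht
    have hstep : 1 ≤ anchorSum D i (m t) s t := by
      rcases h.step t hTt with ⟨-, h1⟩ | ⟨h1, -⟩
      · exact h1
      · exact absurd hst h1
    have h1 := abs_le.1 (h.abs_anchorSum_sub_le hL hc hμ hμγ hTt)
    have h2 := h.anchorSum_le_add hL hc hμ hμγ hTt hTN (δ := 1 / (c ^ 2 * t)) (by positivity)
      fun a _ => by
        have hni : (0 : ℝ) < pulls s t i := lt_of_lt_of_le (by positivity) (h.linear t hTt i)
        have h3 : (pulls s t a : ℝ) ≤ pulls s N a := by exact_mod_cast pulls_mono s a htN.le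
        have h4 : (pulls s N i : ℝ) = pulls s t i + 1 := by exact_mod_cast hti
        have h5 := (h.share_mem hc hTt a).2
        have h6 := h.linear t hTt i
        have h7 : share s t i a - share s t i a / (pulls s t i + 1) ≤ share s N i a := by
          rw [share, share, h4]
          refine le_trans (le_of_eq ?_) (div_le_div_of_nonneg_right h3 (by positivity))
          field_simp
          ring
        have h8 : share s t i a / (pulls s t i + 1) ≤ 1 / (c ^ 2 * t) := by
          calc share s t i a / (pulls s t i + 1) ≤ (1 / c) / (c * t) :=
                div_le_div₀ (by positivity) h5 (by positivity) (by linarith)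
            _ = 1 / (c ^ 2 * t) := by field_simp
        linarith
    linarith [h1.1, h1.2]
  · have : Nontrivial (Fin K) := Fin.nontrivial_iff_two_le.2 hK
    obtain ⟨b, hb⟩ := exists_ne i
    have hpos : 0 < pulls s N b := by
      have h1 : (0 : ℝ) < pulls s N b := lt_of_lt_of_le (by positivity) (h.linear N hTN b)
      exact_mod_cast h1
    obtain ⟨t, htN, hst, hto⟩ := exists_last_other_pull hb hpos
    have ht : c * N ≤ t + 1 := by
      have h1 : (pulls s N b : ℝ) ≤ t + 1 := by exact_mod_cast hto b hb ▸ pulls_le s (t + 1) b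
      exact (h.linear N hTN b).trans h1
    obtain ⟨hTt, ht0, hbound⟩ := main t ht
    have hstep : anchorSum D i (m t) s t ≤ 1 := by
      rcases h.step t hTt with ⟨h1, -⟩ | ⟨-, h1, -⟩
      · exact absurd h1 hst
      · exact h1
    have h1 := abs_le.1 (h.abs_anchorSum_sub_le hL hc hμ hμγ hTt)
    have h2 := h.anchorSum_le_add hL hc hμ hμγ hTN hTt (δ := 1 / (c ^ 2 * t)) (by positivity)
      fun a ha => by
        have h3 := share_le_add_of_pulls_le (s := s) (i := i) hc ht0 (h.linear t hTt i) htN.le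
          ((hto a ha).trans_le (pulls_succ_le s t a))
        have h4 : 1 / (c * t) ≤ 1 / (c ^ 2 * t) := by
          refine one_div_le_one_div_of_le (by positivity) ?_
          have : c ^ 2 ≤ c := by nlinarith
          gcongr
        linarith
    linarith [h1.1, h1.2]

/-- At a pull of a challenger, its normalised index at `μ` is at most that of any other challenger,
up to an error of the order of the distance of the means. -/
lemma Settled.cost_le_of_pull (h : Settled D lo hi γ c β i μ s m T)
    (hL : RateBounds D lo hi γ c L) (hc : 0 < c) (hβ1 : β < 1)
    (hμ : ∀ a, μ a ∈ Set.Icc lo hi) (hμγ : ∀ a, a ≠ i → γ ≤ μ i - μ a) {t : ℕ} (ht : T ≤ t)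
    {a b : Fin K} (hst : s (t + 1) = a) (ha : a ≠ i) (hb : b ≠ i) :
    cost D (μ i) (μ a) (share s t i a) ≤ cost D (μ i) (μ b) (share s t i b)
      + (4 * L + 1 / (c * (1 - β))) * (t : ℝ) ^ (-β) := by
  have hL0 := zero_le_one.trans hL.one_le
  have ht1 := h.cast_one_le ht
  have ht0 : (0 : ℝ) < t := by linarith
  rcases h.step t ht with ⟨h1, -⟩ | ⟨-, -, hidx⟩
  · exact absurd (hst.symm.trans h1) ha
  have h1 := hidx b hb
  rw [hst] at h1
  have hlin := h.linear t ht i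
  have hni : (0 : ℝ) < pulls s t i := lt_of_lt_of_le (by positivity) hlin
  have hlog : Real.log (pulls s t b) ≤ pulls s t i * (1 / (c * (1 - β)) * (t : ℝ) ^ (-β)) := by
    have hnb : (0 : ℝ) < pulls s t b := lt_of_lt_of_le (by positivity) (h.linear t ht b)
    have h2 : (pulls s t b : ℝ) ≤ t := by exact_mod_cast pulls_le s t b
    have h3 : 0 < 1 - β := by linarith
    calc Real.log (pulls s t b) ≤ Real.log t := Real.log_le_log hnb h2
      _ ≤ (t : ℝ) ^ (1 - β) / (1 - β) := Real.log_le_rpow_div ht0.le h3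
      _ = c * t * (1 / (c * (1 - β)) * (t : ℝ) ^ (-β)) := by
          rw [show 1 - β = 1 + -β by ring, Real.rpow_add ht0, Real.rpow_one]
          field_simp
      _ ≤ _ := by gcongr
  have h2 : cost D (m t i) (m t a) (share s t i a) ≤ cost D (m t i) (m t b) (share s t i b)
      + 1 / (c * (1 - β)) * (t : ℝ) ^ (-β) := by
    refine le_of_mul_le_mul_left ?_ hni
    linarith
  have key : ∀ x, x ≠ i → |cost D (m t i) (m t x) (share s t i x)
      - cost D (μ i) (μ x) (share s t i x)| ≤ 2 * L * (t : ℝ) ^ (-β) := by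
    intro x hx
    refine (hL.abs_cost_sub_le _ (h.means.mem t ht i) _ (h.means.mem t ht x)
      (h.means.gap t ht x hx) _ (hμ i) _ (hμ x) (hμγ x hx) _ (h.share_mem hc ht x)).trans ?_
    have h3 := h.means.close t ht i
    have h4 := h.means.close t ht x
    calc L * (|m t i - μ i| + |m t x - μ x|) ≤ L * ((t : ℝ) ^ (-β) + (t : ℝ) ^ (-β)) := by gcongr
      _ = _ := by ring
  have h3 := abs_le.1 (key a ha)
  have h4 := abs_le.1 (key b hb)
  linarith [h3.1, h4.2]

set_option maxHeartbeats 1000000 in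
/-- Between the last pull of a challenger `a` and the present, the best arm receives few pulls. Such
pulls decrease the anchor term of `a`; as the anchor sum stays near one, the anchor term of some other
challenger `b` increases, so `b` is pulled, and at its last pull its index was at most that of `a`.
Hence the index of `b` was well below that of `a` when `a` was pulled, against the rule. -/
lemma Settled.one_sub_div_le (h : Settled D lo hi γ c β i μ s m T)
    (hL : RateBounds D lo hi γ c L) (hc : 0 < c) (hβ0 : 0 ≤ β) (hβ1 : β < 1)
    (hc1 : c ≤ 1) (hμ : ∀ a, μ a ∈ Set.Icc lo hi) (hμγ : ∀ a, a ≠ i → γ ≤ μ i - μ a) {C₁ C₂ : ℝ}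
    (hC₁0 : 0 ≤ C₁) (hC₁ : ∀ N : ℕ, T ≤ N → |anchorSum D i μ s N - 1| ≤ C₁ * (N : ℝ) ^ (-β))
    (hC₂ : C₂ = 4 * L + 1 / (c * (1 - β))) {t N : ℕ} {a : Fin K} (ha : a ≠ i) (hTt : T ≤ t)
    (htN : t < N) (hst : s (t + 1) = a) (hlast : pulls s N a = pulls s t a + 1)
    (ht : c / 2 * N ≤ t) :
    1 - (pulls s t i : ℝ) / pulls s N i ≤
      1 / c * (L * (K * (L ^ 2 * (2 / c * (2 * C₂ + 2 * (L / c)))) + C₁ + C₁ * (2 / c)) + 2 / c ^ 2)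
        * (N : ℝ) ^ (-β) := by
  have hL1 := hL.one_le
  have hL0 : 0 < L := by linarith
  have hTN : T ≤ N := hTt.trans htN.le
  have hN1 := h.cast_one_le hTN
  have ht1 := h.cast_one_le hTt
  have hN0 : (0 : ℝ) < N := by linarith
  have ht0 : (0 : ℝ) < t := by linarith
  set e := (N : ℝ) ^ (-β) with he
  have he0 : 0 < e := Real.rpow_pos_of_pos hN0 _
  have hC₂0 : 0 ≤ C₂ := by
    rw [hC₂]
    have : 0 < 1 - β := by linarith
    positivity
  have hlate : ∀ u : ℕ, t ≤ u → (u : ℝ) ^ (-β) ≤ 2 / c * e ∧ 1 / (c * u) ≤ 1 / c * (2 / c * e) := by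
    intro u hu
    have hu' : (t : ℝ) ≤ u := by exact_mod_cast hu
    have h1 := rpow_neg_le_of_mul_le (y := (u : ℝ)) (by positivity) (by linarith) hβ0 hβ1.le hN0
      (ht.trans hu')
    rw [one_div_div] at h1
    have h2 := one_div_le_rpow_neg hβ1.le (ht1.trans hu')
    refine ⟨h1, ?_⟩
    rw [← one_div_mul_one_div]
    exact mul_le_mul_of_nonneg_left (h2.trans h1) (by positivity)
  have hnit : (0 : ℝ) < pulls s t i := lt_of_lt_of_le (by positivity) (h.linear t hTt i)
  have hniN : (0 : ℝ) < pulls s N i := lt_of_lt_of_le (by positivity) (h.linear N hTN i)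
  have hni : (pulls s t i : ℝ) ≤ pulls s N i := by exact_mod_cast pulls_mono s i htN.le
  set x := 1 - (pulls s t i : ℝ) / pulls s N i with hx
  have hx0 : 0 ≤ x := by
    rw [hx, sub_nonneg, div_le_one hniN]
    exact hni
  -- `R` is the least total increase of the other anchor terms that compensates the decrease of
  -- the term of `a`
  set R := (x * c - 2 / c ^ 2 * e) / L - (C₁ + C₁ * (2 / c)) * e with hR
  suffices hRle : R ≤ K * (L ^ 2 * (2 / c * (2 * C₂ + 2 * (L / c)))) * e by
    have h1 : (x * c - 2 / c ^ 2 * e) / L ≤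
        (K * (L ^ 2 * (2 / c * (2 * C₂ + 2 * (L / c)))) + C₁ + C₁ * (2 / c)) * e := by linarith
    rw [div_le_iff₀ hL0] at h1
    rw [one_div, mul_assoc, inv_mul_eq_div, le_div_iff₀ hc]
    linarith
  set C₄ := 2 / c * (2 * C₂ + 2 * (L / c)) with hC₄
  have hC₄0 : 0 ≤ C₄ := by positivity
  by_contra hlt
  push Not at hlt
  have hRpos : 0 < R := lt_of_le_of_lt (by positivity) hlt
  -- the anchor term of `a` decreases
  have hsa : share s N i a ≤ share s t i a - (x * c - 2 / c ^ 2 * e) := by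
    have h1 : share s N i a = (1 - x) * share s t i a + 1 / pulls s N i := by
      rw [share, share, hx, hlast]
      push_cast
      field_simp
      ring
    have h2 : 1 / (pulls s N i : ℝ) ≤ 2 / c ^ 2 * e := by
      have h3 := (hlate N htN.le).2
      have h4 : 1 / (pulls s N i : ℝ) ≤ 1 / (c * N) :=
        one_div_le_one_div_of_le (by positivity) (h.linear N hTN i)
      have e1 : 1 / c * (2 / c * e) = 2 / c ^ 2 * e := by field_simp
      linarith
    have h3 := (h.share_mem hc hTt a).1
    nlinarith
  have hxc : 0 < x * c - 2 / c ^ 2 * e := by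
    have h1 : 0 ≤ (C₁ + C₁ * (2 / c)) * e := by positivity
    have h2 : 0 < (x * c - 2 / c ^ 2 * e) / L := by linarith
    exact (div_pos_iff_of_pos_right hL0).1 h2
  have hra : (x * c - 2 / c ^ 2 * e) / L ≤
      ratio D (μ i) (μ a) (share s t i a) - ratio D (μ i) (μ a) (share s N i a) := by
    refine le_trans ?_ (hL.le_ratio_sub _ (hμ i) _ (hμ a) (hμγ a ha) _ (h.share_mem hc hTN a) _
      (h.share_mem hc hTt a) (by linarith))
    exact div_le_div_of_nonneg_right (by linarith) hL0.le
  have hsum : R ≤ ∑ b ∈ (Finset.univ.erase i).erase a,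
      (ratio D (μ i) (μ b) (share s N i b) - ratio D (μ i) (μ b) (share s t i b)) := by
    have hmem : a ∈ Finset.univ.erase i := Finset.mem_erase.2 ⟨ha, Finset.mem_univ a⟩
    have h1 := Finset.add_sum_erase (Finset.univ.erase i)
      (fun b => ratio D (μ i) (μ b) (share s N i b) - ratio D (μ i) (μ b) (share s t i b)) hmem
    have h2 : ∑ b ∈ Finset.univ.erase i,
        (ratio D (μ i) (μ b) (share s N i b) - ratio D (μ i) (μ b) (share s t i b))
        = anchorSum D i μ s N - anchorSum D i μ s t := by
      rw [Finset.sum_sub_distrib]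
      rfl
    have h3 := abs_le.1 (hC₁ N hTN)
    have h4 := abs_le.1 (hC₁ t hTt)
    have h5 : C₁ * (t : ℝ) ^ (-β) ≤ C₁ * (2 / c * e) :=
      mul_le_mul_of_nonneg_left (hlate t le_rfl).1 hC₁0
    rw [h2] at h1
    rw [hR]
    linarith [h3.1, h4.2]
  -- so the anchor term of some other challenger increases
  obtain ⟨b, hbi, hb⟩ : ∃ b, b ≠ i ∧ R / K ≤
      ratio D (μ i) (μ b) (share s N i b) - ratio D (μ i) (μ b) (share s t i b) := by
    by_contra hno
    push Not at hno
    have hne : ((Finset.univ.erase i).erase a).Nonempty := by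
      rw [Finset.nonempty_iff_ne_empty]
      intro hem
      rw [hem, Finset.sum_empty] at hsum
      linarith
    have h1 := Finset.sum_lt_sum_of_nonempty hne fun b hb =>
      hno b (Finset.ne_of_mem_erase (Finset.mem_of_mem_erase hb))
    rw [Finset.sum_const, nsmul_eq_mul] at h1
    have h2 : (((Finset.univ.erase i).erase a).card : ℝ) ≤ K := by
      have := Finset.card_le_univ ((Finset.univ.erase i).erase a)
      rw [Fintype.card_fin] at this
      exact_mod_cast this
    have hK0 : (0 : ℝ) < K := by exact_mod_cast i.pos
    have h3 : (((Finset.univ.erase i).erase a).card : ℝ) * (R / K) ≤ K * (R / K) :=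
      mul_le_mul_of_nonneg_right h2 (by positivity)
    rw [mul_div_cancel₀ _ hK0.ne'] at h3
    linarith
  have hK0 : (0 : ℝ) < K := by exact_mod_cast i.pos
  have hRK : 0 < R / K := by positivity
  have hsb : share s t i b < share s N i b := by
    by_contra hle
    push Not at hle
    have h1 := hL.ratio_le_add (hμ i) (hμ b) (hμγ b hbi) (h.share_mem hc hTN b)
      (h.share_mem hc hTt b) le_rfl (by linarith)
    linarith
  have hsb' : R / K ≤ L * (share s N i b - share s t i b) :=
    hb.trans (hL.ratio_sub_le _ (hμ i) _ (hμ b) (hμγ b hbi) _ (h.share_mem hc hTt b) _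
      (h.share_mem hc hTN b) hsb.le)
  have hpb : pulls s t b < pulls s N b := by
    by_contra hle
    push Not at hle
    have h1 : (pulls s N b : ℝ) ≤ pulls s t b := by exact_mod_cast hle
    have h2 : share s N i b ≤ share s t i b := by
      rw [share, share]
      gcongr
    linarith
  -- at its last pull, the index of `b` is at most that of `a`, which has not increased much
  obtain ⟨u, htu, huN, hsu, hu⟩ := exists_last_pull hpb
  have hTu : T ≤ u := hTt.trans htu
  have hu0 : (0 : ℝ) < u := by linarith [h.cast_one_le hTu]
  have h1 := h.cost_le_of_pull hL hc hβ1 hμ hμγ hTt hst ha hbi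
  have h2 := h.cost_le_of_pull hL hc hβ1 hμ hμγ hTu hsu hbi ha
  rw [← hC₂] at h1 h2
  have h3 := hL.cost_le_add (hμ i) (hμ b) (hμγ b hbi) (h.share_mem hc hTN b)
    (h.share_mem hc hTu b) (by positivity) (share_le_add_of_pulls_le hc hu0 (h.linear u hTu i)
      huN.le hu.le)
  have h4 := hL.cost_le_add (hμ i) (hμ a) (hμγ a ha) (h.share_mem hc hTu a)
    (h.share_mem hc hTt a) (by positivity) (share_le_add_of_pulls_le hc ht0 (h.linear t hTt i) htu
      ((pulls_mono s a huN.le).trans hlast.le))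
  have h5 := mul_le_mul_of_nonneg_left (hlate t le_rfl).1 hC₂0
  have h6 := mul_le_mul_of_nonneg_left (hlate u htu).1 hC₂0
  have h7 := mul_le_mul_of_nonneg_left (hlate t le_rfl).2 hL0.le
  have h8 := mul_le_mul_of_nonneg_left (hlate u htu).2 hL0.le
  have h9 : cost D (μ i) (μ b) (share s N i b) ≤ cost D (μ i) (μ b) (share s t i b) + C₄ * e := by
    have e1 : C₄ * e = C₂ * (2 / c * e) + C₂ * (2 / c * e) + L * (1 / c * (2 / c * e))
        + L * (1 / c * (2 / c * e)) := by
      rw [hC₄]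
      field_simp
      ring
    linarith
  have h10 := hL.le_cost_sub _ (hμ i) _ (hμ b) (hμγ b hbi) _ (h.share_mem hc hTt b) _
    (h.share_mem hc hTN b) hsb.le
  have h11 : share s N i b - share s t i b ≤ L * (C₄ * e) := by
    rw [div_le_iff₀ hL0] at h10
    nlinarith
  have h12 : R / K ≤ L * (L * (C₄ * e)) :=
    hsb'.trans (mul_le_mul_of_nonneg_left h11 hL0.le)
  rw [div_le_iff₀ hK0, show L * (L * (C₄ * e)) * K = K * (L ^ 2 * C₄) * e by ring] at h12
  exact absurd h12 (not_le.2 hlt)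

/-- The normalised indexes of the challengers at `μ` differ by at most the order of the distance of
the means. -/
lemma Settled.exists_cost_le (hL : RateBounds D lo hi γ c L) (hc : 0 < c) (hc1 : c ≤ 1)
    (hβ0 : 0 ≤ β) (hβ1 : β < 1) (hμ : ∀ a, μ a ∈ Set.Icc lo hi)
    (hμγ : ∀ a, a ≠ i → γ ≤ μ i - μ a) {C₁ : ℝ} (hC₁0 : 0 ≤ C₁) :
    ∃ C : ℝ, 0 < C ∧ ∀ (s : ℕ → Fin K) (m : ℕ → Fin K → ℝ) (T : ℕ),
      Settled D lo hi γ c β i μ s m T →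
      (∀ N : ℕ, T ≤ N → |anchorSum D i μ s N - 1| ≤ C₁ * (N : ℝ) ^ (-β)) →
      ∀ N : ℕ, 2 * ((T : ℝ) + 1) ≤ c * N → ∀ a b, a ≠ i → b ≠ i →
        cost D (μ i) (μ a) (share s N i a) ≤
          cost D (μ i) (μ b) (share s N i b) + C * (N : ℝ) ^ (-β) := by
  have hL1 := hL.one_le
  have hL0 : 0 < L := by linarith
  have hβ : 0 < 1 - β := by linarith
  set C₂ := 4 * L + 1 / (c * (1 - β)) with hC₂
  have hC₂0 : 0 < C₂ := by positivity
  set C₃ := 1 / c * (L * (K * (L ^ 2 * (2 / c * (2 * C₂ + 2 * (L / c)))) + C₁ + C₁ * (2 / c))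
    + 2 / c ^ 2) with hC₃
  have hC₃0 : 0 < C₃ := by positivity
  refine ⟨L * (1 / c * (2 / c)) + C₂ * (2 / c) + L * (C₃ * (1 / c)), by positivity,
    fun s m T h hC₁ N hN a b ha hb => ?_⟩
  have hT0 : (0 : ℝ) ≤ T := Nat.cast_nonneg T
  have hN0 : (0 : ℝ) < N := by
    by_contra hneg
    push Not at hneg
    nlinarith
  have hTN : T ≤ N := by
    have : (T : ℝ) ≤ N := by nlinarith
    exact_mod_cast this
  have hpos : pulls s 0 a < pulls s N a := by
    have h1 : (0 : ℝ) < pulls s N a := lt_of_lt_of_le (by positivity) (h.linear N hTN a)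
    rw [pulls_zero]
    exact_mod_cast h1
  obtain ⟨t, -, htN, hst, hlast⟩ := exists_last_pull hpos
  have ht : c * N ≤ t + 1 := by
    have h1 : (pulls s N a : ℝ) ≤ t + 1 := by
      exact_mod_cast hlast.trans_le (Nat.succ_le_succ (pulls_le s t a))
    exact (h.linear N hTN a).trans h1
  have hTt : T ≤ t := by
    have : (T : ℝ) ≤ t := by linarith
    exact_mod_cast this
  have ht' : c / 2 * N ≤ t := by linarith
  have ht1 := h.cast_one_le hTt
  have ht0 : (0 : ℝ) < t := by linarith
  have hx := h.one_sub_div_le hL hc hβ0 hβ1 hc1 hμ hμγ hC₁0 hC₁ hC₂ ha hTt htN hst hlast ht'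
  rw [← hC₃] at hx
  set e := (N : ℝ) ^ (-β) with he
  have he0 : 0 < e := Real.rpow_pos_of_pos hN0 _
  have hte : (t : ℝ) ^ (-β) ≤ 2 / c * e := by
    have h1 := rpow_neg_le_of_mul_le (by positivity) (by linarith) hβ0 hβ1.le hN0 ht'
    rwa [one_div_div] at h1
  have h1t : 1 / (c * t) ≤ 1 / c * (2 / c * e) := by
    rw [← one_div_mul_one_div]
    exact mul_le_mul_of_nonneg_left ((one_div_le_rpow_neg hβ1.le ht1).trans hte) (by positivity)
  have h1 := h.cost_le_of_pull hL hc hβ1 hμ hμγ hTt hst ha hb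
  rw [← hC₂] at h1
  have h2 := hL.cost_le_add (hμ i) (hμ a) (hμγ a ha) (h.share_mem hc hTN a) (h.share_mem hc hTt a)
    (by positivity) (share_le_add_of_pulls_le hc ht0 (h.linear t hTt i) htN.le hlast.le)
  have hniN : (0 : ℝ) < pulls s N i := lt_of_lt_of_le (by positivity) (h.linear N hTN i)
  have hnit : (0 : ℝ) < pulls s t i := lt_of_lt_of_le (by positivity) (h.linear t hTt i)
  have h3 : share s t i b ≤ share s N i b + C₃ * e * (1 / c) := by
    have h4 : (1 - (1 - (pulls s t i : ℝ) / pulls s N i)) * share s t i b ≤ share s N i b := by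
      have h5 : (pulls s t b : ℝ) ≤ pulls s N b := by exact_mod_cast pulls_mono s b htN.le
      rw [share, share]
      calc (1 - (1 - (pulls s t i : ℝ) / pulls s N i)) * (pulls s t b / pulls s t i)
          = pulls s t b / pulls s N i := by field_simp; ring
        _ ≤ _ := by gcongr
    have h5 := (h.share_mem hc hTt b).2
    have h6 : (1 - (pulls s t i : ℝ) / pulls s N i) * share s t i b ≤ C₃ * e * (1 / c) :=
      mul_le_mul hx h5 (share_nonneg s t i b) (by positivity)
    linarith
  have h4 := hL.cost_le_add (hμ i) (hμ b) (hμγ b hb) (h.share_mem hc hTt b) (h.share_mem hc hTN b)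
    (by positivity) h3
  have h5 := mul_le_mul_of_nonneg_left hte hC₂0.le
  have h6 := mul_le_mul_of_nonneg_left h1t hL0.le
  linarith

end Settled

/-! ### Stability of a path with accurate sample means -/

lemma mix_eq_pooled {ν w : Fin K → ℝ} {i : Fin K} (hw : 0 < w i) (a : Fin K) :
    mix ν w i a = pooled (ν i) (ν a) (w a / w i) := by
  rw [mix, pooled, ← mul_div_mul_left _ (1 + w a / w i) hw.ne']
  congr 1 <;> field_simp

lemma anchor_eq_sum_ratio {ρ : Measure ℝ} {ν w : Fin K → ℝ} {i : Fin K} (hw : 0 < w i) :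
    anchor ρ i ν w = ∑ a ∈ Finset.univ.erase i, ratio (kl ρ) (ν i) (ν a) (w a / w i) - 1 := by
  simp only [anchor, ratio, mix_eq_pooled hw]

lemma index_eq_mul_cost {ρ : Measure ℝ} {ν w : Fin K → ℝ} {i : Fin K} (hw : 0 < w i) (a : Fin K) :
    index ρ ν w i a = w i * cost (kl ρ) (ν i) (ν a) (w a / w i) := by
  rw [index, cost, mix_eq_pooled hw]
  field_simp

/-- Outside of forced exploration, both sampling rules make an `AnchoredStep`. -/
lemma IsChoice.anchoredStep {ρ : Measure ℝ} {r : Rule} {α : ℝ} {s : ℕ → Fin K}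
    {m : ℕ → Fin K → ℝ} {N : ℕ} {i : Fin K}
    (h : IsChoice ρ r α (N + 1) (pulls s N) (m N) (s (N + 1)))
    (hexp : ∀ a, ((N + 1 : ℕ) : ℝ) ^ α ≤ pulls s N a) (hm : ∀ a, m N a ∈ meanSet ρ)
    (hbest : ∀ a, a ≠ i → m N a < m N i) (hpos : ∀ a, 0 < pulls s N a) :
    AnchoredStep (kl ρ) i s m N := by
  have hpos' : ∀ a, (0 : ℝ) < pulls s N a := fun a => by exact_mod_cast hpos a
  have hlog : ∀ a, 0 ≤ Real.log (pulls s N a) := fun a =>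
    Real.log_nonneg (by exact_mod_cast hpos a)
  obtain ⟨h1, h2⟩ := h.2 hexp hm i hbest
  rw [anchor_eq_sum_ratio (w := fun a => (pulls s N a : ℝ)) (hpos' i)] at h1 h2
  by_cases hg : 1 < ∑ a ∈ Finset.univ.erase i, ratio (kl ρ) (m N i) (m N a) (share s N i a)
  · exact Or.inl ⟨h1 (sub_pos.2 hg), hg.le⟩
  · push Not at hg
    obtain ⟨h3, h4⟩ := h2 (sub_nonpos.2 hg)
    refine Or.inr ⟨h3, hg, fun b hb => ?_⟩
    have h5 := h4 b hb
    have e : ∀ a, index ρ (m N) (fun a => (pulls s N a : ℝ)) i a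
        = pulls s N i * cost (kl ρ) (m N i) (m N a) (share s N i a) := fun a =>
      index_eq_mul_cost (w := fun a => (pulls s N a : ℝ)) (hpos' i) a
    rw [← e, ← e]
    cases r with
    | at2 =>
      simp only [score] at h5
      linarith [hlog b]
    | iat2 =>
      simp only [score] at h5
      linarith [hlog (s (N + 1))]

lemma exists_forall_rpow_neg_le {β γ : ℝ} (hβ : 0 < β) (hγ : 0 < γ) :
    ∃ N₀ : ℕ, ∀ N : ℕ, N₀ ≤ N → (N : ℝ) ^ (-β) ≤ γ := by
  have h := (tendsto_rpow_neg_atTop hβ).comp tendsto_natCast_atTop_atTop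
  exact eventually_atTop.1 (h.eventually (eventually_le_nhds hγ))

lemma exists_gap {i : Fin K} {μ : Fin K → ℝ} {lo hi : ℝ} (hJ : ∀ a, lo < μ a ∧ μ a < hi)
    (hbest : ∀ a, a ≠ i → μ a < μ i) :
    ∃ γ : ℝ, 0 < γ ∧ (∀ a, lo + γ ≤ μ a ∧ μ a ≤ hi - γ) ∧ ∀ a, a ≠ i → 3 * γ ≤ μ i - μ a := by
  have hev : ∀ᶠ γ in nhdsWithin (0 : ℝ) (Set.Ioi 0),
      (∀ a, lo + γ ≤ μ a ∧ μ a ≤ hi - γ) ∧ ∀ a, a ≠ i → 3 * γ ≤ μ i - μ a := by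
    have aux : ∀ x y : ℝ, 0 < x → 0 < y → ∀ᶠ γ in nhdsWithin (0 : ℝ) (Set.Ioi 0), y * γ ≤ x := by
      intro x y hx hy
      filter_upwards [nhdsWithin_le_nhds (eventually_le_nhds (div_pos hx hy))] with γ hγ
      rw [le_div_iff₀ hy] at hγ
      linarith
    refine (eventually_all.2 fun a => ?_).and (eventually_all.2 fun a => ?_)
    · filter_upwards [aux _ 1 (sub_pos.2 (hJ a).1) one_pos, aux _ 1 (sub_pos.2 (hJ a).2) one_pos]
        with γ h1 h2
      constructor <;> linarith
    · by_cases ha : a = i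
      · exact Eventually.of_forall fun γ hne => absurd ha hne
      · filter_upwards [aux _ 3 (sub_pos.2 (hbest a ha)) three_pos] with γ h1 _
        exact h1
  obtain ⟨γ, h1, h2⟩ := (hev.and self_mem_nhdsWithin).exists
  exact ⟨γ, h2, h1⟩

lemma le_rpow_of_pow_le {α x y : ℝ} {p : ℕ} (hα : 0 < α) (hp : 1 / α ≤ p) (hx : 1 ≤ x)
    (hxy : x ^ p ≤ y) : x ≤ y ^ α := by
  have h1 : 1 ≤ p * α := by rwa [div_le_iff₀ hα] at hp
  calc x = x ^ (1 : ℝ) := (Real.rpow_one x).symm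
    _ ≤ x ^ (p * α) := Real.rpow_le_rpow_of_exponent_le hx h1
    _ = (x ^ p) ^ α := by rw [Real.rpow_mul (by linarith), Real.rpow_natCast]
    _ ≤ y ^ α := Real.rpow_le_rpow (by positivity) hxy hα.le

set_option maxHeartbeats 1000000 in
/-- The deterministic part of the argument: along any path that follows the rule and whose sample
means are accurate from iteration `T₀` on, the anchor function and the index differences are small
after a number of iterations that is polynomial in `T₀`. -/
theorem exists_forall_stable {ρ : Measure ℝ} (hρ : ∀ c : ℝ, ¬ ∀ᵐ x ∂ρ, x = c) (hK : 2 ≤ K)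
    {α : ℝ} (hα0 : 0 < α) (hα1 : α < 1) {μ : Fin K → ℝ} (hμ : ∀ a, μ a ∈ meanSet ρ)
    {i₁ : Fin K} (hbest : ∀ a, a ≠ i₁ → μ a < μ i₁) :
    ∃ C : ℝ, 0 < C ∧ ∃ A p : ℕ, ∀ (r : Rule) (s : ℕ → Fin K) (x : ℕ → ℝ) (T₀ : ℕ),
      (∀ N, IsChoice ρ r α (N + 1) (pulls s N) (sampleMean s x N) (s (N + 1))) →
      (∀ N : ℕ, T₀ ≤ N → ∀ a, ((N : ℝ) / 2) ^ α ≤ pulls s N a →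
        |sampleMean s x N a - μ a| ≤ (N : ℝ) ^ (-(3 * α / 8))) →
      ∀ N : ℕ, A * (T₀ + 1) ^ p ≤ N →
        let n : Fin K → ℝ := fun a => (pulls s N a : ℝ)
        anchor ρ i₁ μ (proportion s N) =
            ∑ a ∈ Finset.univ.erase i₁,
              kl ρ (μ i₁) (mix μ n i₁ a) / kl ρ (μ a) (mix μ n i₁ a) - 1 ∧
          |anchor ρ i₁ μ (proportion s N)| ≤ C * (N : ℝ) ^ (-(3 * α / 8)) ∧
          ∀ i : Fin K, (i = i₁ ∨ ∀ b, sampleMean s x N b ≤ sampleMean s x N i) →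
            ∀ a b : Fin K, a ≠ i₁ → b ≠ i₁ →
              |index ρ μ n i a - index ρ μ n i b| ≤ C * (N : ℝ) ^ (1 - 3 * α / 8) := by
  have : NeZero K := ⟨by omega⟩
  obtain ⟨lo, hi, k₁, k₂, hJ, hμJ, hB⟩ := exists_isBregman_kl hρ hμ
  obtain ⟨γ, hγ, hμγ, hgap⟩ := exists_gap hμJ hbest
  have hlt : lo < hi := (hμJ i₁).1.trans (hμJ i₁).2
  have hμI : ∀ a, μ a ∈ Set.Icc lo hi := fun a => ⟨(hμJ a).1.le, (hμJ a).2.le⟩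
  have hμgap : ∀ a, a ≠ i₁ → γ ≤ μ i₁ - μ a := fun a ha => by linarith [hgap a ha]
  set β := 3 * α / 8 with hβ
  have hβ0 : 0 < β := by positivity
  have hβ1 : β < 1 := by linarith
  obtain ⟨N₀, hN₀⟩ := exists_forall_rpow_le_pulls (K := K) (by omega) hα0 hα1
  obtain ⟨N₂, hN₂⟩ := exists_forall_rpow_neg_le hβ0 hγ
  obtain ⟨c, hc0, hc1, Q₁, hlin⟩ := exists_forall_mul_le_pulls hB hlt hγ hK hα0 hα1
  obtain ⟨N₃, hN₃⟩ := exists_forall_rpow_le_mul (c := c / 2) hα1 (by positivity)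
  obtain ⟨L, hL⟩ := hB.exists_rateBounds hlt hγ hc0
  have hL0 : 0 < L := zero_lt_one.trans_le hL.one_le
  set C₁ := 2 / c * (K * L * (2 + 1 / c ^ 2)) with hC₁
  have hC₁0 : 0 ≤ C₁ := by positivity
  obtain ⟨C₅, hC₅0, hC₅⟩ := Settled.exists_cost_le hL hc0 hc1 hβ0.le hβ1 hμI hμgap hC₁0
  set p := ⌈1 / α⌉₊ with hp_def
  have hp := Nat.le_ceil (1 / α)
  rw [← hp_def] at hp
  have hp1 : 1 ≤ p := Nat.one_le_iff_ne_zero.2 fun h0 => by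
    rw [h0, Nat.cast_zero] at hp
    linarith [one_div_pos.2 hα0]
  set k := ⌈2 / c⌉₊ with hk_def
  have hk := Nat.le_ceil (2 / c)
  rw [← hk_def, div_le_iff₀ hc0] at hk
  have hk1 : 1 ≤ k := Nat.one_le_iff_ne_zero.2 fun h0 => by
    rw [h0, Nat.cast_zero] at hk
    linarith
  set Q := N₀ + N₂ + 1 with hQ
  set A₁ := 2 * (2 * (Q + 1)) ^ p with hA₁
  set A₂ := Q₁ * (A₁ + 1) + N₃ + A₁ with hA₂
  set A₃ := k * (A₂ + 1) with hA₃
  refine ⟨C₁ + C₅, by positivity, k * (A₃ + 1), p, fun r s x T₀ hs hx N hN => ?_⟩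
  set X := (T₀ + 1) ^ p with hX
  have hX1 : 1 ≤ X := Nat.one_le_pow _ _ (by omega)
  -- from `T` on the sample means are within `γ` of the means
  set T := T₀ + Q with hT
  have hclose : ∀ N, T ≤ N → ∀ a, |sampleMean s x N a - μ a| ≤ (N : ℝ) ^ (-β) :=
    fun N hN a => hx N (by omega) a (hN₀ s (fun N => (hs N).1) N (by omega) a)
  have hmeans : MeansClose lo hi γ β i₁ μ (sampleMean s x) T := by
    have key : ∀ N, T ≤ N → ∀ a, |sampleMean s x N a - μ a| ≤ γ := fun N hN a =>
      (hclose N hN a).trans (hN₂ N (by omega))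
    refine ⟨fun N hN a => ?_, fun N hN a ha => ?_, hclose⟩
    · have h1 := abs_le.1 (key N hN a)
      constructor <;> linarith [h1.1, h1.2, (hμγ a).1, (hμγ a).2]
    · have h1 := abs_le.1 (key N hN a)
      have h2 := abs_le.1 (key N hN i₁)
      linarith [h1.2, h2.1, hgap a ha]
  have hpos : ∀ N, T ≤ N → ∀ a, 0 < pulls s N a := fun N hN a => by
    have h1 := hN₀ s (fun N => (hs N).1) N (by omega) a
    have h2 : (0 : ℝ) < N := by
      have : 0 < N := by omega
      exact_mod_cast this
    have h3 : (0 : ℝ) < pulls s N a := lt_of_lt_of_le (Real.rpow_pos_of_pos (by positivity) _) h1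
    exact_mod_cast h3
  have hstep : ∀ N, T ≤ N → (∀ a, ((N + 1 : ℕ) : ℝ) ^ α ≤ pulls s N a) →
      AnchoredStep (kl ρ) i₁ s (sampleMean s x) N := fun N hN hexp =>
    (hs N).anchoredStep hexp (fun a => hJ (hmeans.mem N hN a))
      (fun a ha => by linarith [hmeans.gap N hN a ha]) (hpos N hN)
  have hrule : FollowsRule (kl ρ) α i₁ s (sampleMean s x) T := ⟨fun N => (hs N).1, hpos, hstep⟩
  -- from `A₁ X` on the initial iterations are negligible
  have hTA : 2 * (2 * (T + 1)) ^ p ≤ A₁ * X := by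
    rw [hA₁, hX, mul_assoc, ← mul_pow]
    gcongr 2 * ?_ ^ p
    rw [hT]
    nlinarith
  have hTA' : T ≤ A₁ * X := by
    have : T + 1 ≤ (2 * (T + 1)) ^ p :=
      (by omega : T + 1 ≤ 2 * (T + 1)).trans (Nat.le_self_pow (by omega) _)
    omega
  have hforget : ∀ N, A₁ * X ≤ N → 2 * ((T : ℝ) + 1) ≤ pulls s N i₁ := fun N hN => by
    refine le_trans ?_ (hN₀ s (fun N => (hs N).1) N (by omega) i₁)
    refine le_rpow_of_pow_le hα0 hp (by linarith [(Nat.cast_nonneg T : (0 : ℝ) ≤ T)]) ?_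
    rw [le_div_iff₀ two_pos, mul_comm]
    exact_mod_cast hTA.trans hN
  have hlin' := hlin i₁ μ β s (sampleMean s x) T (A₁ * X) hmeans hrule hTA' hforget
  have hset : Settled (kl ρ) lo hi γ c β i₁ μ s (sampleMean s x) (A₂ * X) := by
    have h1 : A₁ * X ≤ A₂ * X := Nat.mul_le_mul_right _ (by omega)
    have h2 : Q₁ * (A₁ * X + 1) + N₃ ≤ A₂ * X := by
      calc Q₁ * (A₁ * X + 1) + N₃ ≤ Q₁ * (A₁ * X + 1 * X) + N₃ * X := by nlinarith
        _ = (Q₁ * (A₁ + 1) + N₃) * X := by ring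
        _ ≤ A₂ * X := Nat.mul_le_mul_right _ (by omega)
    have hlin2 : ∀ N, A₂ * X ≤ N → ∀ a, c * N ≤ pulls s N a := fun N hN a => hlin' N (by omega) a
    refine ⟨⟨fun N hN => hmeans.mem N (by omega), fun N hN => hmeans.gap N (by omega),
      fun N hN => hmeans.close N (by omega)⟩, by omega, hlin2, fun N hN => ?_⟩
    refine hstep N (by omega) fun a => ?_
    have hN1 : (1 : ℝ) ≤ N := by
      have : 1 ≤ N := by omega
      exact_mod_cast this
    have h3 := hN₃ ((N + 1 : ℕ) : ℝ) (by exact_mod_cast (by omega : N₃ ≤ N + 1))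
    have h4 : c / 2 * ((N + 1 : ℕ) : ℝ) ≤ c * N := by
      push_cast
      nlinarith
    exact h3.trans (h4.trans (hlin2 N hN a))
  have hmul : ∀ M N : ℕ, k * (M + 1) * X ≤ N → 2 * (((M * X : ℕ) : ℝ) + 1) ≤ c * N := by
    intro M N hMN
    have h1 : k * (M * X + 1) ≤ N := by
      refine le_trans ?_ hMN
      rw [mul_assoc]
      gcongr
      nlinarith
    have h2 : (k : ℝ) * (((M * X : ℕ) : ℝ) + 1) ≤ N := by exact_mod_cast h1
    calc 2 * (((M * X : ℕ) : ℝ) + 1) ≤ k * c * (((M * X : ℕ) : ℝ) + 1) := by gcongr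
      _ = c * (k * (((M * X : ℕ) : ℝ) + 1)) := by ring
      _ ≤ c * N := by gcongr
  have hanchor : ∀ N : ℕ, A₃ * X ≤ N → |anchorSum (kl ρ) i₁ μ s N - 1| ≤ C₁ * (N : ℝ) ^ (-β) :=
    fun N hN => hset.abs_anchorSum_sub_one_le hL hK hc0 hc1 hβ0.le hβ1.le hμI hμgap (hmul A₂ N hN)
  have hA₂₃ : A₂ * X ≤ A₃ * X := Nat.mul_le_mul_right _ (by rw [hA₃]; nlinarith)
  have hcost := hC₅ s (sampleMean s x) (A₃ * X) (hset.mono hA₂₃) hanchor N (hmul A₃ N hN)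
  have hA₃N : A₃ * X ≤ N := (Nat.mul_le_mul_right X (by nlinarith)).trans hN
  have hTN : T ≤ N := by
    have : A₁ * X ≤ A₂ * X := Nat.mul_le_mul_right _ (by omega)
    omega
  have hN0 : (0 : ℝ) < N := by
    have : 0 < N := by omega
    exact_mod_cast this
  have hni : (0 : ℝ) < pulls s N i₁ := by exact_mod_cast hpos N hTN i₁
  have hmix : ∀ a, mix μ (proportion s N) i₁ a = mix μ (fun a => (pulls s N a : ℝ)) i₁ a := by
    intro a
    rw [mix_eq_pooled (w := fun a => (pulls s N a : ℝ)) hni, mix_eq_pooled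
      (show 0 < proportion s N i₁ from div_pos hni hN0)]
    congr 1
    simp only [proportion]
    field_simp
  have hanchor' : anchor ρ i₁ μ (proportion s N) =
      ∑ a ∈ Finset.univ.erase i₁, kl ρ (μ i₁) (mix μ (fun a => (pulls s N a : ℝ)) i₁ a) /
        kl ρ (μ a) (mix μ (fun a => (pulls s N a : ℝ)) i₁ a) - 1 := by
    simp only [anchor, hmix]
  have he0 : 0 < (N : ℝ) ^ (-β) := Real.rpow_pos_of_pos hN0 _
  refine ⟨hanchor', ?_, fun i hi' a b ha hb => ?_⟩
  · have h1 : anchor ρ i₁ μ (proportion s N) = anchorSum (kl ρ) i₁ μ s N - 1 := by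
      rw [hanchor']
      exact anchor_eq_sum_ratio (w := fun a => (pulls s N a : ℝ)) hni
    rw [h1]
    refine (hanchor N hA₃N).trans ?_
    gcongr
    linarith
  · have hi₁ : i = i₁ := by
      rcases hi' with h1 | h1
      · exact h1
      · by_contra hne
        linarith [hmeans.gap N hTN i hne, h1 i₁]
    subst hi₁
    rw [index_eq_mul_cost (w := fun a => (pulls s N a : ℝ)) hni,
      index_eq_mul_cost (w := fun a => (pulls s N a : ℝ)) hni, ← mul_sub, abs_mul,
      abs_of_pos hni]
    have h1 : |cost (kl ρ) (μ i) (μ a) (share s N i a) - cost (kl ρ) (μ i) (μ b) (share s N i b)|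
        ≤ C₅ * (N : ℝ) ^ (-β) := by
      rw [abs_le]
      constructor <;> linarith [hcost a b ha hb, hcost b a hb ha]
    have h2 : (pulls s N i : ℝ) ≤ N := by exact_mod_cast pulls_le s N i
    calc (pulls s N i : ℝ) * _ ≤ N * (C₅ * (N : ℝ) ^ (-β)) :=
          mul_le_mul h2 h1 (abs_nonneg _) hN0.le
      _ = C₅ * (N : ℝ) ^ (1 - β) := by
          rw [show 1 - β = 1 + -β by ring, Real.rpow_add hN0, Real.rpow_one]
          ring
      _ ≤ (C₁ + C₅) * (N : ℝ) ^ (1 - β) := by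
          gcongr
          linarith

/-! ### Concentration of the sample means under adaptive sampling -/

/-- The exponential moment bound of `lintegral_exp_armLaw_le`, with one constant for all
arms, which also bounds the range of admissible `l`. -/
lemma exists_lintegral_exp_le {ρ : Measure ℝ} (hρ : ∀ c : ℝ, ¬ ∀ᵐ x ∂ρ, x = c) {μ : Fin K → ℝ}
    (hμ : ∀ a, μ a ∈ meanSet ρ) :
    ∃ V : ℝ, 0 < V ∧ ∀ a, ∀ l : ℝ, |l| ≤ 1 / (2 * V) →
      ∫⁻ x, ENNReal.ofReal (Real.exp (l * (x - μ a) - V * l ^ 2)) ∂(armLaw ρ (μ a)) ≤ 1 := by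
  choose δ C hδ hC h using fun a => lintegral_exp_armLaw_le hρ (hμ a)
  have hterm : ∀ a, 0 ≤ C a + 1 / (2 * δ a) := fun a => by
    have := hδ a
    have := hC a
    positivity
  have hle : ∀ a, C a + 1 / (2 * δ a) ≤ 1 + ∑ b, (C b + 1 / (2 * δ b)) := fun a => by
    have := Finset.single_le_sum (f := fun b => C b + 1 / (2 * δ b)) (fun b _ => hterm b)
      (Finset.mem_univ a)
    linarith
  set V := 1 + ∑ b, (C b + 1 / (2 * δ b)) with hV
  have hV0 : 0 < V := by
    have := Finset.sum_nonneg fun b (_ : b ∈ Finset.univ) => hterm b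
    linarith
  refine ⟨V, hV0, fun a l hl => ?_⟩
  have h1 := hle a
  have hδa := hδ a
  have hδa' : 0 < 1 / (2 * δ a) := by positivity
  have hl' : |l| ≤ δ a := by
    refine hl.trans ?_
    have h2 : 1 / (2 * δ a) ≤ V := by linarith [hC a]
    rw [div_le_iff₀ (by positivity)] at h2 ⊢
    linarith
  refine le_trans (lintegral_mono fun x => ENNReal.ofReal_le_ofReal (Real.exp_le_exp.2 ?_))
    (h a l hl')
  have : C a * l ^ 2 ≤ V * l ^ 2 := mul_le_mul_of_nonneg_right (by linarith) (sq_nonneg l)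
  linarith

section ExponentialSupermartingale

variable {Ω : Type*}

/-- The supermartingale `exp (∑ (l (X t - m) - v))`, summed over the pulls `t ≤ N` of arm `a`. -/
noncomputable def expMartingale (a : Fin K) (m l v : ℝ) (A : ℕ → Ω → Fin K) (X : ℕ → Ω → ℝ) (N : ℕ)
    (ω : Ω) : ENNReal :=
  ∏ t ∈ Finset.Icc 1 N,
    if A t ω = a then ENNReal.ofReal (Real.exp (l * (X t ω - m) - v)) else 1

lemma expMartingale_succ (a : Fin K) (m l v : ℝ) (A : ℕ → Ω → Fin K) (X : ℕ → Ω → ℝ) (N : ℕ) (ω : Ω) :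
    expMartingale a m l v A X (N + 1) ω = expMartingale a m l v A X N ω *
      if A (N + 1) ω = a then ENNReal.ofReal (Real.exp (l * (X (N + 1) ω - m) - v)) else 1 :=
  Finset.prod_Icc_succ_top (by omega) _

lemma expMartingale_eq (a : Fin K) (m l v : ℝ) (A : ℕ → Ω → Fin K) (X : ℕ → Ω → ℝ) (N : ℕ) (ω : Ω) :
    expMartingale a m l v A X N ω = ENNReal.ofReal (Real.exp
      (l * (∑ t ∈ (Finset.Icc 1 N).filter (fun t => A t ω = a), X t ω
        - pulls (fun t => A t ω) N a * m) - pulls (fun t => A t ω) N a * v)) := by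
  rw [expMartingale, ← Finset.prod_filter, ← ENNReal.ofReal_prod_of_nonneg
    fun _ _ => (Real.exp_pos _).le, ← Real.exp_sum]
  congr 2
  rw [Finset.sum_sub_distrib, ← Finset.mul_sum, Finset.sum_sub_distrib, Finset.sum_const,
    Finset.sum_const, nsmul_eq_mul, nsmul_eq_mul]
  rfl

end ExponentialSupermartingale

section Run

variable {Ω : Type*} [mΩ : MeasurableSpace Ω] {ρ : Measure ℝ} {r : Rule} {α : ℝ} {μ : Fin K → ℝ}
  {P : Measure Ω} {𝓕 : Filtration ℕ mΩ} {A : ℕ → Ω → Fin K} {X : ℕ → Ω → ℝ}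

/-- On an event of `𝓕 N` on which arm `a` is pulled next, the reward has the law of arm `a`. -/
lemma IsRun.map_restrict_reward [IsProbabilityMeasure P] (h : IsRun ρ r α μ P 𝓕 A X) (N : ℕ)
    {a : Fin K} [IsProbabilityMeasure (armLaw ρ (μ a))] {F : Set Ω} (hF : MeasurableSet[𝓕 N] F)
    (hFa : ∀ ω ∈ F, A (N + 1) ω = a) :
    (P.restrict F).map (X (N + 1)) = P F • armLaw ρ (μ a) := by
  have hX : Measurable (X (N + 1)) := (h.measurable_reward N).mono (𝓕.le _) le_rfl
  ext B hB
  have hXB : MeasurableSet (X (N + 1) ⁻¹' B) := hX hB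
  have h1 : ∫ ω in F, (X (N + 1) ⁻¹' B).indicator (fun _ => (1 : ℝ)) ω ∂P
      = ∫ ω in F, (armLaw ρ (μ a)).real B ∂P := by
    rw [← setIntegral_condExp (𝓕.le N) ((integrable_const (1 : ℝ)).indicator hXB) hF]
    refine setIntegral_congr_ae (𝓕.le N _ hF) ?_
    filter_upwards [h.reward_law N B hB] with ω hω hωF
    rw [hω, hFa ω hωF]
  rw [integral_indicator_const _ hXB, setIntegral_const, smul_eq_mul, mul_one, smul_eq_mul,
    measureReal_restrict_apply hXB, measureReal_def, measureReal_def, measureReal_def,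
    ← ENNReal.toReal_mul] at h1
  rw [Measure.map_apply hX hB, Measure.restrict_apply hXB, Measure.smul_apply, smul_eq_mul]
  exact (ENNReal.toReal_eq_toReal_iff' (measure_ne_top _ _)
    (ENNReal.mul_ne_top (measure_ne_top _ _) (measure_ne_top _ _))).1 h1

/-- A function of the past may be integrated separately from a function of the next reward, on the
event that the next pull is of arm `a`. -/
lemma IsRun.lintegral_mul_reward [IsProbabilityMeasure P] (h : IsRun ρ r α μ P 𝓕 A X) (N : ℕ)
    {a : Fin K} [IsProbabilityMeasure (armLaw ρ (μ a))] {Y : Ω → ENNReal} (hY : Measurable[𝓕 N] Y)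
    {φ : ℝ → ENNReal} (hφ : Measurable φ) :
    ∫⁻ ω in A (N + 1) ⁻¹' {a}, Y ω * φ (X (N + 1) ω) ∂P =
      (∫⁻ x, φ x ∂(armLaw ρ (μ a))) * ∫⁻ ω in A (N + 1) ⁻¹' {a}, Y ω ∂P := by
  have hX : Measurable (X (N + 1)) := (h.measurable_reward N).mono (𝓕.le _) le_rfl
  set E := A (N + 1) ⁻¹' {a} with hE
  have hEm : MeasurableSet[𝓕 N] E := h.measurable_action N (measurableSet_singleton a)
  have hYm : Measurable Y := hY.mono (𝓕.le N) le_rfl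
  have htrim : ((P.restrict E).withDensity (fun ω => φ (X (N + 1) ω))).trim (𝓕.le N)
      = ((∫⁻ x, φ x ∂(armLaw ρ (μ a))) • P.restrict E).trim (𝓕.le N) := by
    refine @Measure.ext _ (𝓕 N) _ _ fun F hF => ?_
    have hF' := 𝓕.le N F hF
    rw [trim_measurableSet_eq _ hF, trim_measurableSet_eq _ hF, withDensity_apply _ hF',
      Measure.smul_apply, Measure.restrict_restrict hF', Measure.restrict_apply hF', smul_eq_mul,
      ← lintegral_map hφ hX, h.map_restrict_reward N (hF.inter hEm) fun ω hω => hω.2,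
      lintegral_smul_measure, smul_eq_mul, mul_comm]
  calc ∫⁻ ω in E, Y ω * φ (X (N + 1) ω) ∂P
      = ∫⁻ ω, Y ω ∂((P.restrict E).withDensity (fun ω => φ (X (N + 1) ω))) := by
        rw [lintegral_withDensity_eq_lintegral_mul _ (f := fun ω => φ (X (N + 1) ω))
          (hφ.comp hX) hYm]
        refine lintegral_congr fun ω => ?_
        simp [mul_comm]
    _ = ∫⁻ ω, Y ω ∂((∫⁻ x, φ x ∂(armLaw ρ (μ a))) • P.restrict E) := by
        rw [← lintegral_trim (𝓕.le N) hY, htrim, lintegral_trim (𝓕.le N) hY]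
    _ = _ := by rw [lintegral_smul_measure, smul_eq_mul]

lemma IsRun.measurable_expMartingale (h : IsRun ρ r α μ P 𝓕 A X) (a : Fin K) (m l v : ℝ) (N : ℕ) :
    Measurable[𝓕 N] (expMartingale a m l v A X N) := by
  induction N with
  | zero =>
    have : expMartingale a m l v A X 0 = fun _ => 1 := by
      ext ω
      simp [expMartingale]
    rw [this]
    exact measurable_const
  | succ N ih =>
    have e : expMartingale a m l v A X (N + 1) = fun ω => expMartingale a m l v A X N ω *
        if A (N + 1) ω = a then ENNReal.ofReal (Real.exp (l * (X (N + 1) ω - m) - v)) else 1 :=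
      funext fun ω => expMartingale_succ a m l v A X N ω
    rw [e]
    have hle := 𝓕.mono (Nat.le_succ N)
    have hX := h.measurable_reward N
    refine Measurable.mul (ih.mono hle le_rfl) (Measurable.ite ?_ ?_ measurable_const)
    · exact hle _ (h.measurable_action N (measurableSet_singleton a))
    · exact (Real.measurable_exp.comp
        (((hX.sub_const m).const_mul l).sub_const v)).ennreal_ofReal

/-- `expMartingale` is a supermartingale started at one. -/
lemma IsRun.lintegral_expMartingale_le [IsProbabilityMeasure P] (h : IsRun ρ r α μ P 𝓕 A X)
    {a : Fin K} [IsProbabilityMeasure (armLaw ρ (μ a))] {l v : ℝ}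
    (hl : ∫⁻ x, ENNReal.ofReal (Real.exp (l * (x - μ a) - v)) ∂(armLaw ρ (μ a)) ≤ 1) (N : ℕ) :
    ∫⁻ ω, expMartingale a (μ a) l v A X N ω ∂P ≤ 1 := by
  induction N with
  | zero => simp [expMartingale]
  | succ N ih =>
    refine le_trans ?_ ih
    set E := A (N + 1) ⁻¹' {a} with hE
    have hEm : MeasurableSet E :=
      𝓕.le N _ (h.measurable_action N (measurableSet_singleton a))
    rw [← lintegral_add_compl _ hEm, ← lintegral_add_compl (expMartingale a (μ a) l v A X N) hEm]
    refine add_le_add ?_ (le_of_eq ?_)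
    · have h1 : ∫⁻ ω in E, expMartingale a (μ a) l v A X (N + 1) ω ∂P
          = ∫⁻ ω in E, expMartingale a (μ a) l v A X N ω
            * (fun x => ENNReal.ofReal (Real.exp (l * (x - μ a) - v))) (X (N + 1) ω) ∂P := by
        refine setLIntegral_congr_fun hEm fun ω hω => ?_
        have hω' : A (N + 1) ω = a := hω
        simp only [expMartingale_succ, if_pos hω']
      have hφ : Measurable fun x : ℝ => ENNReal.ofReal (Real.exp (l * (x - μ a) - v)) := by fun_prop
      rw [h1, h.lintegral_mul_reward N (h.measurable_expMartingale a (μ a) l v N) hφ]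
      exact mul_le_of_le_one_left zero_le hl
    · refine setLIntegral_congr_fun hEm.compl fun ω hω => ?_
      have hω' : ¬ A (N + 1) ω = a := hω
      simp only [expMartingale_succ, if_neg hω', mul_one]

lemma IsRun.measurable_pulls (h : IsRun ρ r α μ P 𝓕 A X) (N : ℕ) (a : Fin K) :
    Measurable fun ω => pulls (fun t => A t ω) N a := by
  simp only [pulls, Finset.card_filter]
  refine Finset.measurable_fun_sum _ fun t ht => ?_
  obtain ⟨u, rfl⟩ := Nat.exists_eq_add_of_le' (Finset.mem_Icc.1 ht).1
  exact Measurable.ite (𝓕.le u _ (h.measurable_action u (measurableSet_singleton a)))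
    measurable_const measurable_const

lemma IsRun.measurable_sampleMean (h : IsRun ρ r α μ P 𝓕 A X) (N : ℕ) (a : Fin K) :
    Measurable fun ω => sampleMean (fun t => A t ω) (fun t => X t ω) N a := by
  simp only [sampleMean, Finset.sum_filter]
  refine Measurable.div (Finset.measurable_fun_sum _ fun t ht => ?_)
    (measurable_from_top.comp (h.measurable_pulls N a))
  obtain ⟨u, rfl⟩ := Nat.exists_eq_add_of_le' (Finset.mem_Icc.1 ht).1
  exact Measurable.ite (𝓕.le u _ (h.measurable_action u (measurableSet_singleton a)))
    ((h.measurable_reward u).mono (𝓕.le _) le_rfl) measurable_const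

/-- Chernoff bound for the sample mean after a random number of pulls, without a union bound over
that number: the deviation `ε` fixes the parameter `ε / (2 V)` of the exponential supermartingale. -/
lemma IsRun.measure_deviation_le [IsProbabilityMeasure P] (h : IsRun ρ r α μ P 𝓕 A X)
    {a : Fin K} [IsProbabilityMeasure (armLaw ρ (μ a))] {V ε : ℝ} (hV : 0 < V)
    (hl : ∀ l : ℝ, |l| ≤ 1 / (2 * V) →
      ∫⁻ x, ENNReal.ofReal (Real.exp (l * (x - μ a) - V * l ^ 2)) ∂(armLaw ρ (μ a)) ≤ 1)
    (hε0 : 0 < ε) (hε1 : ε ≤ 1) {k : ℝ} (hk : 0 < k) (N : ℕ) :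
    P {ω | k ≤ pulls (fun t => A t ω) N a ∧
        ε < |sampleMean (fun t => A t ω) (fun t => X t ω) N a - μ a|} ≤
      ENNReal.ofReal (2 * Real.exp (-(k * ε ^ 2 / (4 * V)))) := by
  have hone : ∀ σ : ℝ, σ = 1 ∨ σ = -1 →
      P {ω | k ≤ pulls (fun t => A t ω) N a ∧
        ε < σ * (sampleMean (fun t => A t ω) (fun t => X t ω) N a - μ a)} ≤
      ENNReal.ofReal (Real.exp (-(k * ε ^ 2 / (4 * V)))) := by
    intro σ hσ
    have hσ2 : σ ^ 2 = 1 := by rcases hσ with rfl | rfl <;> norm_num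
    have hσa : |σ| = 1 := by rcases hσ with rfl | rfl <;> norm_num
    set l := σ * (ε / (2 * V)) with hl_def
    have hl1 : |l| ≤ 1 / (2 * V) := by
      rw [hl_def, abs_mul, hσa, one_mul, abs_of_pos (by positivity)]
      gcongr
    have hM := h.lintegral_expMartingale_le (hl l hl1) N
    have hMm : Measurable (expMartingale a (μ a) l (V * l ^ 2) A X N) :=
      (h.measurable_expMartingale a (μ a) l (V * l ^ 2) N).mono (𝓕.le N) le_rfl
    have hmarkov := mul_meas_ge_le_lintegral (μ := P) hMm
      (ENNReal.ofReal (Real.exp (k * ε ^ 2 / (4 * V))))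
    have hsub : {ω | k ≤ pulls (fun t => A t ω) N a ∧
        ε < σ * (sampleMean (fun t => A t ω) (fun t => X t ω) N a - μ a)} ⊆
        {ω | ENNReal.ofReal (Real.exp (k * ε ^ 2 / (4 * V))) ≤
          expMartingale a (μ a) l (V * l ^ 2) A X N ω} := by
      rintro ω ⟨hω1, hω2⟩
      rw [Set.mem_ofPred_eq, expMartingale_eq]
      refine ENNReal.ofReal_le_ofReal (Real.exp_le_exp.2 ?_)
      set n : ℝ := (pulls (fun t => A t ω) N a : ℝ) with hn
      have hn0 : 0 < n := hk.trans_le hω1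
      have hS : ∑ t ∈ (Finset.Icc 1 N).filter (fun t => A t ω = a), X t ω
          = n * sampleMean (fun t => A t ω) (fun t => X t ω) N a := by
        rw [sampleMean, ← hn]
        field_simp
      rw [hS, ← mul_sub]
      set d := sampleMean (fun t => A t ω) (fun t => X t ω) N a - μ a with hd
      have e1 : l * (n * d) - n * (V * l ^ 2)
          = n * (ε / (2 * V) * (σ * d) - ε ^ 2 / (4 * V)) := by
        rw [hl_def, mul_pow, hσ2]
        field_simp
        ring
      rw [e1]
      have e2 : ε / (2 * V) * ε - ε ^ 2 / (4 * V) = ε ^ 2 / (4 * V) := by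
        field_simp
        ring
      calc k * ε ^ 2 / (4 * V) = k * (ε ^ 2 / (4 * V)) := by ring
        _ ≤ n * (ε ^ 2 / (4 * V)) := by gcongr
        _ = n * (ε / (2 * V) * ε - ε ^ 2 / (4 * V)) := by rw [e2]
        _ ≤ _ := by gcongr
    refine (measure_mono hsub).trans ?_
    have h1 := hmarkov.trans hM
    rw [Real.exp_neg, ENNReal.ofReal_inv_of_pos (Real.exp_pos _), ENNReal.le_inv_iff_mul_le,
      mul_comm]
    exact h1
  have hsub : {ω | k ≤ pulls (fun t => A t ω) N a ∧
        ε < |sampleMean (fun t => A t ω) (fun t => X t ω) N a - μ a|} ⊆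
      {ω | k ≤ pulls (fun t => A t ω) N a ∧
        ε < 1 * (sampleMean (fun t => A t ω) (fun t => X t ω) N a - μ a)} ∪
      {ω | k ≤ pulls (fun t => A t ω) N a ∧
        ε < -1 * (sampleMean (fun t => A t ω) (fun t => X t ω) N a - μ a)} := by
    rintro ω ⟨hω1, hω2⟩
    rcases lt_abs.1 hω2 with h1 | h1
    · exact Or.inl ⟨hω1, by linarith⟩
    · exact Or.inr ⟨hω1, by linarith⟩
  refine (measure_mono hsub).trans ((measure_union_le _ _).trans ?_)
  rw [two_mul, ENNReal.ofReal_add (Real.exp_pos _).le (Real.exp_pos _).le]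
  exact add_le_add (hone 1 (Or.inl rfl)) (hone (-1) (Or.inr rfl))

/-- The event that some arm has been explored enough by iteration `N` and its sample mean is still
farther than `N ^ (-3 α / 8)` from the mean. -/
def deviationSet (α : ℝ) (μ : Fin K → ℝ) (A : ℕ → Ω → Fin K) (X : ℕ → Ω → ℝ) (N : ℕ) : Set Ω :=
  {ω | ∃ a, ((N : ℝ) / 2) ^ α ≤ pulls (fun t => A t ω) N a ∧
    (N : ℝ) ^ (-(3 * α / 8)) < |sampleMean (fun t => A t ω) (fun t => X t ω) N a - μ a|}

lemma IsRun.measurableSet_deviationSet (h : IsRun ρ r α μ P 𝓕 A X) (N : ℕ) :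
    MeasurableSet (deviationSet α μ A X N) := by
  simp only [deviationSet, Set.ofPred_exists]
  refine MeasurableSet.iUnion fun a => ?_
  have h1 : Measurable fun ω => (pulls (fun t => A t ω) N a : ℝ) :=
    measurable_from_top.comp (h.measurable_pulls N a)
  have h2 : Measurable fun ω =>
      |sampleMean (fun t => A t ω) (fun t => X t ω) N a - μ a| :=
    ((h.measurable_sampleMean N a).sub_const _).abs
  exact (measurableSet_le measurable_const h1).inter (measurableSet_lt measurable_const h2)

/-- The exponent `3 α / 8` leaves `N ^ α * (N ^ (-3 α / 8)) ^ 2 = N ^ (α / 4)` in the exponent of the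
deviation probability. -/
lemma IsRun.measure_deviationSet_le [IsProbabilityMeasure P] (h : IsRun ρ r α μ P 𝓕 A X)
    (hρ : ∀ c : ℝ, ¬ ∀ᵐ x ∂ρ, x = c) (hα0 : 0 < α) (hα1 : α < 1) (hK : 0 < K)
    (hμ : ∀ a, μ a ∈ meanSet ρ) {V : ℝ} (hV : 0 < V)
    (hl : ∀ a, ∀ l : ℝ, |l| ≤ 1 / (2 * V) →
      ∫⁻ x, ENNReal.ofReal (Real.exp (l * (x - μ a) - V * l ^ 2)) ∂(armLaw ρ (μ a)) ≤ 1) (N : ℕ) :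
    P (deviationSet α μ A X N) ≤
      ENNReal.ofReal (2 * K * Real.exp (-(1 / (8 * V)) * (N : ℝ) ^ (α / 4))) := by
  have hK1 : (1 : ℝ) ≤ K := by exact_mod_cast hK
  rcases Nat.eq_zero_or_pos N with rfl | hN
  · rw [Nat.cast_zero, Real.zero_rpow (by positivity), mul_zero, Real.exp_zero, mul_one]
    refine prob_le_one.trans ?_
    rw [← ENNReal.ofReal_one]
    exact ENNReal.ofReal_le_ofReal (by linarith)
  have hN1 : (1 : ℝ) ≤ N := by exact_mod_cast hN
  have hN0 : (0 : ℝ) < N := by linarith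
  have hexp : 1 / (8 * V) * (N : ℝ) ^ (α / 4) ≤
      ((N : ℝ) / 2) ^ α * ((N : ℝ) ^ (-(3 * α / 8))) ^ 2 / (4 * V) := by
    have h1 : ((N : ℝ) ^ (-(3 * α / 8))) ^ 2 = (N : ℝ) ^ (-(3 * α / 4)) := by
      rw [← Real.rpow_natCast, ← Real.rpow_mul hN0.le]
      congr 1
      push_cast
      ring
    have h2 : (N : ℝ) ^ α * (N : ℝ) ^ (-(3 * α / 4)) = (N : ℝ) ^ (α / 4) := by
      rw [← Real.rpow_add hN0]
      congr 1
      ring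
    have h3 : (2 : ℝ) ^ α ≤ 2 := by
      calc (2 : ℝ) ^ α ≤ 2 ^ (1 : ℝ) :=
            Real.rpow_le_rpow_of_exponent_le (by norm_num) hα1.le
        _ = 2 := Real.rpow_one 2
    have e1 : ((N : ℝ) / 2) ^ α * (N : ℝ) ^ (-(3 * α / 4)) / (4 * V)
        = (N : ℝ) ^ (α / 4) / (2 ^ α * (4 * V)) := by
      rw [Real.div_rpow hN0.le (by norm_num), ← h2]
      field_simp
    rw [h1, e1, one_div_mul_eq_div]
    refine div_le_div_of_nonneg_left (by positivity) (by positivity) ?_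
    nlinarith
  have hsub : deviationSet α μ A X N = ⋃ a, {ω | ((N : ℝ) / 2) ^ α ≤ pulls (fun t => A t ω) N a ∧
      (N : ℝ) ^ (-(3 * α / 8)) <
        |sampleMean (fun t => A t ω) (fun t => X t ω) N a - μ a|} := by
    simp only [deviationSet, Set.ofPred_exists]
  rw [hsub]
  refine (measure_iUnion_fintype_le _ _).trans ?_
  calc _ ≤ ∑ _a : Fin K, ENNReal.ofReal (2 * Real.exp (-(1 / (8 * V)) * (N : ℝ) ^ (α / 4))) := by
        refine Finset.sum_le_sum fun a _ => ?_
        have := isProbabilityMeasure_armLaw hρ (hμ a)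
        refine (h.measure_deviation_le hV (hl a) (Real.rpow_pos_of_pos hN0 _)
          (Real.rpow_le_one_of_one_le_of_nonpos hN1 (by linarith))
          (Real.rpow_pos_of_pos (by positivity) _) N).trans ?_
        refine ENNReal.ofReal_le_ofReal ?_
        gcongr
        linarith
    _ = _ := by
        rw [Finset.sum_const, Finset.card_univ, Fintype.card_fin, nsmul_eq_mul,
          ← ENNReal.ofReal_natCast, ← ENNReal.ofReal_mul (by positivity)]
        congr 1
        ring

end Run

/-! ### A random time with a finite moment after which no bad event occurs -/

lemma summable_pow_mul_exp_neg_rpow {c q : ℝ} (hc : 0 < c) (hq : 0 < q) (p : ℕ) :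
    Summable fun N : ℕ => ((N : ℝ) + 1) ^ p * Real.exp (-c * (N : ℝ) ^ q) := by
  have h1 := (isLittleO_exp_neg_mul_rpow_atTop hc (-((p : ℝ) + 2) / q)).bound one_pos
  have h2 : Tendsto (fun N : ℕ => (N : ℝ) ^ q) atTop atTop :=
    (tendsto_rpow_atTop hq).comp tendsto_natCast_atTop_atTop
  have h3 : Summable fun N : ℕ => 2 ^ p * (N : ℝ) ^ (-2 : ℝ) :=
    (Real.summable_nat_rpow.2 (by norm_num)).mul_left _
  refine h3.of_norm_bounded_eventually_nat ?_
  filter_upwards [h2.eventually h1, eventually_ge_atTop 1] with N hN hN1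
  have hN1' : (1 : ℝ) ≤ N := by exact_mod_cast hN1
  have hN0 : (0 : ℝ) < N := by linarith
  rw [one_mul, Real.norm_of_nonneg (Real.exp_pos _).le,
    Real.norm_of_nonneg (Real.rpow_nonneg (Real.rpow_nonneg hN0.le _) _),
    ← Real.rpow_mul hN0.le, mul_div_cancel₀ _ hq.ne'] at hN
  rw [Real.norm_of_nonneg (by positivity)]
  calc ((N : ℝ) + 1) ^ p * Real.exp (-c * (N : ℝ) ^ q)
      ≤ (2 * N) ^ p * (N : ℝ) ^ (-((p : ℝ) + 2)) := by
        gcongr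
        linarith
    _ = 2 ^ p * (N : ℝ) ^ (-2 : ℝ) := by
        rw [mul_pow, mul_assoc, ← Real.rpow_natCast (N : ℝ), ← Real.rpow_add hN0]
        congr 2
        ring

/-- If the probabilities of the events `E N` decay fast, then there is a time with finite `p`-th
moment after which none of them occurs: the variable `R = ∑ (N + 1) ^ p 1_{E N}` is integrable and
`R ^ (1 / p)` exceeds the index of every event that occurs. -/
lemma exists_random_time {Ω : Type*} [MeasurableSpace Ω] {P : Measure Ω} [IsProbabilityMeasure P]
    {E : ℕ → Set Ω} (hE : ∀ N, MeasurableSet (E N)) {b : ℕ → ℝ}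
    (hb : ∀ N, P (E N) ≤ ENNReal.ofReal (b N)) {p : ℕ} (hp : p ≠ 0)
    (hsum : Summable fun N : ℕ => ((N : ℝ) + 1) ^ p * b N) :
    ∃ T : Ω → ℕ, Measurable T ∧ Integrable (fun ω => ((T ω : ℝ) + 1) ^ p) P ∧
      ∀ᵐ ω ∂P, ∀ N, T ω ≤ N → ω ∉ E N := by
  set R : Ω → ENNReal := fun ω =>
    ∑' N : ℕ, (E N).indicator (fun _ => ENNReal.ofReal (((N : ℝ) + 1) ^ p)) ω with hR
  have hRm : Measurable R := Measurable.tsum fun N => measurable_const.indicator (hE N)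
  have hRi : ∫⁻ ω, R ω ∂P ≠ ⊤ := by
    rw [hR, lintegral_tsum fun N => (measurable_const.indicator (hE N)).aemeasurable]
    refine ne_top_of_le_ne_top hsum.tsum_ofReal_ne_top (ENNReal.tsum_le_tsum fun N => ?_)
    rw [lintegral_indicator_const (hE N), ENNReal.ofReal_mul (by positivity)]
    gcongr
    exact hb N
  have hRfin := ae_lt_top hRm hRi
  have hRint : Integrable (fun ω => (R ω).toReal) P :=
    integrable_toReal_of_lintegral_ne_top hRm.aemeasurable hRi
  have hTm : Measurable fun ω => ⌈(R ω).toReal ^ (1 / (p : ℝ))⌉₊ :=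
    Nat.measurable_ceil.comp (hRm.ennreal_toReal.pow_const _)
  have hp0 : (p : ℝ) ≠ 0 := by exact_mod_cast hp
  have hroot : ∀ y : ℝ, 0 ≤ y → (y ^ (1 / (p : ℝ))) ^ p = y := fun y hy => by
    rw [← Real.rpow_natCast, ← Real.rpow_mul hy, one_div_mul_cancel hp0, Real.rpow_one]
  refine ⟨fun ω => ⌈(R ω).toReal ^ (1 / (p : ℝ))⌉₊, hTm, ?_, ?_⟩
  · refine Integrable.mono' ((hRint.add (integrable_const 1)).const_mul (3 ^ p))
      ((measurable_from_top (f := fun n : ℕ => ((n : ℝ) + 1) ^ p)).comp hTm).aestronglyMeasurable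
      (Eventually.of_forall fun ω => ?_)
    have hy : 0 ≤ (R ω).toReal := ENNReal.toReal_nonneg
    set y := (R ω).toReal with hy_def
    have hz : 0 ≤ y ^ (1 / (p : ℝ)) := Real.rpow_nonneg hy _
    have h1 := (Nat.ceil_lt_add_one hz).le
    have h2 := hroot y hy
    set z := y ^ (1 / (p : ℝ)) with hz_def
    rw [Real.norm_of_nonneg (by positivity)]
    simp only [Pi.add_apply]
    calc ((⌈z⌉₊ : ℝ) + 1) ^ p ≤ (3 * max z 1) ^ p := by
          gcongr
          linarith [le_max_left z 1, le_max_right z 1]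
      _ = 3 ^ p * (max z 1) ^ p := mul_pow _ _ _
      _ ≤ 3 ^ p * (y + 1) := by
          gcongr
          rcases le_total z 1 with hz1 | hz1
          · rw [max_eq_right hz1, one_pow]
            linarith
          · rw [max_eq_left hz1, h2]
            linarith
  · filter_upwards [hRfin] with ω hω N hN hmem
    have h1 : ENNReal.ofReal (((N : ℝ) + 1) ^ p) ≤ R ω := by
      refine le_trans (le_of_eq ?_) (ENNReal.le_tsum N)
      rw [Set.indicator_of_mem hmem]
    have h2 : ((N : ℝ) + 1) ^ p ≤ (R ω).toReal := (ENNReal.ofReal_le_iff_le_toReal hω.ne).1 h1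
    rw [← hroot (R ω).toReal ENNReal.toReal_nonneg] at h2
    have h3 := le_of_pow_le_pow_left₀ hp (Real.rpow_nonneg ENNReal.toReal_nonneg _) h2
    have h4 := (Nat.le_ceil ((R ω).toReal ^ (1 / (p : ℝ)))).trans (Nat.cast_le.2 hN)
    linarith

end AnchoredTop2

theorem proposition5p1
    (ρ : Measure ℝ) (hρ : ∀ c : ℝ, ¬ ∀ᵐ x ∂ρ, x = c)
    (K : ℕ) (hK : 2 ≤ K) (α : ℝ) (hα0 : 0 < α) (hα1 : α < 1)
    (μ : Fin K → ℝ) (hμ : ∀ a, μ a ∈ AnchoredTop2.meanSet ρ)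
    (i₁ : Fin K) (hbest : ∀ a, a ≠ i₁ → μ a < μ i₁) :
    ∃ C : ℝ, 0 < C ∧
      ∀ (r : AnchoredTop2.Rule) (Ω : Type*) [mΩ : MeasurableSpace Ω]
        (P : Measure Ω) [IsProbabilityMeasure P] (𝓕 : Filtration ℕ mΩ)
        (A : ℕ → Ω → Fin K) (X : ℕ → Ω → ℝ),
        AnchoredTop2.IsRun ρ r α μ P 𝓕 A X →
        ∃ T : Ω → ℕ, Measurable T ∧ Integrable (fun ω => (T ω : ℝ)) P ∧
          ∀ᵐ ω ∂P, ∀ N : ℕ, T ω ≤ N →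
            -- the numbers of pulls after iteration `N`
            let n : Fin K → ℝ := fun a => (AnchoredTop2.pulls (fun t => A t ω) N a : ℝ)
            AnchoredTop2.anchor ρ i₁ μ (AnchoredTop2.proportion (fun t => A t ω) N) =
                ∑ a ∈ Finset.univ.erase i₁,
                  AnchoredTop2.kl ρ (μ i₁) (AnchoredTop2.mix μ n i₁ a) /
                    AnchoredTop2.kl ρ (μ a) (AnchoredTop2.mix μ n i₁ a) - 1 ∧
              |AnchoredTop2.anchor ρ i₁ μ (AnchoredTop2.proportion (fun t => A t ω) N)| ≤
                C * (N : ℝ) ^ (-(3 * α / 8)) ∧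
              -- the index against arm `i₁`, and against any empirically best arm
              ∀ i : Fin K,
                (i = i₁ ∨ ∀ b,
                  AnchoredTop2.sampleMean (fun t => A t ω) (fun t => X t ω) N b ≤
                    AnchoredTop2.sampleMean (fun t => A t ω) (fun t => X t ω) N i) →
                ∀ a b : Fin K, a ≠ i₁ → b ≠ i₁ →
                  |AnchoredTop2.index ρ μ n i a - AnchoredTop2.index ρ μ n i b| ≤
                    C * (N : ℝ) ^ (1 - 3 * α / 8) := by
  obtain ⟨C, hC, M, p, hstable⟩ :=
    AnchoredTop2.exists_forall_stable hρ hK hα0 hα1 hμ hbest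
  obtain ⟨V, hV, hexp⟩ := AnchoredTop2.exists_lintegral_exp_le hρ hμ
  refine ⟨C, hC, fun r Ω mΩ P _ 𝓕 A X h => ?_⟩
  have hsum : Summable fun N : ℕ => ((N : ℝ) + 1) ^ (p + 1) *
      (2 * K * Real.exp (-(1 / (8 * V)) * (N : ℝ) ^ (α / 4))) := by
    refine ((AnchoredTop2.summable_pow_mul_exp_neg_rpow (c := 1 / (8 * V)) (q := α / 4)
      (by positivity) (by positivity) (p + 1)).mul_left (2 * (K : ℝ))).congr fun N => ?_
    ring
  obtain ⟨T₀, hT₀, hint, hT₀E⟩ := AnchoredTop2.exists_random_time h.measurableSet_deviationSet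
    (h.measure_deviationSet_le hρ hα0 hα1 (by omega) hμ hV hexp) p.succ_ne_zero hsum
  have hTm : Measurable fun ω => M * (T₀ ω + 1) ^ (p + 1) :=
    (measurable_from_top (f := fun n : ℕ => M * (n + 1) ^ (p + 1))).comp hT₀
  refine ⟨fun ω => M * (T₀ ω + 1) ^ (p + 1), hTm, ?_, ?_⟩
  · push_cast
    exact hint.const_mul (M : ℝ)
  · filter_upwards [h.choice, hT₀E] with ω hchoice hω N hN
    refine hstable r (fun t => A t ω) (fun t => X t ω) (T₀ ω) hchoice (fun N hN a ha => ?_) N ?_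
    · by_contra hlt
      exact hω N hN ⟨a, ha, not_le.1 hlt⟩
    · refine le_trans (Nat.mul_le_mul_left M ?_) hN
      exact Nat.pow_le_pow_right (by omega) (Nat.le_succ p)
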